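/- Let $\Bbbk$ be a field of characteristic zero. Let $\mathrm{PostLie}$ be the (symmetric) operad of right post-Lie algebras, that is, of vector spaces with bilinear operations $[a_1,a_2]$ and $a_1\triangleleft a_2$ satisfying $[a_1,a_2]=-[a_2,a_1]$ and $$[[a_1,a_2],a_3]-[[a_1,a_3],a_2]=[a_1,[a_2,a_3]],\qquad [a_1,a_2]\triangleleft a_3=[a_1\triangleleft a_3,a_2]+[a_1,a_2\triangleleft a_3],$$ $$\bigl((a_1\triangleleft a_2)\triangleleft a_3-a_1\triangleleft(a_2\triangleleft a_3)\bigr)-\bigl((a_1\triangleleft a_3)\triangleleft a_2-a_1\triangleleft(a_3\triangleleft a_2)\bigr)=a_1\triangleleft[a_2,a_3].$$ Let $\mathrm{TriDend}$ be the operad of tridendriform algebras, that is, of vector spaces with bilinear operations $\prec$, $\succ$, $\cdot$ satisfying $$(a_1\prec a_2)\prec a_3=a_1\prec(a_2\prec a_3)+a_1\prec(a_2\succ a_3)+a_1\prec(a_2\cdot a_3),$$ $$(a_1\cdot a_2)\prec a_3=a_1\cdot(a_2\prec a_3),\quad (a_1\cdot a_2)\cdot a_3=a_1\cdot(a_2\cdot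 a_3),\quad (a_1\succ a_2)\prec a_3=a_1\succ(a_2\prec a_3),$$ $$(a_1\prec a_2)\cdot a_3=a_1\cdot(a_2\succ a_3),\quad (a_1\succ a_2)\cdot a_3=a_1\succ(a_2\cdot a_3),$$ $$(a_1\prec a_2)\succ a_3+(a_1\succ a_2)\succ a_3+(a_1\cdot a_2)\succ a_3=a_1\succ(a_2\succ a_3).$$ Let $\phi\colon\mathrm{PostLie}\to\mathrm{TriDend}$ be the morphism of operads with $\phi([a_1,a_2])=a_1\cdot a_2-a_2\cdot a_1$ and $\phi(a_1\triangleleft a_2)=a_1\prec a_2-a_2\succ a_1$. **Theorem.** The datum $(\mathrm{PostLie},\mathrm{TriDend},\phi)$ has the PBW property: the pullback functor $\phi^*$ from $\mathrm{TriDend}$-algebras to $\mathrm{PostLie}$-algebras has a left adjoint $\phi_!$ (the universal enveloping tridendriform algebra), and there is an endofunctor $\mathcal X$ of the category of $\Bbbk$-vector spaces such that the underlying vector space of $\phi_!(A)$ is isomorphic to $\mathcal X(A)$, naturally with respect to morphisms of $\mathrm{PostLie}$-algebras $A$. Moreover, $\mathrm{TriDend}$, viewed as a right $\mathrm{PostLie}$-module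 via $\phi$, is free, that is, it is isomorphic to the free right $\mathrm{PostLie}$-module generated by some symmetric sequence of $\Bbbk$-vector spaces. -/

import Mathlib

open CategoryTheory

universe u

namespace FunctorialPBW

/-! ## Symmetric sequences and symmetric operads

Symmetric sequences are indexed by finite sets: a symmetric sequence is a functor from finite sets
and bijections to vector spaces; its value at `Fin n` is the usual `n`-th component with its action
of the symmetric group. -/

/-- A symmetric sequence of `k`-vector spaces. -/
structure SymmSeq (k : Type u) [Field k] where
  obj : (I : Type) → [Finite I] → Type u
  [addCommGroup : ∀ (I : Type) [Finite I], AddCommGroup (obj I)]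
  [module : ∀ (I : Type) [Finite I], Module k (obj I)]
  /-- the action of bijections -/
  relabel : ∀ {I J : Type} [Finite I] [Finite J], (I ≃ J) → (obj I →ₗ[k] obj J)
  relabel_refl : ∀ {I : Type} [Finite I] (x : obj I), relabel (Equiv.refl I) x = x
  relabel_trans : ∀ {I J K : Type} [Finite I] [Finite J] [Finite K] (σ : I ≃ J) (τ : J ≃ K)
    (x : obj I), relabel (σ.trans τ) x = relabel τ (relabel σ x)

attribute [instance] SymmSeq.addCommGroup SymmSeq.module

/-- A morphism of symmetric sequences: an equivariant family of linear maps. -/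
structure SymmSeq.Hom {k : Type u} [Field k] (X Y : SymmSeq k) where
  app : ∀ (I : Type) [Finite I], X.obj I →ₗ[k] Y.obj I
  app_relabel : ∀ {I J : Type} [Finite I] [Finite J] (σ : I ≃ J) (x : X.obj I),
    app J (X.relabel σ x) = Y.relabel σ (app I x)

/-- A symmetric operad over `k`: `comp p q` is the composite `p(q i, i ∈ I)`, which inserts the
operation `q i` with set of inputs `J i` into the input `i` of `p`. -/
structure Operad (k : Type u) [Field k] extends SymmSeq k where
  one : obj Unit
  comp : ∀ {I : Type} [Finite I] {J : I → Type} [∀ i, Finite (J i)],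
    obj I →ₗ[k] MultilinearMap k (fun i => obj (J i)) (obj (Σ i, J i))
  one_comp : ∀ {I : Type} [Finite I] (p : obj I),
    relabel (Equiv.uniqueSigma (fun _ : Unit => I)) (comp one (fun _ : Unit => p)) = p
  comp_one : ∀ {I : Type} [Finite I] (p : obj I),
    relabel (Equiv.sigmaPUnit I) (comp p (fun _ : I => one)) = p
  comp_assoc : ∀ {I : Type} [Finite I] {J : I → Type} [∀ i, Finite (J i)]
    {K : (i : I) → J i → Type} [∀ i j, Finite (K i j)]
    (p : obj I) (q : ∀ i, obj (J i)) (r : ∀ i j, obj (K i j)),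
    relabel (Equiv.sigmaAssoc K) (comp (comp p q) (fun x : (Σ i, J i) => r x.1 x.2)) =
      comp p (fun i => comp (q i) (r i))
  relabel_comp : ∀ {I I' : Type} [Finite I] [Finite I'] {J : I' → Type} [∀ i, Finite (J i)]
    (σ : I ≃ I') (p : obj I) (q : ∀ i, obj (J i)),
    comp (relabel σ p) q = relabel (Equiv.sigmaCongrLeft σ) (comp p (fun i => q (σ i)))
  comp_relabel : ∀ {I : Type} [Finite I] {J J' : I → Type} [∀ i, Finite (J i)]
    [∀ i, Finite (J' i)] (τ : ∀ i, J i ≃ J' i) (p : obj I) (q : ∀ i, obj (J i)),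
    comp p (fun i => relabel (τ i) (q i)) = relabel (Equiv.sigmaCongrRight τ) (comp p q)

/-- A morphism of operads. -/
structure Operad.Hom {k : Type u} [Field k] (P Q : Operad k) extends
    SymmSeq.Hom P.toSymmSeq Q.toSymmSeq where
  app_one : app Unit P.one = Q.one
  app_comp : ∀ {I : Type} [Finite I] {J : I → Type} [∀ i, Finite (J i)]
    (p : P.obj I) (q : ∀ i, P.obj (J i)),
    app (Σ i, J i) (P.comp p q) = Q.comp (app I p) (fun i => app (J i) (q i))

/-! ## Right modules -/

/-- A right module over the operad `P`. -/
structure RightModule {k : Type u} [Field k] (P : Operad k) extends SymmSeq k where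
  act : ∀ {I : Type} [Finite I] {J : I → Type} [∀ i, Finite (J i)],
    obj I →ₗ[k] MultilinearMap k (fun i => P.obj (J i)) (obj (Σ i, J i))
  act_one : ∀ {I : Type} [Finite I] (m : obj I),
    relabel (Equiv.sigmaPUnit I) (act m (fun _ : I => P.one)) = m
  act_assoc : ∀ {I : Type} [Finite I] {J : I → Type} [∀ i, Finite (J i)]
    {K : (i : I) → J i → Type} [∀ i j, Finite (K i j)]
    (m : obj I) (q : ∀ i, P.obj (J i)) (r : ∀ i j, P.obj (K i j)),
    relabel (Equiv.sigmaAssoc K) (act (act m q) (fun x : (Σ i, J i) => r x.1 x.2)) =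
      act m (fun i => P.comp (q i) (r i))
  relabel_act : ∀ {I I' : Type} [Finite I] [Finite I'] {J : I' → Type} [∀ i, Finite (J i)]
    (σ : I ≃ I') (m : obj I) (q : ∀ i, P.obj (J i)),
    act (relabel σ m) q = relabel (Equiv.sigmaCongrLeft σ) (act m (fun i => q (σ i)))
  act_relabel : ∀ {I : Type} [Finite I] {J J' : I → Type} [∀ i, Finite (J i)]
    [∀ i, Finite (J' i)] (τ : ∀ i, J i ≃ J' i) (m : obj I) (q : ∀ i, P.obj (J i)),
    act m (fun i => P.relabel (τ i) (q i)) = relabel (Equiv.sigmaCongrRight τ) (act m q)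

/-- A morphism of right modules. -/
structure RightModule.Hom {k : Type u} [Field k] {P : Operad k} (M N : RightModule P) extends
    SymmSeq.Hom M.toSymmSeq N.toSymmSeq where
  app_act : ∀ {I : Type} [Finite I] {J : I → Type} [∀ i, Finite (J i)]
    (m : M.obj I) (q : ∀ i, P.obj (J i)),
    app (Σ i, J i) (M.act m q) = N.act (app I m) q

/-- A right module is free if it is freely generated by some symmetric sequence `X`, that is, if it
has, together with a map from `X`, the universal property of the free right module on `X`. -/
def RightModule.IsFree {k : Type u} [Field k] {P : Operad k} (M : RightModule P) : Prop :=
  ∃ (X : SymmSeq k) (ι : SymmSeq.Hom X M.toSymmSeq),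
    ∀ (N : RightModule P) (f : SymmSeq.Hom X N.toSymmSeq),
      ∃! g : RightModule.Hom M N,
        ∀ (I : Type) [Finite I] (x : X.obj I), g.app I (ι.app I x) = f.app I x

/-- The right `P`-module structure on `Q` defined by a morphism of operads `φ : P → Q`. -/
noncomputable def Operad.Hom.rightModule {k : Type u} [Field k] {P Q : Operad k}
    (φ : Operad.Hom P Q) : RightModule P where
  toSymmSeq := Q.toSymmSeq
  act {_ _ J _} := (MultilinearMap.compLinearMapₗ (fun i => φ.app (J i))) ∘ₗ Q.comp
  act_one m := by
    simp only [LinearMap.comp_apply, MultilinearMap.compLinearMapₗ_apply,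
      MultilinearMap.compLinearMap_apply, φ.app_one]
    exact Q.comp_one m
  act_assoc m q r := by
    simp only [LinearMap.comp_apply, MultilinearMap.compLinearMapₗ_apply,
      MultilinearMap.compLinearMap_apply, φ.app_comp]
    exact Q.comp_assoc m (fun i => φ.app _ (q i)) (fun i j => φ.app _ (r i j))
  relabel_act σ m q := by
    simp only [LinearMap.comp_apply, MultilinearMap.compLinearMapₗ_apply,
      MultilinearMap.compLinearMap_apply]
    exact Q.relabel_comp σ m (fun i => φ.app _ (q i))
  act_relabel τ m q := by
    simp only [LinearMap.comp_apply, MultilinearMap.compLinearMapₗ_apply,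
      MultilinearMap.compLinearMap_apply, φ.app_relabel]
    exact Q.comp_relabel τ m (fun i => φ.app _ (q i))

/-! ## Algebras over operads and the PBW property -/

/-- An algebra over the operad `P`: a vector space on which every `p ∈ P(I)` acts by a multilinear
operation with set of arguments `I`. -/
structure Operad.Alg {k : Type u} [Field k] (P : Operad k) where
  carrier : Type u
  [addCommGroup : AddCommGroup carrier]
  [module : Module k carrier]
  act : ∀ {I : Type} [Finite I],
    P.obj I →ₗ[k] MultilinearMap k (fun _ : I => carrier) carrier
  act_one : ∀ a : Unit → carrier, act P.one a = a ()
  act_comp : ∀ {I : Type} [Finite I] {J : I → Type} [∀ i, Finite (J i)]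
    (p : P.obj I) (q : ∀ i, P.obj (J i)) (a : (Σ i, J i) → carrier),
    act (P.comp p q) a = act p (fun i => act (q i) (fun j => a ⟨i, j⟩))
  act_relabel : ∀ {I J : Type} [Finite I] [Finite J] (σ : I ≃ J) (p : P.obj I)
    (a : J → carrier), act (P.relabel σ p) a = act p (fun i => a (σ i))

attribute [instance] Operad.Alg.addCommGroup Operad.Alg.module

/-- A morphism of `P`-algebras: a linear map that commutes with all operations of `P`. -/
@[ext]
structure Operad.Alg.Hom {k : Type u} [Field k] {P : Operad k} (A B : P.Alg) where
  toLinearMap : A.carrier →ₗ[k] B.carrier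
  map_act : ∀ {I : Type} [Finite I] (p : P.obj I) (a : I → A.carrier),
    toLinearMap (A.act p a) = B.act p (fun i => toLinearMap (a i))

instance Operad.Alg.category {k : Type u} [Field k] (P : Operad k) : Category P.Alg where
  Hom A B := Operad.Alg.Hom A B
  id A := ⟨LinearMap.id, fun _ _ => rfl⟩
  comp f g := ⟨g.toLinearMap ∘ₗ f.toLinearMap, fun p a => by
    simp only [LinearMap.comp_apply, f.map_act, g.map_act]⟩

/-- The forgetful functor from `P`-algebras to vector spaces. -/
def Operad.Alg.forgetful {k : Type u} [Field k] (P : Operad k) : P.Alg ⥤ ModuleCat.{u} k where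
  obj A := ModuleCat.of k A.carrier
  map f := ModuleCat.ofHom f.toLinearMap

/-- The pullback functor `φ^*` from `Q`-algebras to `P`-algebras. -/
def Operad.Hom.pullback {k : Type u} [Field k] {P Q : Operad k} (φ : Operad.Hom P Q) :
    Q.Alg ⥤ P.Alg where
  obj B :=
    { carrier := B.carrier
      act := fun {I} _ => B.act ∘ₗ φ.app I
      act_one := fun a => by
        simp only [LinearMap.comp_apply, φ.app_one]
        exact B.act_one a
      act_comp := fun p q a => by
        simp only [LinearMap.comp_apply, φ.app_comp]
        exact B.act_comp _ _ a
      act_relabel := fun σ p a => by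
        simp only [LinearMap.comp_apply, φ.app_relabel]
        exact B.act_relabel σ _ a }
  map f := ⟨f.toLinearMap, fun p a => f.map_act (φ.app _ p) a⟩

/-- The datum `(P, Q, φ)` has the PBW property: the pullback functor `φ^*` has a left adjoint `φ_!`
(the universal enveloping algebra functor), and there is an endofunctor `X` of the category of
vector spaces such that the underlying vector space of `φ_! A` is isomorphic to `X` applied to the
underlying vector space of `A`, naturally in the `P`-algebra `A`. -/
def Operad.Hom.HasPBWProperty {k : Type u} [Field k] {P Q : Operad k} (φ : Operad.Hom P Q) :
    Prop :=
  ∃ (U : P.Alg ⥤ Q.Alg) (_ : U ⊣ φ.pullback) (X : ModuleCat.{u} k ⥤ ModuleCat.{u} k),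
    Nonempty (U ⋙ Operad.Alg.forgetful Q ≅ Operad.Alg.forgetful P ⋙ X)

/-! ## Varieties of algebras with binary operations, and their operads -/

/-- Nonassociative monomials with variables in `X` and binary operation symbols in `E`. -/
inductive Mon (E X : Type) : Type
  | var : X → Mon E X
  | node : E → Mon E X → Mon E X → Mon E X

/-- The list of variables of a monomial, with repetitions. -/
def Mon.vars {E X : Type} : Mon E X → List X
  | .var x => [x]
  | .node _ l r => l.vars ++ r.vars

/-- Evaluation of a monomial in a vector space with bilinear operations `op e`. -/
def Mon.eval {k : Type u} [Field k] {E X : Type} {A : Type u} [AddCommGroup A] [Module k A]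
    (op : E → A →ₗ[k] A →ₗ[k] A) (a : X → A) : Mon E X → A
  | .var x => a x
  | .node e l r => op e (l.eval op a) (r.eval op a)

/-- Nonassociative polynomials: the free vector space with bilinear operations `E` on `X`. -/
abbrev Poly (k : Type u) [Field k] (E X : Type) : Type u := Mon E X →₀ k

namespace Poly

variable {k : Type u} [Field k] {E X : Type}

/-- The variable `x`. -/
noncomputable def var (x : X) : Poly k E X := Finsupp.single (Mon.var x) 1

/-- The bilinear operation `e` on polynomials. -/
noncomputable def op (e : E) : Poly k E X →ₗ[k] Poly k E X →ₗ[k] Poly k E X :=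
  Finsupp.linearCombination k (fun l => Finsupp.lmapDomain k k (Mon.node e l))

/-- Evaluation of polynomials. -/
noncomputable def eval {A : Type u} [AddCommGroup A] [Module k A]
    (op : E → A →ₗ[k] A →ₗ[k] A) (a : X → A) : Poly k E X →ₗ[k] A :=
  Finsupp.linearCombination k (Mon.eval op a)

theorem op_single (e : E) (l r : Mon E X) :
    op e (Finsupp.single l (1 : k)) (Finsupp.single r 1) = Finsupp.single (Mon.node e l r) 1 := by
  simp [op]

theorem eval_single {A : Type u} [AddCommGroup A] [Module k A]
    (o : E → A →ₗ[k] A →ₗ[k] A) (a : X → A) (t : Mon E X) :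
    eval o a (Finsupp.single t 1) = t.eval o a := by
  simp [eval]

theorem eval_var {A : Type u} [AddCommGroup A] [Module k A]
    (o : E → A →ₗ[k] A →ₗ[k] A) (a : X → A) (x : X) : eval o a (var x) = a x := by
  simp [eval, var, Mon.eval]

theorem eval_op {A : Type u} [AddCommGroup A] [Module k A]
    (o : E → A →ₗ[k] A →ₗ[k] A) (a : X → A) (e : E) (s t : Poly k E X) :
    eval o a (op e s t) = o e (eval o a s) (eval o a t) := by
  have h : (op e).compr₂ (eval o a) = (o e).compl₁₂ (eval o a) (eval o a) := by
    ext l r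
    simp [op, eval, Mon.eval]
  simpa using LinearMap.congr_fun₂ h s t

theorem hom_eval {Y : Type} {A B : Type u} [AddCommGroup A] [Module k A] [AddCommGroup B]
    [Module k B] {o : E → A →ₗ[k] A →ₗ[k] A} {o' : E → B →ₗ[k] B →ₗ[k] B} (f : A →ₗ[k] B)
    (hf : ∀ e x y, f (o e x y) = o' e (f x) (f y)) (a : Y → A) (s : Poly k E Y) :
    f (eval o a s) = eval o' (fun y => f (a y)) s := by
  have h : f ∘ₗ eval o a = eval o' (fun y => f (a y)) := by
    ext t
    simp only [LinearMap.comp_apply, Finsupp.lsingle_apply, eval_single]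
    induction t with
    | var x => rfl
    | node e l r hl hr => simp only [Mon.eval, hf, hl, hr]
  exact LinearMap.congr_fun h s

end Poly

/-- A variety of algebras: a set of binary operations without symmetries, and a set of identities
(polynomials that are required to vanish identically). -/
structure Variety (k : Type u) [Field k] where
  Op : Type
  ident : Set (Poly k Op ℕ)

namespace Variety

variable {k : Type u} [Field k] (V : Variety k)

/-- The bilinear operations `o` on `A` satisfy the identities of the variety. -/
def IsModel {A : Type u} [AddCommGroup A] [Module k A] (o : V.Op → A →ₗ[k] A →ₗ[k] A) : Prop :=
  ∀ r ∈ V.ident, ∀ a : ℕ → A, Poly.eval o a r = 0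

/-- The ideal of consequences of the identities: the smallest ideal that contains all values of the
identities. -/
inductive Conseq (X : Type) : Poly k V.Op X → Prop
  | ident (r : Poly k V.Op ℕ) (hr : r ∈ V.ident) (s : ℕ → Poly k V.Op X) :
      Conseq X (Poly.eval Poly.op s r)
  | zero : Conseq X 0
  | add (s t : Poly k V.Op X) : Conseq X s → Conseq X t → Conseq X (s + t)
  | smul (c : k) (s : Poly k V.Op X) : Conseq X s → Conseq X (c • s)
  | op_left (e : V.Op) (s t : Poly k V.Op X) : Conseq X s → Conseq X (Poly.op e s t)
  | op_right (e : V.Op) (s t : Poly k V.Op X) : Conseq X t → Conseq X (Poly.op e s t)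

/-- The ideal of consequences, as a subspace. -/
noncomputable def ideal (X : Type) : Submodule k (Poly k V.Op X) where
  carrier := {s | V.Conseq X s}
  add_mem' hs ht := Conseq.add _ _ hs ht
  zero_mem' := Conseq.zero
  smul_mem' c _ hs := Conseq.smul c _ hs

/-- The free algebra of the variety on the set `X`. -/
abbrev Free (X : Type) : Type u := Poly k V.Op X ⧸ V.ideal X

/-- The operations of the free algebra. -/
noncomputable def op {X : Type} (e : V.Op) : V.Free X →ₗ[k] V.Free X →ₗ[k] V.Free X :=
  (V.ideal X).liftQ
    (LinearMap.flip ((V.ideal X).liftQ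
      (LinearMap.flip ((Poly.op e).compr₂ (V.ideal X).mkQ)) (by
        intro t ht
        ext s
        exact (Submodule.Quotient.mk_eq_zero _).2 (Conseq.op_right e _ t ht)))) (by
    intro s hs
    ext t
    exact (Submodule.Quotient.mk_eq_zero _).2 (Conseq.op_left e s _ hs))

/-- The generator `x` of the free algebra. -/
noncomputable def gen {X : Type} (x : X) : V.Free X := (V.ideal X).mkQ (Poly.var x)

theorem op_mk {X : Type} (e : V.Op) (s t : Poly k V.Op X) :
    V.op e ((V.ideal X).mkQ s) ((V.ideal X).mkQ t) = (V.ideal X).mkQ (Poly.op e s t) := rfl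

theorem isModel_free (X : Type) : V.IsModel (V.op (X := X)) := by
  intro r hr a
  choose s hs using fun n => Submodule.mkQ_surjective (V.ideal X) (a n)
  have h := Poly.hom_eval (V.ideal X).mkQ (fun e x y => (V.op_mk e x y).symm) s r
  simp only [hs] at h
  rw [← h]
  exact (Submodule.Quotient.mk_eq_zero _).2 (Conseq.ident r hr s)

/-- The homomorphism from the free algebra on `X` to an algebra `A` of the variety that extends a
map `a : X → A`. -/
noncomputable def lift {X : Type} {A : Type u} [AddCommGroup A] [Module k A]
    (o : V.Op → A →ₗ[k] A →ₗ[k] A) (h : V.IsModel o) (a : X → A) : V.Free X →ₗ[k] A :=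
  (V.ideal X).liftQ (Poly.eval o a) (by
    intro s hs
    change Poly.eval o a s = 0
    have hs' : V.Conseq X s := hs
    clear hs
    induction hs' with
    | ident r hr s =>
      rw [Poly.hom_eval (Poly.eval o a) (fun e x y => Poly.eval_op o a e x y)]
      exact h r hr _
    | zero => simp
    | add s t _ _ h1 h2 => simp [h1, h2]
    | smul c s _ h1 => simp [h1]
    | op_left e s t _ h1 => simp [Poly.eval_op, h1]
    | op_right e s t _ h1 => simp [Poly.eval_op, h1])

section lift

variable {X : Type} {A B : Type u} [AddCommGroup A] [Module k A] [AddCommGroup B] [Module k B]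
  {o : V.Op → A →ₗ[k] A →ₗ[k] A} (h : V.IsModel o)
  {o' : V.Op → B →ₗ[k] B →ₗ[k] B}

theorem lift_mk (a : X → A) (s : Poly k V.Op X) :
    V.lift o h a ((V.ideal X).mkQ s) = Poly.eval o a s := rfl

theorem lift_gen (a : X → A) (x : X) : V.lift o h a (V.gen x) = a x := Poly.eval_var o a x

theorem lift_op (a : X → A) (e : V.Op) (s t : V.Free X) :
    V.lift o h a (V.op e s t) = o e (V.lift o h a s) (V.lift o h a t) := by
  obtain ⟨s, rfl⟩ := Submodule.mkQ_surjective _ s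
  obtain ⟨t, rfl⟩ := Submodule.mkQ_surjective _ t
  rw [op_mk, lift_mk, lift_mk, lift_mk, Poly.eval_op]

theorem hom_lift (h : V.IsModel o) (h' : V.IsModel o') (f : A →ₗ[k] B) (hf : ∀ e x y, f (o e x y) = o' e (f x) (f y)) (a : X → A)
    (s : V.Free X) : f (V.lift o h a s) = V.lift o' h' (fun x => f (a x)) s := by
  obtain ⟨s, rfl⟩ := Submodule.mkQ_surjective _ s
  rw [lift_mk, lift_mk, Poly.hom_eval f hf]

theorem lift_gen_id (s : V.Free X) : V.lift V.op (V.isModel_free X) V.gen s = s := by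
  obtain ⟨s, rfl⟩ := Submodule.mkQ_surjective _ s
  have h1 : ∀ t : Mon V.Op X, t.eval (Poly.op (k := k)) Poly.var = Finsupp.single t 1 := by
    intro t
    induction t with
    | var x => rfl
    | node e l r hl hr => rw [Mon.eval, hl, hr, Poly.op_single]
  have h2 : Poly.eval (k := k) (E := V.Op) (X := X) Poly.op Poly.var = LinearMap.id := by
    ext t : 1
    ext
    simp [Poly.eval_single, h1]
  have h3 := Poly.hom_eval (V.ideal X).mkQ (fun e x y => (V.op_mk e x y).symm) Poly.var s
  rw [h2] at h3
  exact h3.symm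

theorem lift_lift {Y : Type} (a : X → A) (b : Y → V.Free X) (s : V.Free Y) :
    V.lift o h a (V.lift V.op (V.isModel_free X) b s) =
      V.lift o h (fun y => V.lift o h a (b y)) s :=
  V.hom_lift (V.isModel_free X) h (V.lift o h a) (V.lift_op h a) b s

end lift

/-- The subspace of the free algebra on `X` spanned by the multilinear monomials in the elements of
`S`: those in which every element of `S` occurs exactly once, and no other variable occurs. -/
noncomputable def multilin {X : Type} (S : Set X) : Submodule k (V.Free X) :=
  Submodule.span k {z | ∃ t : Mon V.Op X, t.vars.Nodup ∧ {x | x ∈ t.vars} = S ∧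
    z = (V.ideal X).mkQ (Finsupp.single t 1)}

theorem gen_mem {X : Type} (x : X) : V.gen x ∈ V.multilin {x} :=
  Submodule.subset_span ⟨Mon.var x, by simp [Mon.vars], by ext; simp [Mon.vars], rfl⟩

theorem op_mem {X : Type} (e : V.Op) {S T : Set X} (hST : Disjoint S T) {s t : V.Free X}
    (hs : s ∈ V.multilin S) (ht : t ∈ V.multilin T) : V.op e s t ∈ V.multilin (S ∪ T) := by
  induction hs, ht using Submodule.span_induction₂ with
  | mem_mem s t hs ht =>
    obtain ⟨m, hm, rfl, rfl⟩ := hs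
    obtain ⟨n, hn, rfl, rfl⟩ := ht
    rw [op_mk, Poly.op_single]
    refine Submodule.subset_span ⟨_, ?_, ?_, rfl⟩
    · rw [Mon.vars, List.nodup_append']
      exact ⟨hm, hn, fun x h1 h2 => Set.disjoint_left.1 hST h1 h2⟩
    · ext; simp [Mon.vars]
  | zero_left _ _ => simp
  | zero_right _ _ => simp
  | add_left _ _ _ _ _ _ h1 h2 => simpa using add_mem h1 h2
  | add_right _ _ _ _ _ _ h1 h2 => simpa using add_mem h1 h2
  | smul_left c _ _ _ _ h1 => simpa using Submodule.smul_mem _ c h1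
  | smul_right c _ _ _ _ h1 => simpa using Submodule.smul_mem _ c h1

/-- Substituting multilinear elements in disjoint sets of variables into a multilinear element
gives a multilinear element. -/
theorem lift_mem {W : Variety k} {X Y : Type} {o : V.Op → W.Free Y →ₗ[k] W.Free Y →ₗ[k] W.Free Y}
    (h : V.IsModel o)
    (ho : ∀ (e : V.Op) (S T : Set Y) (s t : W.Free Y), Disjoint S T → s ∈ W.multilin S →
      t ∈ W.multilin T → o e s t ∈ W.multilin (S ∪ T))
    (a : X → W.Free Y) (B : X → Set Y) (hB : Pairwise (fun x y => Disjoint (B x) (B y)))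
    (ha : ∀ x, a x ∈ W.multilin (B x)) {S : Set X} {z : V.Free X} (hz : z ∈ V.multilin S) :
    V.lift o h a z ∈ W.multilin (⋃ x ∈ S, B x) := by
  induction hz using Submodule.span_induction with
  | mem z hz =>
    obtain ⟨t, ht, rfl, rfl⟩ := hz
    rw [lift_mk, Poly.eval_single]
    induction t with
    | var x => simpa [Mon.vars, Mon.eval] using ha x
    | node e l r hl hr =>
      rw [Mon.vars, List.nodup_append'] at ht
      have key := ho e _ _ _ _ ?_ (hl ht.1) (hr ht.2.1)
      · have hU : (⋃ x ∈ {x | x ∈ (Mon.node e l r).vars}, B x) =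
            (⋃ x ∈ {x | x ∈ l.vars}, B x) ∪ ⋃ x ∈ {x | x ∈ r.vars}, B x := by
          ext y
          simp only [Mon.vars, List.mem_append, Set.mem_ofPred_eq, Set.mem_iUnion, Set.mem_union,
            exists_prop, or_and_right, exists_or]
        rw [hU]
        exact key
      · rw [Set.disjoint_left]
        intro y h1 h2
        simp only [Set.mem_iUnion, Set.mem_ofPred_eq] at h1 h2
        obtain ⟨i, hi, hyi⟩ := h1
        obtain ⟨j, hj, hyj⟩ := h2
        have hij : i ≠ j := by
          rintro rfl
          exact ht.2.2 hi hj
        exact Set.disjoint_left.1 (hB hij) hyi hyj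
  | zero => simp
  | add _ _ _ _ h1 h2 => simpa using add_mem h1 h2
  | smul c _ _ h1 => simpa using Submodule.smul_mem _ c h1

section multilinear

variable {X : Type} [DecidableEq X] {A : Type u} [AddCommGroup A] [Module k A]
  {o : V.Op → A →ₗ[k] A →ₗ[k] A}

theorem eval_update_of_notMem (a : X → A) (i : X) (x : A) (t : Mon V.Op X) (hi : i ∉ t.vars) :
    t.eval o (Function.update a i x) = t.eval o a := by
  induction t with
  | var j =>
    have : j ≠ i := by rintro rfl; simp [Mon.vars] at hi
    simp [Mon.eval, this]
  | node e l r hl hr =>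
    simp only [Mon.vars, List.mem_append, not_or] at hi
    rw [Mon.eval, Mon.eval, hl hi.1, hr hi.2]

theorem eval_update_of_mem (a : X → A) (i : X) (t : Mon V.Op X) (ht : t.vars.Nodup)
    (hi : i ∈ t.vars) :
    ∃ f : A →ₗ[k] A, ∀ x, t.eval o (Function.update a i x) = f x := by
  induction t with
  | var j =>
    obtain rfl : i = j := by simpa [Mon.vars] using hi
    exact ⟨LinearMap.id, fun x => by simp [Mon.eval]⟩
  | node e l r hl hr =>
    rw [Mon.vars, List.nodup_append'] at ht
    rw [Mon.vars, List.mem_append] at hi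
    rcases hi with hi | hi
    · obtain ⟨f, hf⟩ := hl ht.1 hi
      refine ⟨(o e).flip (r.eval o a) ∘ₗ f, fun x => ?_⟩
      rw [Mon.eval, hf, V.eval_update_of_notMem a i x r (fun h => ht.2.2 hi h)]
      rfl
    · obtain ⟨f, hf⟩ := hr ht.2.1 hi
      refine ⟨o e (l.eval o a) ∘ₗ f, fun x => ?_⟩
      rw [Mon.eval, hf, V.eval_update_of_notMem a i x l (fun h => ht.2.2 h hi)]
      rfl

theorem lift_update (h : V.IsModel o) (a : X → A) (i : X) {z : V.Free X}
    (hz : z ∈ V.multilin Set.univ) :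
    ∃ f : A →ₗ[k] A, ∀ x, V.lift o h (Function.update a i x) z = f x := by
  induction hz using Submodule.span_induction with
  | mem z hz =>
    obtain ⟨t, ht, hS, rfl⟩ := hz
    obtain ⟨f, hf⟩ := V.eval_update_of_mem (o := o) a i t ht (by
      change i ∈ {x | x ∈ t.vars}
      rw [hS]
      trivial)
    exact ⟨f, fun x => by rw [lift_mk, Poly.eval_single, hf]⟩
  | zero => exact ⟨0, by simp⟩
  | add _ _ _ _ h1 h2 =>
    obtain ⟨f, hf⟩ := h1
    obtain ⟨g, hg⟩ := h2
    exact ⟨f + g, fun x => by simp [hf, hg]⟩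
  | smul c _ _ h1 =>
    obtain ⟨f, hf⟩ := h1
    exact ⟨c • f, fun x => by simp [hf]⟩

end multilinear

/-- The homomorphism of free algebras that renames the variables. -/
noncomputable def rename {X Y : Type} (f : X → Y) : V.Free X →ₗ[k] V.Free Y :=
  V.lift V.op (V.isModel_free Y) (fun x => V.gen (f x))

theorem rename_mem {X Y : Type} (f : X → Y) (hf : Function.Injective f) {S : Set X}
    {z : V.Free X} (hz : z ∈ V.multilin S) : V.rename f z ∈ V.multilin (f '' S) := by
  have h := V.lift_mem (V.isModel_free Y) (fun e _ _ _ _ hd hs ht => V.op_mem e hd hs ht)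
    (fun x => V.gen (f x)) (fun x => {f x})
    (fun x y hxy => by simpa using fun h => hxy (hf h)) (fun x => V.gen_mem (f x)) hz
  have hU : f '' S = ⋃ x ∈ S, {f x} := by
    ext y
    simp [eq_comm]
  rw [hU]
  exact h

/-- The substitution of multilinear elements into a multilinear element. -/
theorem subst_mem {I : Type} {J : I → Type} (p : V.Free I) (hp : p ∈ V.multilin Set.univ)
    (q : ∀ i, V.multilin (Set.univ : Set (J i))) :
    V.lift V.op (V.isModel_free (Σ i, J i)) (fun i => V.rename (Sigma.mk i) (q i).1) p ∈
      V.multilin Set.univ := by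
  have h := V.lift_mem (V.isModel_free (Σ i, J i))
    (fun e _ _ _ _ hd hs ht => V.op_mem e hd hs ht)
    (fun i => V.rename (Sigma.mk i) (q i).1) (fun i => Sigma.mk i '' Set.univ) (by
      intro i j hij
      rw [Set.disjoint_left]
      rintro _ ⟨x, -, rfl⟩ ⟨y, -, hy⟩
      exact hij (congrArg Sigma.fst hy).symm)
    (fun i => V.rename_mem _ sigma_mk_injective (q i).2) hp
  convert h using 2
  ext ⟨i, j⟩
  simp

/-- The multilinear part of the free algebra on `I`: the subspace spanned by the monomials in which
every element of `I` occurs exactly once. -/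
noncomputable abbrev Part (I : Type) : Submodule k (V.Free I) := V.multilin Set.univ

/-- Renaming variables along a bijection. -/
noncomputable def relabelPart {I J : Type} (σ : I ≃ J) : V.Part I →ₗ[k] V.Part J :=
  (V.rename σ).restrict (p := V.Part I) (q := V.Part J) (fun z hz => by
    have h := V.rename_mem σ σ.injective hz
    rwa [Set.image_univ, σ.surjective.range_eq] at h)

theorem relabelPart_coe {I J : Type} (σ : I ≃ J) (z : V.Part I) :
    (V.relabelPart σ z).1 = V.rename σ z.1 := rfl

/-- Composition by substitution. -/
noncomputable def compPart {I : Type} {J : I → Type} :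
    V.Part I →ₗ[k] MultilinearMap k (fun i => V.Part (J i)) (V.Part (Σ i, J i)) where
  toFun p :=
    { toFun := fun q => ⟨_, V.subst_mem p.1 p.2 q⟩
      map_update_add' := by
        intro _ q i x y
        obtain ⟨f, hf⟩ := V.lift_update (V.isModel_free (Σ i, J i))
          (fun i => V.rename (Sigma.mk i) (q i).1) i p.2
        have hu : ∀ z, (fun j => V.rename (Sigma.mk j) (Function.update q i z j).1) =
            Function.update (fun j => V.rename (Sigma.mk j) (q j).1) i
              (V.rename (Sigma.mk i) z.1) := fun z =>
          funext fun j => Function.apply_update (fun j (w : V.Part (J j)) =>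
            V.rename (Sigma.mk j) w.1) q i z j
        apply Subtype.ext
        simp only [hu, hf, Submodule.coe_add, map_add]
      map_update_smul' := by
        intro _ q i c x
        obtain ⟨f, hf⟩ := V.lift_update (V.isModel_free (Σ i, J i))
          (fun i => V.rename (Sigma.mk i) (q i).1) i p.2
        have hu : ∀ z, (fun j => V.rename (Sigma.mk j) (Function.update q i z j).1) =
            Function.update (fun j => V.rename (Sigma.mk j) (q j).1) i
              (V.rename (Sigma.mk i) z.1) := fun z =>
          funext fun j => Function.apply_update (fun j (w : V.Part (J j)) =>
            V.rename (Sigma.mk j) w.1) q i z j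
        apply Subtype.ext
        simp only [hu, hf, Submodule.coe_smul, map_smul] }
  map_add' p p' := MultilinearMap.ext fun q => Subtype.ext (map_add _ _ _)
  map_smul' c p := MultilinearMap.ext fun q => Subtype.ext (map_smul _ _ _)

theorem compPart_coe {I : Type} {J : I → Type} (p : V.Part I) (q : ∀ i, V.Part (J i)) :
    (V.compPart p q).1 = V.lift V.op (V.isModel_free (Σ i, J i))
      (fun i => V.rename (Sigma.mk i) (q i).1) p.1 := rfl

/-- The operad of a variety: its value at `I` is the multilinear part of the free algebra on `I`,
and the composition is substitution. -/
noncomputable def operad : Operad k where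
  obj I _ := V.Part I
  addCommGroup _ _ := inferInstance
  module _ _ := inferInstance
  relabel σ := V.relabelPart σ
  relabel_refl x := Subtype.ext (V.lift_gen_id x.1)
  relabel_trans σ τ x := Subtype.ext (by
    simp only [relabelPart_coe, rename, lift_lift, lift_gen, Equiv.trans_apply])
  one := ⟨V.gen (), by
    have h := V.gen_mem ()
    rwa [show ({()} : Set Unit) = Set.univ from Set.eq_univ_of_forall fun _ => rfl] at h⟩
  comp := V.compPart
  one_comp p := Subtype.ext (by
    simp only [relabelPart_coe, compPart_coe, rename, lift_lift, lift_gen]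
    exact V.lift_gen_id p.1)
  comp_one p := Subtype.ext (by
    simp only [relabelPart_coe, compPart_coe, rename, lift_lift, lift_gen]
    exact V.lift_gen_id p.1)
  comp_assoc p q r := Subtype.ext (by
    simp only [relabelPart_coe, compPart_coe, rename, lift_lift, lift_gen]
    rfl)
  relabel_comp σ p q := Subtype.ext (by
    simp only [relabelPart_coe, compPart_coe, rename, lift_lift, lift_gen]
    rfl)
  comp_relabel τ p q := Subtype.ext (by
    simp only [relabelPart_coe, compPart_coe, rename, lift_lift, lift_gen]
    rfl)

/-- The morphism of operads defined by expressing the operations of `V` as natural combinations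
`o` of the operations of `W`, in such a way that the identities of `V` hold. -/
noncomputable def operadHom (W : Variety k)
    (o : ∀ X : Type, V.Op → W.Free X →ₗ[k] W.Free X →ₗ[k] W.Free X)
    (h : ∀ X : Type, V.IsModel (o X))
    (ho : ∀ (X : Type) (e : V.Op) (S T : Set X) (s t : W.Free X), Disjoint S T →
      s ∈ W.multilin S → t ∈ W.multilin T → o X e s t ∈ W.multilin (S ∪ T))
    (hn : ∀ (X Y : Type) (a : X → W.Free Y) (e : V.Op) (s t : W.Free X),
      W.lift W.op (W.isModel_free Y) a (o X e s t) =
        o Y e (W.lift W.op (W.isModel_free Y) a s) (W.lift W.op (W.isModel_free Y) a t)) :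
    Operad.Hom V.operad W.operad where
  app I _ := (V.lift (o I) (h I) W.gen).restrict (p := V.Part I) (q := W.Part I) (fun z hz => by
    have h1 := V.lift_mem (h I) (ho I) W.gen (fun i => {i})
      (fun x y hxy => by simpa using hxy) (fun x => W.gen_mem x) hz
    rwa [show (⋃ x ∈ (Set.univ : Set I), {x}) = Set.univ by ext; simp] at h1)
  app_relabel σ x := Subtype.ext (by
    change V.lift (o _) (h _) W.gen (V.rename σ x.1) =
      W.rename σ (V.lift (o _) (h _) W.gen x.1)
    rw [rename, rename, lift_lift, V.hom_lift (h _) (h _) _ (hn _ _ _)]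
    simp only [lift_gen])
  app_one := Subtype.ext (V.lift_gen (h Unit) W.gen ())
  app_comp {I _ J _} p q := Subtype.ext (by
    change V.lift (o _) (h _) W.gen (V.lift V.op (V.isModel_free _)
        (fun i => V.rename (Sigma.mk i) (q i).1) p.1) =
      W.lift W.op (W.isModel_free _)
        (fun i => W.rename (Sigma.mk i) (V.lift (o _) (h _) W.gen (q i).1))
        (V.lift (o _) (h _) W.gen p.1)
    simp only [rename]
    rw [lift_lift, V.hom_lift (h _) (h _) _ (hn _ _ _)]
    simp only [lift_gen, lift_lift]
    congr 2
    funext i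
    rw [V.hom_lift (h _) (h _) _ (hn _ _ _)]
    simp only [lift_gen])

end Variety

/-! ## Post-Lie algebras and tridendriform algebras -/

inductive PostLieOp : Type
  | bracket : PostLieOp
  | triangle : PostLieOp

inductive TriDendOp : Type
  | prec : TriDendOp
  | succ : TriDendOp
  | dot : TriDendOp

/-- The identities of (right) post-Lie algebras, with operations `[a, b]` and `a ◁ b`. -/
def postLieIdent (k : Type u) [Field k] : Set (Poly k PostLieOp ℕ) :=
  let a : Poly k PostLieOp ℕ := Poly.var 1
  let b : Poly k PostLieOp ℕ := Poly.var 2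
  let c : Poly k PostLieOp ℕ := Poly.var 3
  let br (s t : Poly k PostLieOp ℕ) := Poly.op .bracket s t
  let tr (s t : Poly k PostLieOp ℕ) := Poly.op .triangle s t
  { br a b + br b a,
    (br (br a b) c - br (br a c) b) - br a (br b c),
    tr (br a b) c - (br (tr a c) b + br a (tr b c)),
    ((tr (tr a b) c - tr a (tr b c)) - (tr (tr a c) b - tr a (tr c b))) - tr a (br b c) }

/-- The variety of (right) post-Lie algebras. -/
def postLie (k : Type u) [Field k] : Variety k where
  Op := PostLieOp
  ident := postLieIdent k

/-- The identities of tridendriform algebras, with operations `a ≺ b`, `a ≻ b`, `a · b`. -/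
def triDendIdent (k : Type u) [Field k] : Set (Poly k TriDendOp ℕ) :=
  let a : Poly k TriDendOp ℕ := Poly.var 1
  let b : Poly k TriDendOp ℕ := Poly.var 2
  let c : Poly k TriDendOp ℕ := Poly.var 3
  let p (s t : Poly k TriDendOp ℕ) := Poly.op .prec s t
  let q (s t : Poly k TriDendOp ℕ) := Poly.op .succ s t
  let m (s t : Poly k TriDendOp ℕ) := Poly.op .dot s t
  { p (p a b) c - (p a (p b c) + p a (q b c) + p a (m b c)),
    p (m a b) c - m a (p b c),
    m (m a b) c - m a (m b c),
    p (q a b) c - q a (p b c),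
    m (p a b) c - m a (q b c),
    m (q a b) c - q a (m b c),
    (q (p a b) c + q (q a b) c + q (m a b) c) - q a (q b c) }

/-- The variety of tridendriform algebras. -/
def triDend (k : Type u) [Field k] : Variety k where
  Op := TriDendOp
  ident := triDendIdent k

theorem isModel_postLie_iff {k : Type u} [Field k] {A : Type u} [AddCommGroup A] [Module k A]
    (o : PostLieOp → A →ₗ[k] A →ₗ[k] A) :
    (postLie k).IsModel o ↔ ∀ a b c : A,
      o .bracket a b = - o .bracket b a ∧
      o .bracket (o .bracket a b) c - o .bracket (o .bracket a c) b =
        o .bracket a (o .bracket b c) ∧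
      o .triangle (o .bracket a b) c =
        o .bracket (o .triangle a c) b + o .bracket a (o .triangle b c) ∧
      (o .triangle (o .triangle a b) c - o .triangle a (o .triangle b c)) -
        (o .triangle (o .triangle a c) b - o .triangle a (o .triangle c b)) =
        o .triangle a (o .bracket b c) := by
  change (∀ r ∈ postLieIdent k, ∀ a : ℕ → A, Poly.eval o a r = 0) ↔ _
  simp only [postLieIdent, Set.mem_insert_iff, Set.mem_singleton_iff, forall_eq_or_imp, forall_eq,
    map_sub, map_add, Poly.eval_op, Poly.eval_var, sub_eq_zero, add_eq_zero_iff_eq_neg]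
  constructor
  · rintro ⟨h1, h2, h3, h4⟩ a b c
    let v : ℕ → A := fun n => if n = 1 then a else if n = 2 then b else c
    exact ⟨h1 v, h2 v, h3 v, h4 v⟩
  · intro h
    exact ⟨fun a => (h (a 1) (a 2) (a 3)).1, fun a => (h (a 1) (a 2) (a 3)).2.1,
      fun a => (h (a 1) (a 2) (a 3)).2.2.1, fun a => (h (a 1) (a 2) (a 3)).2.2.2⟩

theorem isModel_triDend_iff {k : Type u} [Field k] {A : Type u} [AddCommGroup A] [Module k A]
    (o : TriDendOp → A →ₗ[k] A →ₗ[k] A) :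
    (triDend k).IsModel o ↔ ∀ a b c : A,
      o .prec (o .prec a b) c =
        o .prec a (o .prec b c) + o .prec a (o .succ b c) + o .prec a (o .dot b c) ∧
      o .prec (o .dot a b) c = o .dot a (o .prec b c) ∧
      o .dot (o .dot a b) c = o .dot a (o .dot b c) ∧
      o .prec (o .succ a b) c = o .succ a (o .prec b c) ∧
      o .dot (o .prec a b) c = o .dot a (o .succ b c) ∧
      o .dot (o .succ a b) c = o .succ a (o .dot b c) ∧
      o .succ (o .prec a b) c + o .succ (o .succ a b) c + o .succ (o .dot a b) c =
        o .succ a (o .succ b c) := by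
  change (∀ r ∈ triDendIdent k, ∀ a : ℕ → A, Poly.eval o a r = 0) ↔ _
  simp only [triDendIdent, Set.mem_insert_iff, Set.mem_singleton_iff, forall_eq_or_imp, forall_eq,
    map_sub, map_add, Poly.eval_op, Poly.eval_var, sub_eq_zero]
  constructor
  · rintro ⟨h1, h2, h3, h4, h5, h6, h7⟩ a b c
    let v : ℕ → A := fun n => if n = 1 then a else if n = 2 then b else c
    exact ⟨h1 v, h2 v, h3 v, h4 v, h5 v, h6 v, h7 v⟩
  · intro h
    refine ⟨fun a => ?_, fun a => ?_, fun a => ?_, fun a => ?_, fun a => ?_, fun a => ?_,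
      fun a => ?_⟩ <;>
    obtain ⟨h1, h2, h3, h4, h5, h6, h7⟩ := h (a 1) (a 2) (a 3) <;>
    assumption

/-- The operad of post-Lie algebras. -/
noncomputable def PostLie (k : Type u) [Field k] : Operad k := (postLie k).operad

/-- The operad of tridendriform algebras. -/
noncomputable def TriDend (k : Type u) [Field k] : Operad k := (triDend k).operad

/-- The operations `[a, b] = a · b - b · a` and `a ◁ b = a ≺ b - b ≻ a` of a tridendriform
algebra. -/
def postLieOps {k : Type u} [Field k] {A : Type u} [AddCommGroup A] [Module k A]
    (o : TriDendOp → A →ₗ[k] A →ₗ[k] A) : PostLieOp → A →ₗ[k] A →ₗ[k] A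
  | .bracket => o .dot - (o .dot).flip
  | .triangle => o .prec - (o .succ).flip

/-- Every tridendriform algebra is a post-Lie algebra. -/
theorem isModel_postLieOps {k : Type u} [Field k] {A : Type u} [AddCommGroup A] [Module k A]
    (o : TriDendOp → A →ₗ[k] A →ₗ[k] A) (h : (triDend k).IsModel o) :
    (postLie k).IsModel (postLieOps o) := by
  rw [isModel_triDend_iff] at h
  have h1 := fun a b c => (h a b c).1
  have h2 := fun a b c => (h a b c).2.1
  have h3 := fun a b c => (h a b c).2.2.1
  have h4 := fun a b c => (h a b c).2.2.2.1
  have h5 := fun a b c => (h a b c).2.2.2.2.1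
  have h6 := fun a b c => (h a b c).2.2.2.2.2.1
  have h7 := fun a b c => (h a b c).2.2.2.2.2.2
  rw [isModel_postLie_iff]
  intro a b c
  simp only [postLieOps, LinearMap.sub_apply, LinearMap.flip_apply, map_sub]
  refine ⟨?_, ?_, ?_, ?_⟩
  · abel
  · simp only [h3]
    abel
  · simp only [h2, h5, h6]
    abel
  · simp only [h1, h4, ← h7]
    abel

/-- The morphism of operads `φ : PostLie → TriDend` with `φ([a, b]) = a · b - b · a` and
`φ(a ◁ b) = a ≺ b - b ≻ a`. -/
noncomputable def phi (k : Type u) [Field k] : Operad.Hom (PostLie k) (TriDend k) :=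
  (postLie k).operadHom (triDend k) (fun _ => postLieOps (triDend k).op)
    (fun X => isModel_postLieOps _ ((triDend k).isModel_free X))
    (fun X e S T s t hd hs ht => by
      have h1 := fun e => (triDend k).op_mem e hd hs ht
      have h2 := fun e => (triDend k).op_mem e hd.symm ht hs
      rw [Set.union_comm T S] at h2
      cases e
      · exact sub_mem (h1 .dot) (h2 .dot)
      · exact sub_mem (h1 .prec) (h2 .succ))
    (fun X Y a e s t => by
      have h := (triDend k).lift_op ((triDend k).isModel_free Y) a
      cases e
      · exact (map_sub _ _ _).trans (congrArg₂ _ (h .dot s t) (h .dot t s))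
      · exact (map_sub _ _ _).trans (congrArg₂ _ (h .prec s t) (h .succ t s)))

end FunctorialPBW

namespace FunctorialPBW

/-! ## Planar trees and unital actions on tridendriform algebras -/

/-! Adjoin a unit to a tridendriform algebra `A`: `k × A` is associative under `* = ≺ + ≻ + ·` and
acts on `A` on the left by `≻` and on the right by `≺`. Let `E` be a post-Lie subalgebra that
contains the generators, and let `B` be the span of the `·`-products of elements of `E`. Every
monomial can be rewritten as a combination of normal trees with letters in `B`. Two relations drive
the rewriting. The first is `a ≻ b = b ≺ a - b ◁ a`, which carries a `*`-product of elements of `E`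
from the left of a letter to its right. The second is `x * a = x ≺ a + x ≻ a + x · a`, by which the
trees with a bare root are expressed through the other ones and through products `x * a` with `a ∈
E`. Hence normal trees are combinations of products `q * c`, with `q` not bare and `c` a `*`-product
of elements of `E`, and the span of normal trees is closed under all operations. Both facts depend
on each other in lower degrees and are proved in one induction (`LetterSystem.closedAt_and_le`).

In characteristic zero `B` is spanned by symmetrized products of elements of `E`
(`letterSystem_symProd`), and `E` is taken to be the span of left-normed brackets of `◁`-monomials
whose first entry contains the smallest variable (`op_mem_minFirstSpan`). The resulting spanning
family of the multilinear part consists of patterns. A pattern is by construction a generic tree,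
whose letters are multisets of inputs, with brackets substituted for the inputs; this is the shape
of a basis of a free right `PostLie`-module.

Linear independence of patterns is obtained by counting. The Schröder trees with letters in `I` are
independent in the free tridendriform algebra, as a model on words with heights shows
(`linearIndependent_ev_gen`). Every pattern is decoded from such a tree (`IsPattern.exists_tree`),
so there are at most as many patterns as trees. As patterns span, they form a basis
(`linearIndependent_patternElt`). A pattern determines its presentation by a generic tree and
brackets up to relabelling (`Presentation.value_eq`), so a morphism defined on generic trees extends
to the basis consistently, and the right module is free (`isFree_rightModule_phi`).

The enveloping algebra of `A` is the relative composite product of `TriDend` and `A` over `PostLie`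
(`Envelope.homEquiv`). If the right module is free on `X`, this product is the Schur functor of `X`
at the underlying space of `A`, naturally in `A` (`RightModule.IsFree.exists_equiv`). This is the
PBW property (`hasPBWProperty_of_isFree`). -/

/-- Planar (Schröder) trees with letters in `γ`, including the empty tree. A nonempty tree is a
sequence of subtrees separated by letters; `last q b t` ends the root with the subtrees `q`, `t`
around the letter `b`, and `more q b r` puts `q`, `b` in front of the root of `r`. -/
inductive PTree (γ : Type) : Type
  | nil : PTree γ
  | last : PTree γ → γ → PTree γ → PTree γ
  | more : PTree γ → γ → PTree γ → PTree γ

/-- The tool for multilinear expressions: one argument at a time is replaced by a spanning element,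
while the others are frozen into `f`. -/
theorem mem_of_mem_span {k V W : Type*} [Field k] [AddCommGroup V] [Module k V] [AddCommGroup W]
    [Module k W] (f : V →ₗ[k] W) {S : Set V} {N : Submodule k W} {x : V}
    (hx : x ∈ Submodule.span k S) (h : ∀ y ∈ S, f y ∈ N) : f x ∈ N :=
  (Submodule.span_le (p := N.comap f)).2 h hx

section unital

variable {k : Type u} [Field k] {A : Type u} [AddCommGroup A] [Module k A]
  (o : TriDendOp → A →ₗ[k] A →ₗ[k] A)

/-- The left action of the unitization: `u ≻ a`, with `1 ≻ a = a`. -/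
def lact : (k × A) →ₗ[k] A →ₗ[k] A :=
  LinearMap.lsmul k A ∘ₗ LinearMap.fst k k A + o .succ ∘ₗ LinearMap.snd k k A

/-- The right action of the unitization: `a ≺ u`, with `a ≺ 1 = a`. -/
def ract : (k × A) →ₗ[k] A →ₗ[k] A :=
  LinearMap.lsmul k A ∘ₗ LinearMap.fst k k A + (o .prec).flip ∘ₗ LinearMap.snd k k A

/-- The associative product `≺ + ≻ + ·` on the unitization. -/
def star : (k × A) →ₗ[k] (k × A) →ₗ[k] (k × A) :=
  LinearMap.mk₂ k (fun u v => (u.1 * v.1, u.1 • v.2 + v.1 • u.2 +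
      (o .prec u.2 v.2 + o .succ u.2 v.2 + o .dot u.2 v.2)))
    (fun u u' v => by ext <;> simp [add_mul, add_smul]; abel)
    (fun c u v => by ext <;> simp [mul_assoc, mul_smul, smul_comm c])
    (fun u v v' => by ext <;> simp [mul_add, add_smul]; abel)
    (fun c u v => by ext <;> simp [mul_left_comm, mul_smul, smul_comm c])

theorem lact_apply (u : k × A) (a : A) : lact o u a = u.1 • a + o .succ u.2 a := rfl

theorem ract_apply (u : k × A) (a : A) : ract o u a = u.1 • a + o .prec a u.2 := rfl

theorem star_apply (u v : k × A) : star o u v = (u.1 * v.1, u.1 • v.2 + v.1 • u.2 +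
      (o .prec u.2 v.2 + o .succ u.2 v.2 + o .dot u.2 v.2)) := rfl

theorem lact_one (a : A) : lact o (1, 0) a = a := by simp [lact_apply]

theorem ract_one (a : A) : ract o (1, 0) a = a := by simp [ract_apply]

theorem one_star (v : k × A) : star o (1, 0) v = v := by ext <;> simp [star_apply]

theorem star_one (v : k × A) : star o v (1, 0) = v := by ext <;> simp [star_apply]

variable {o} (h : (triDend k).IsModel o)
include h

/-- The seven identities with units allowed say that `A` is a bimodule over `(k × A, *)`, and that
`·` is an associative product on it which is linear for the outer actions and balanced for the inner
one. The lemmas up to `dot_assoc` are these statements; afterwards the identities are used mostly in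
this form. -/
theorem lact_star (u v : k × A) (x : A) : lact o (star o u v) x = lact o u (lact o v x) := by
  have h7 := ((isModel_triDend_iff o).1 h u.2 v.2 x).2.2.2.2.2.2
  simp only [lact_apply, star_apply, map_add, LinearMap.add_apply, map_smul, LinearMap.smul_apply,
    smul_add, mul_smul, ← h7]
  rw [smul_comm v.1 u.1]
  abel

theorem ract_star (u v : k × A) (x : A) : ract o (star o u v) x = ract o v (ract o u x) := by
  have h1 := ((isModel_triDend_iff o).1 h x u.2 v.2).1
  simp only [ract_apply, star_apply, map_add, map_smul, smul_add, mul_smul, h1]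
  abel

theorem lact_ract (u v : k × A) (x : A) : lact o u (ract o v x) = ract o v (lact o u x) := by
  have h4 := ((isModel_triDend_iff o).1 h u.2 x v.2).2.2.2.1
  simp only [lact_apply, ract_apply, map_add, map_smul, smul_add, h4]
  rw [smul_comm v.1 u.1]
  abel

theorem dot_lact (u : k × A) (x y : A) : lact o u (o .dot x y) = o .dot (lact o u x) y := by
  have h6 := ((isModel_triDend_iff o).1 h u.2 x y).2.2.2.2.2.1
  simp only [lact_apply, map_add, LinearMap.add_apply, map_smul, LinearMap.smul_apply, h6]

theorem dot_ract (u : k × A) (x y : A) : ract o u (o .dot x y) = o .dot x (ract o u y) := by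
  have h2 := ((isModel_triDend_iff o).1 h x y u.2).2.1
  simp only [ract_apply, map_add, map_smul, h2]

theorem ract_dot (u : k × A) (x y : A) : o .dot (ract o u x) y = o .dot x (lact o u y) := by
  have h5 := ((isModel_triDend_iff o).1 h x u.2 y).2.2.2.2.1
  simp only [ract_apply, lact_apply, map_add, LinearMap.add_apply, map_smul, LinearMap.smul_apply,
    h5]

theorem dot_assoc (x y z : A) : o .dot (o .dot x y) z = o .dot x (o .dot y z) :=
  ((isModel_triDend_iff o).1 h x y z).2.2.1

/-- On the second components this is the sum of all seven identities. -/
theorem star_assoc (u v w : k × A) : star o (star o u v) w = star o u (star o v w) := by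
  have h0 := fun a b c => (isModel_triDend_iff o).1 h a b c
  obtain ⟨h1, h2, h3, h4, h5, h6, h7⟩ := h0 u.2 v.2 w.2
  ext
  · simp [star_apply, mul_assoc]
  · simp only [star_apply, map_add, LinearMap.add_apply, map_smul, LinearMap.smul_apply,
      smul_add, mul_smul, h1, h2, h3, h4, h5, h6, ← h7]
    rw [smul_comm w.1 u.1, smul_comm w.1 v.1]
    abel

end unital

/-! ## Values and degrees of trees -/

namespace PTree

variable {γ : Type}

/-- The value of a tree in the unitization of a tridendriform algebra. -/
def ev {k : Type u} [Field k] {A : Type u} [AddCommGroup A] [Module k A]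
    (o : TriDendOp → A →ₗ[k] A →ₗ[k] A) (val : γ → A) : PTree γ → k × A
  | nil => (1, 0)
  | last q b t => (0, lact o (q.ev o val) (ract o (t.ev o val) (val b)))
  -- A root with subtrees `q₀, …, qₙ` has the value `(q₀ ≻ b₁) · (q₁ ≻ b₂) · … · (qₙ₋₁ ≻ bₙ ≺ qₙ)`.
  -- The meaningless tree `more q b nil` gets the value zero; it is neither normal nor, later,
  -- proper.
  | more q b r => (0, o .dot (lact o (q.ev o val) (val b)) (r.ev o val).2)

/-- The list of letters of a tree. -/
def letters : PTree γ → List γ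
  | nil => []
  | last q b t => q.letters ++ b :: t.letters
  | more q b r => q.letters ++ b :: r.letters

/-- The degree of a tree. -/
def degree {Γ : Type} [AddCommMonoid Γ] (deg : γ → Γ) : PTree γ → Γ
  | nil => 0
  | last q b t => q.degree deg + deg b + t.degree deg
  | more q b r => q.degree deg + deg b + r.degree deg

/-- The first subtree of the root is not empty. -/
def Guarded : PTree γ → Prop
  | nil => False
  | last q _ _ => q ≠ nil
  | more q _ _ => q ≠ nil

/-- The root has one letter, which is not followed by a nonempty subtree. -/
def Bare : PTree γ → Prop
  | last _ _ nil => True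
  | _ => False

/-- Normal trees: the subtrees of every vertex except the last one are not bare, and all of them
except the first one and the last one are not empty. -/
def Normal : PTree γ → Prop
  | nil => True
  | last q _ t => q.Normal ∧ ¬ q.Bare ∧ t.Normal
  | more q _ r => q.Normal ∧ ¬ q.Bare ∧ r.Normal ∧ r.Guarded

theorem ev_fst_of_ne_nil {k : Type u} [Field k] {A : Type u} [AddCommGroup A] [Module k A]
    (o : TriDendOp → A →ₗ[k] A →ₗ[k] A) (val : γ → A) {t : PTree γ} (h : t ≠ nil) :
    (t.ev o val).1 = 0 := by
  cases t with
  | nil => exact absurd rfl h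
  | last => rfl
  | more => rfl

theorem Guarded.ne_nil {t : PTree γ} (h : t.Guarded) : t ≠ nil := by
  rintro rfl
  exact h

end PTree
end FunctorialPBW

namespace FunctorialPBW

/-! ## Normal trees span -/

section span

variable {k : Type u} [Field k] {A : Type u} [AddCommGroup A] [Module k A] {γ I : Type}

/-- The span of the values of the trees of degree `s` with a given property. -/
def evSpan (o : TriDendOp → A →ₗ[k] A →ₗ[k] A) (val : γ → A) (deg : γ → Multiset I)
    (P : PTree γ → Prop) (s : Multiset I) : Submodule k (k × A) :=
  Submodule.span k {x | ∃ t : PTree γ, P t ∧ t.degree deg = s ∧ t.ev o val = x}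

/-- The span of the values of the letters of degree `s`. -/
def valSpan (k : Type u) [Field k] {A : Type u} [AddCommGroup A] [Module k A]
    (val : γ → A) (deg : γ → Multiset I) (s : Multiset I) : Submodule k A :=
  Submodule.span k {x | ∃ b : γ, deg b = s ∧ val b = x}

/-- Letters with values in a tridendriform algebra that span a subspace which is graded by
multisets, closed under `·`, generated under `·` by the subspace `E`, such that `E` is closed
under `a ≺ b - b ≻ a`, and this operation maps the span and `E` to the span. -/
structure LetterSystem (o : TriDendOp → A →ₗ[k] A →ₗ[k] A) (val : γ → A) (deg : γ → Multiset I)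
    (E : Multiset I → Submodule k A) : Prop where
  isModel : (triDend k).IsModel o
  deg_ne : ∀ b, deg b ≠ 0
  le : ∀ s, E s ≤ valSpan k val deg s
  dot_mem : ∀ {s t x y}, x ∈ valSpan k val deg s → y ∈ valSpan k val deg t →
    o .dot x y ∈ valSpan k val deg (s + t)
  tri_mem : ∀ {s t x a}, x ∈ valSpan k val deg s → a ∈ E t →
    o .prec x a - o .succ a x ∈ valSpan k val deg (s + t)
  tri_mem' : ∀ {s t x a}, x ∈ E s → a ∈ E t → o .prec x a - o .succ a x ∈ E (s + t)
  le_sup : ∀ s, valSpan k val deg s ≤ E s ⊔ Submodule.span k {x | ∃ s1 s2, s1 + s2 = s ∧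
    s1 ≠ 0 ∧ s2 ≠ 0 ∧ ∃ b ∈ valSpan k val deg s1, ∃ a ∈ E s2, o .dot b a = x}

variable {o : TriDendOp → A →ₗ[k] A →ₗ[k] A} {val : γ → A} {deg : γ → Multiset I}
  {E : Multiset I → Submodule k A}

theorem card_pos {s : Multiset I} (h : s ≠ 0) : 0 < s.card := Multiset.card_pos.2 h

/-- The span of the `*`-products of elements of `E` of total degree `s`. -/
def starSpan (o : TriDendOp → A →ₗ[k] A →ₗ[k] A) (E : Multiset I → Submodule k A)
    (s : Multiset I) : Submodule k (k × A) :=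
  Submodule.span k {x | ∃ l : List (Multiset I × A), (∀ p ∈ l, p.1 ≠ 0 ∧ p.2 ∈ E p.1) ∧
    (l.map Prod.fst).sum = s ∧ l.foldr (fun p c => star o (0, p.2) c) (1, 0) = x}

theorem evSpan_mono {P P' : PTree γ → Prop} (h : ∀ t, P t → P' t) (s : Multiset I) :
    evSpan o val deg P s ≤ evSpan o val deg P' s :=
  Submodule.span_mono fun _ ⟨t, ht, h1, h2⟩ => ⟨t, h t ht, h1, h2⟩

/-- Grafting is trilinear in the left subtree, the letter and the right subtree, so it passes from
trees to spans. The predicates are left open because normal, nonbare and guarded trees all need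
this. -/
theorem last_mem_evSpan {P1 P2 P : PTree γ → Prop} {s1 s2 s3 : Multiset I}
    (h : ∀ q b t, P1 q → P2 t → q.degree deg = s1 → deg b = s2 → t.degree deg = s3 →
      P (.last q b t)) {q t : k × A} {b : A}
    (hq : q ∈ evSpan o val deg P1 s1) (hb : b ∈ valSpan k val deg s2)
    (ht : t ∈ evSpan o val deg P2 s3) :
    ((0, lact o q (ract o t b)) : k × A) ∈ evSpan o val deg P (s1 + s2 + s3) := by
  refine mem_of_mem_span (LinearMap.inr k k A ∘ₗ (lact o).flip (ract o t b)) hq ?_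
  rintro _ ⟨q, hq, hq', rfl⟩
  refine mem_of_mem_span (LinearMap.inr k k A ∘ₗ lact o _ ∘ₗ (ract o t)) hb ?_
  rintro _ ⟨b, hb, rfl⟩
  refine mem_of_mem_span (LinearMap.inr k k A ∘ₗ lact o _ ∘ₗ (ract o).flip _) ht ?_
  rintro _ ⟨t, ht, ht', rfl⟩
  refine Submodule.subset_span ⟨.last q b t, h q b t hq ht hq' hb ht', ?_, rfl⟩
  rw [PTree.degree, hq', hb, ht']

theorem more_mem_evSpan {P1 P2 P : PTree γ → Prop} {s1 s2 s3 : Multiset I}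
    (h : ∀ q b t, P1 q → P2 t → q.degree deg = s1 → deg b = s2 → t.degree deg = s3 →
      P (.more q b t)) {q t : k × A} {b : A}
    (hq : q ∈ evSpan o val deg P1 s1) (hb : b ∈ valSpan k val deg s2)
    (ht : t ∈ evSpan o val deg P2 s3) :
    ((0, o .dot (lact o q b) t.2) : k × A) ∈ evSpan o val deg P (s1 + s2 + s3) := by
  refine mem_of_mem_span (LinearMap.inr k k A ∘ₗ (o .dot).flip t.2 ∘ₗ (lact o).flip b) hq ?_
  rintro _ ⟨q, hq, hq', rfl⟩
  refine mem_of_mem_span (LinearMap.inr k k A ∘ₗ (o .dot).flip t.2 ∘ₗ lact o _) hb ?_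
  rintro _ ⟨b, hb, rfl⟩
  refine mem_of_mem_span (LinearMap.inr k k A ∘ₗ o .dot _ ∘ₗ LinearMap.snd k k A) ht ?_
  rintro _ ⟨t, ht, ht', rfl⟩
  refine Submodule.subset_span ⟨.more q b t, h q b t hq ht hq' hb ht', ?_, rfl⟩
  rw [PTree.degree, hq', hb, ht']

theorem ne_nil_of_degree_ne_zero {deg : γ → Multiset I} {t : PTree γ} (ht : t.degree deg ≠ 0) : t ≠ .nil := by
  rintro rfl
  exact ht rfl

theorem one_mem_evSpan : (1, 0) ∈ evSpan o val deg PTree.Normal 0 :=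
  Submodule.subset_span ⟨.nil, trivial, rfl, rfl⟩

theorem one_mem_starSpan : (1, 0) ∈ starSpan o E 0 :=
  Submodule.subset_span ⟨[], by simp, rfl, rfl⟩

theorem starSpan_zero {x : k × A} (hx : x ∈ starSpan o E 0) : x = (x.1, 0) := by
  have : starSpan o E 0 ≤ LinearMap.ker (LinearMap.snd k k A) := by
    refine Submodule.span_le.2 ?_
    rintro _ ⟨l, hl, hs, rfl⟩
    cases l with
    | nil => rfl
    | cons p l =>
      simp only [List.map_cons, List.sum_cons, add_eq_zero] at hs
      exact absurd hs.1 (hl p (by simp)).1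
  exact Prod.ext rfl (this hx)

theorem star_mem_starSpan {s t : Multiset I} {c : k × A} {a : A} (ht : t ≠ 0)
    (hc : c ∈ starSpan o E s) (ha : a ∈ E t) : star o (0, a) c ∈ starSpan o E (t + s) := by
  refine mem_of_mem_span (star o (0, a)) hc ?_
  rintro _ ⟨l, hl, rfl, rfl⟩
  refine Submodule.subset_span ⟨(t, a) :: l, ?_, by simp, rfl⟩
  intro p hp
  rcases List.mem_cons.1 hp with rfl | hp
  · exact ⟨ht, ha⟩
  · exact hl p hp

namespace LetterSystem

variable (S : LetterSystem o val deg E)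
include S

theorem degree_ne_zero {t : PTree γ} (ht : t ≠ .nil) : t.degree deg ≠ 0 := by
  cases t with
  | nil => exact absurd rfl ht
  | last q b t => simp [PTree.degree, S.deg_ne]
  | more q b t => simp [PTree.degree, S.deg_ne]

theorem evSpan_zero {P : PTree γ → Prop} {x : k × A} (hx : x ∈ evSpan o val deg P 0) :
    x = (x.1, 0) := by
  have : evSpan o val deg P 0 ≤ LinearMap.ker (LinearMap.snd k k A) := by
    refine Submodule.span_le.2 ?_
    rintro _ ⟨t, -, ht, rfl⟩
    have : t = .nil := by
      by_contra h
      exact S.degree_ne_zero h ht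
    subst this
    rfl
  exact Prod.ext rfl (this hx)

theorem evSpan_fst {P : PTree γ → Prop} {s : Multiset I} (hs : s ≠ 0) {x : k × A}
    (hx : x ∈ evSpan o val deg P s) : x = (0, x.2) := by
  have : evSpan o val deg P s ≤ LinearMap.ker (LinearMap.fst k k A) := by
    refine Submodule.span_le.2 ?_
    rintro _ ⟨t, -, ht, rfl⟩
    exact PTree.ev_fst_of_ne_nil o val (ne_nil_of_degree_ne_zero (ht ▸ hs))
  exact Prod.ext (this hx) rfl

theorem starSpan_star {s t : Multiset I} {c : k × A} {a : A} (ht : t ≠ 0)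
    (hc : c ∈ starSpan o E s) (ha : a ∈ E t) : star o c (0, a) ∈ starSpan o E (s + t) := by
  refine mem_of_mem_span ((star o).flip (0, a)) hc ?_
  rintro _ ⟨l, hl, rfl, rfl⟩
  refine Submodule.subset_span ⟨l ++ [(t, a)], ?_, by simp, ?_⟩
  · intro p hp
    rcases List.mem_append.1 hp with hp | hp
    · exact hl p hp
    · obtain rfl := List.mem_singleton.1 hp
      exact ⟨ht, ha⟩
  · change _ = star o _ (0, a)
    clear hl hc
    induction l with
    | nil => simp [star_one, one_star]
    | cons p l ih =>
      rw [List.cons_append, List.foldr_cons, ih, List.foldr_cons, star_assoc S.isModel]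

/-- A subspace that contains `b ≺ c'` for suitable `b ∈ F`, `c'` contains `c ≻ b`. -/
theorem lact_starSpan {F : Multiset I → Submodule k A}
    (hF : ∀ {s t x a}, x ∈ F s → a ∈ E t → o .prec x a - o .succ a x ∈ F (s + t))
    {s t : Multiset I} (ht : t ≠ 0) {c : k × A} {b : A} (hc : c ∈ starSpan o E s)
    (hb : b ∈ F t) {W : Type u} [AddCommGroup W] [Module k W] (f : A →ₗ[k] W) (N : Submodule k W)
    (hN : ∀ s' t' c' b', s' + t' = s + t → t'.card ≥ t.card → t' ≠ 0 →
      c' ∈ starSpan o E s' → b' ∈ F t' → f (ract o c' b') ∈ N) : f (lact o c b) ∈ N := by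
  -- The claim is freed from `f` and `N` so that an induction on the number of factors of `c` can
  -- use it.
  suffices h : lact o c b ∈ Submodule.span k {x | ∃ s' t', s' + t' = s + t ∧
      t'.card ≥ t.card ∧ t' ≠ 0 ∧ ∃ c' ∈ starSpan o E s', ∃ b' ∈ F t', ract o c' b' = x} by
    refine mem_of_mem_span f h ?_
    rintro _ ⟨s', t', h1, h2, h3, c', hc', b', hb', rfl⟩
    exact hN s' t' c' b' h1 h2 h3 hc' hb'
  refine mem_of_mem_span ((lact o).flip b) hc ?_
  rintro _ ⟨l, hl, rfl, rfl⟩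
  clear hN hc
  change lact o _ b ∈ _
  induction l with
  | nil =>
    exact Submodule.subset_span ⟨0, t, by simp, le_rfl, ht, (1, 0), one_mem_starSpan, b, hb,
      by simp [lact_one, ract_one]⟩
  | cons p l ih =>
    have hp := hl p (by simp)
    rw [List.foldr_cons, lact_star S.isModel]
    refine mem_of_mem_span (lact o (0, p.2)) (ih fun q hq => hl q (by simp [hq])) ?_
    rintro _ ⟨s', t', h1, h2, h3, c', hc', b', hb', rfl⟩
    -- Here `a ≻ b' = b' ≺ a - b' ◁ a` is applied under the right action of `c'`, which commutes
    -- with left actions. The new factor `a` is absorbed either by `c'` or by the letter.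
    have key : lact o (0, p.2) (ract o c' b') = ract o (star o (0, p.2) c') b' -
        ract o c' (o .prec b' p.2 - o .succ p.2 b') := by
      rw [lact_ract S.isModel, ract_star S.isModel, ← map_sub]
      congr 1
      simp [lact_apply, ract_apply]
    rw [key]
    refine sub_mem ?_ ?_
    · refine Submodule.subset_span ⟨p.1 + s', t', ?_, h2, h3, _,
        star_mem_starSpan hp.1 hc' hp.2, b', hb', rfl⟩
      rw [List.map_cons, List.sum_cons, add_assoc, add_assoc, h1]
    · refine Submodule.subset_span ⟨s', t' + p.1, ?_, ?_, ?_, c', hc', _, hF hb' hp.2, rfl⟩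
      · rw [List.map_cons, List.sum_cons, ← add_assoc, h1]
        abel
      · rw [Multiset.card_add]; omega
      · simp [h3]

end LetterSystem
end span
end FunctorialPBW

namespace FunctorialPBW

/-! ### Closure of the span of normal trees under the operations, degree by degree -/

section closed

variable {k : Type u} [Field k] {A : Type u} [AddCommGroup A] [Module k A] {γ I : Type}

/-- The span of the values of normal trees of degree `s`. -/
abbrev normalSpan (o : TriDendOp → A →ₗ[k] A →ₗ[k] A) (val : γ → A) (deg : γ → Multiset I)
    (s : Multiset I) : Submodule k (k × A) := evSpan o val deg PTree.Normal s

/-- The span of the values of normal trees of degree `s` that are not bare. -/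
abbrev nonbareSpan (o : TriDendOp → A →ₗ[k] A →ₗ[k] A) (val : γ → A) (deg : γ → Multiset I)
    (s : Multiset I) : Submodule k (k × A) := evSpan o val deg (fun t => t.Normal ∧ ¬ t.Bare) s

/-- The span of the values of normal trees of degree `s` whose first subtree is not empty. -/
abbrev guardedSpan (o : TriDendOp → A →ₗ[k] A →ₗ[k] A) (val : γ → A) (deg : γ → Multiset I)
    (s : Multiset I) : Submodule k (k × A) := evSpan o val deg (fun t => t.Normal ∧ t.Guarded) s

/-- The values of normal trees of total degree of cardinality `n` are closed under products. -/
def ClosedAt (o : TriDendOp → A →ₗ[k] A →ₗ[k] A) (val : γ → A) (deg : γ → Multiset I)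
    (n : ℕ) : Prop :=
  ∀ (s t : Multiset I) (x y : k × A), (s + t).card = n → x ∈ normalSpan o val deg s →
    y ∈ normalSpan o val deg t → star o x y ∈ normalSpan o val deg (s + t) ∧
      (0, lact o x y.2) ∈ normalSpan o val deg (s + t) ∧
      (0, ract o x y.2) ∈ normalSpan o val deg (s + t) ∧
      (0, o .dot x.2 y.2) ∈ normalSpan o val deg (s + t)

/-- The span of the products `q * c` of total degree `s`, for `q` in the span of normal trees that
are not bare, and `c` in `starSpan`. -/
def splitSpan (o : TriDendOp → A →ₗ[k] A →ₗ[k] A) (val : γ → A) (deg : γ → Multiset I)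
    (E : Multiset I → Submodule k A) (s : Multiset I) : Submodule k (k × A) :=
  Submodule.span k {x | ∃ s1 s2, s1 + s2 = s ∧ ∃ q ∈ nonbareSpan o val deg s1,
    ∃ c ∈ starSpan o E s2, star o q c = x}

variable {o : TriDendOp → A →ₗ[k] A →ₗ[k] A} {val : γ → A} {deg : γ → Multiset I}
  {E : Multiset I → Submodule k A}

theorem mem_of_mem_splitSpan {s : Multiset I} {x : k × A} (hx : x ∈ splitSpan o val deg E s)
    {W : Type u} [AddCommGroup W] [Module k W] (f : (k × A) →ₗ[k] W) (N : Submodule k W)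
    (h : ∀ s1 s2, s1 + s2 = s → ∀ q ∈ nonbareSpan o val deg s1, ∀ c ∈ starSpan o E s2,
      f (star o q c) ∈ N) : f x ∈ N := by
  refine mem_of_mem_span f hx ?_
  rintro _ ⟨s1, s2, h1, q, hq, c, hc, rfl⟩
  exact h s1 s2 h1 q hq c hc

theorem nonbareSpan_le (s : Multiset I) : nonbareSpan o val deg s ≤ normalSpan o val deg s :=
  evSpan_mono (fun _ h => h.1) s

theorem mem_evSpan_cast {P : PTree γ → Prop} {s t : Multiset I} {x : k × A}
    (hx : x ∈ evSpan o val deg P s) (h : s = t) : x ∈ evSpan o val deg P t := h ▸ hx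

theorem more_mem_nonbareSpan {s1 s2 s3 : Multiset I} {q t : k × A} {b : A}
    (hq : q ∈ nonbareSpan o val deg s1) (hb : b ∈ valSpan k val deg s2)
    (ht : t ∈ guardedSpan o val deg s3) :
    ((0, o .dot (lact o q b) t.2) : k × A) ∈ nonbareSpan o val deg (s1 + s2 + s3) :=
  more_mem_evSpan (fun _ _ _ hq ht _ _ _ => ⟨⟨hq.1, hq.2, ht.1, ht.2⟩, id⟩) hq hb ht

theorem last_mem_normalSpan {s1 s2 s3 : Multiset I} {q t : k × A} {b : A}
    (hq : q ∈ nonbareSpan o val deg s1) (hb : b ∈ valSpan k val deg s2)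
    (ht : t ∈ normalSpan o val deg s3) :
    ((0, lact o q (ract o t b)) : k × A) ∈ normalSpan o val deg (s1 + s2 + s3) :=
  last_mem_evSpan (fun _ _ _ hq ht _ _ _ => ⟨hq.1, hq.2, ht⟩) hq hb ht

theorem last_mem_nonbareSpan {s1 s2 s3 : Multiset I} {q t : k × A} {b : A}
    (hq : q ∈ nonbareSpan o val deg s1) (hb : b ∈ valSpan k val deg s2)
    (ht : t ∈ normalSpan o val deg s3) (hs : s3 ≠ 0) :
    ((0, lact o q (ract o t b)) : k × A) ∈ nonbareSpan o val deg (s1 + s2 + s3) :=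
  last_mem_evSpan (fun _ _ t hq ht _ _ h => by
    refine ⟨⟨hq.1, hq.2, ht⟩, ?_⟩
    cases t with
    | nil => exact absurd h.symm hs
    | last => exact id
    | more => exact id) hq hb ht

theorem last_mem_guardedSpan {s1 s2 s3 : Multiset I} {q t : k × A} {b : A}
    (hq : q ∈ nonbareSpan o val deg s1) (hb : b ∈ valSpan k val deg s2)
    (ht : t ∈ normalSpan o val deg s3) (hs : s1 ≠ 0) :
    ((0, lact o q (ract o t b)) : k × A) ∈ guardedSpan o val deg (s1 + s2 + s3) :=
  last_mem_evSpan (fun _ _ _ hq ht h _ _ =>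
    ⟨⟨hq.1, hq.2, ht⟩, ne_nil_of_degree_ne_zero (h ▸ hs)⟩) hq hb ht

theorem one_mem_nonbareSpan : (1, 0) ∈ nonbareSpan o val deg 0 :=
  Submodule.subset_span ⟨.nil, ⟨trivial, id⟩, rfl, rfl⟩

theorem val_mem_normalSpan {s : Multiset I} {b : A} (hb : b ∈ valSpan k val deg s) :
    ((0, b) : k × A) ∈ normalSpan o val deg s := by
  have := last_mem_normalSpan (o := o) one_mem_nonbareSpan hb one_mem_evSpan
  rw [lact_one, ract_one] at this
  exact mem_evSpan_cast this (by simp)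

namespace LetterSystem

variable (S : LetterSystem o val deg E)
include S

/-- If the first subtree of `y` is not empty, `q` and `b` are put in front of its root. If it is
empty, `b` and the first letter of `y` become adjacent and merge, as letters are closed under `·`.
The first subtree is then made from `q` in either case, and recording this makes one case analysis
serve for normal and for guarded trees. -/
theorem dot_mem_evSpan {s1 s2 s3 : Multiset I} {q y : k × A} {b : A}
    (hq : q ∈ nonbareSpan o val deg s1) (hb : b ∈ valSpan k val deg s2)
    (hy : y ∈ normalSpan o val deg s3) (hs : s3 ≠ 0) :
    ((0, o .dot (lact o q b) y.2) : k × A) ∈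
      evSpan o val deg (fun t => t.Normal ∧ (s1 ≠ 0 → t.Guarded)) (s1 + s2 + s3) := by
  refine mem_of_mem_span (LinearMap.inr k k A ∘ₗ o .dot _ ∘ₗ LinearMap.snd k k A) hy ?_
  rintro _ ⟨t, ht, rfl, rfl⟩
  have key : ∀ t : PTree γ, t.Normal → t.Guarded → (0, o .dot (lact o q b) (t.ev o val).2) ∈
      evSpan o val deg (fun t => t.Normal ∧ (s1 ≠ 0 → t.Guarded)) (s1 + s2 + t.degree deg) :=
    fun t ht hg => more_mem_evSpan (P2 := fun t => t.Normal ∧ t.Guarded)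
      (fun q b t hq ht h _ _ => ⟨⟨hq.1, hq.2, ht.1, ht.2⟩, fun h0 =>
        ne_nil_of_degree_ne_zero (h ▸ h0)⟩) hq hb (Submodule.subset_span ⟨t, ⟨ht, hg⟩, rfl, rfl⟩)
  cases t with
  | nil => exact absurd rfl hs
  | last q0 b' t =>
    cases q0 with
    | nil =>
      have hb' : val b' ∈ valSpan k val deg (deg b') := Submodule.subset_span ⟨b', rfl, rfl⟩
      have := last_mem_evSpan (o := o) (P := fun t => t.Normal ∧ (s1 ≠ 0 → t.Guarded))
        (P2 := PTree.Normal) (fun q b t hq ht h _ _ => ⟨⟨hq.1, hq.2, ht⟩, fun h0 =>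
        ne_nil_of_degree_ne_zero (h ▸ h0)⟩) hq (S.dot_mem hb hb')
        (Submodule.subset_span ⟨t, ht.2.2, rfl, rfl⟩)
      rw [dot_ract S.isModel, dot_lact S.isModel] at this
      refine mem_evSpan_cast (x := (0, _)) ?_ ?_ (s := s1 + (s2 + deg b') + t.degree deg)
      · simpa [PTree.ev, lact_one] using this
      · simp [PTree.degree, add_assoc]
    | last => exact key _ ht (fun h => by cases h)
    | more => exact key _ ht (fun h => by cases h)
  | more q0 b' r =>
    cases q0 with
    | nil =>
      have hb' : val b' ∈ valSpan k val deg (deg b') := Submodule.subset_span ⟨b', rfl, rfl⟩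
      have := more_mem_evSpan (o := o) (P := fun t => t.Normal ∧ (s1 ≠ 0 → t.Guarded))
        (P2 := fun t => t.Normal ∧ t.Guarded)
        (fun q b t hq ht h _ _ => ⟨⟨hq.1, hq.2, ht.1, ht.2⟩, fun h0 =>
        ne_nil_of_degree_ne_zero (h ▸ h0)⟩) hq (S.dot_mem hb hb')
        (Submodule.subset_span ⟨r, ⟨ht.2.2.1, ht.2.2.2⟩, rfl, rfl⟩)
      rw [dot_lact S.isModel, dot_assoc S.isModel] at this
      refine mem_evSpan_cast (x := (0, _)) ?_ ?_ (s := s1 + (s2 + deg b') + r.degree deg)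
      · simpa [PTree.ev, lact_one] using this
      · simp [PTree.degree, add_assoc]
    | last => exact key _ ht (fun h => by cases h)
    | more => exact key _ ht (fun h => by cases h)

theorem dot_mem_normalSpan {s1 s2 s3 : Multiset I} {q y : k × A} {b : A}
    (hq : q ∈ nonbareSpan o val deg s1) (hb : b ∈ valSpan k val deg s2)
    (hy : y ∈ normalSpan o val deg s3) (hs : s3 ≠ 0) :
    ((0, o .dot (lact o q b) y.2) : k × A) ∈ normalSpan o val deg (s1 + s2 + s3) :=
  evSpan_mono (fun _ h => h.1) _ (S.dot_mem_evSpan hq hb hy hs)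

theorem dot_mem_guardedSpan {s1 s2 s3 : Multiset I} {q y : k × A} {b : A}
    (hq : q ∈ nonbareSpan o val deg s1) (hb : b ∈ valSpan k val deg s2)
    (hy : y ∈ normalSpan o val deg s3) (hs : s3 ≠ 0) (hs1 : s1 ≠ 0) :
    ((0, o .dot (lact o q b) y.2) : k × A) ∈ guardedSpan o val deg (s1 + s2 + s3) :=
  evSpan_mono (fun _ h => ⟨h.1, h.2 hs1⟩) _ (S.dot_mem_evSpan hq hb hy hs)

/-- Elements of `E` are combinations of letters, hence normal, and closure in lower degrees keeps
their `*`-products normal. -/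
theorem starSpan_le {n : ℕ} (hC : ∀ m < n, ClosedAt o val deg m) {s : Multiset I}
    (hs : s.card < n) : starSpan o E s ≤ normalSpan o val deg s := by
  refine Submodule.span_le.2 ?_
  rintro _ ⟨l, hl, rfl, rfl⟩
  induction l with
  | nil => exact one_mem_evSpan
  | cons p l ih =>
    rw [List.map_cons, List.sum_cons] at hs ⊢
    rw [Multiset.card_add] at hs
    refine (hC _ ?_ _ _ _ _ rfl (val_mem_normalSpan (S.le _ (hl p (by simp)).2))
      (ih (fun q hq => hl q (by simp [hq])) (by omega))).1
    rwa [Multiset.card_add]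

variable {n : ℕ} (hC : ∀ m < n, ClosedAt o val deg m)
  (hD : ∀ s : Multiset I, s.card < n → normalSpan o val deg s ≤ splitSpan o val deg E s)
include hC hD

/-- An arbitrary normal `u` may not stand to the left of a letter, since it may be bare. It is split
as `q * c`; `q` may stay, while `c` crosses the letter by `lact_starSpan` and is multiplied into
`t`, in a degree below `n`. -/
theorem lact_ract_mem (N : Submodule k (k × A)) {s1 s2 s3 : Multiset I}
    (hn : (s1 + s2 + s3).card = n) (hs : s2 ≠ 0) {u t : k × A} {b : A}
    (hu : u ∈ normalSpan o val deg s1) (hb : b ∈ valSpan k val deg s2)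
    (ht : t ∈ normalSpan o val deg s3)
    (hN : ∀ s1' s2' s3', s1' + s2' + s3' = s1 + s2 + s3 → (s3 ≠ 0 → s3' ≠ 0) →
      ∀ q ∈ nonbareSpan o val deg s1', ∀ b ∈ valSpan k val deg s2',
      ∀ t ∈ normalSpan o val deg s3', ((0, lact o q (ract o t b)) : k × A) ∈ N) :
    ((0, lact o u (ract o t b)) : k × A) ∈ N := by
  have := card_pos hs
  simp only [Multiset.card_add] at hn
  refine mem_of_mem_splitSpan (hD s1 (by omega) hu)
    (LinearMap.inr k k A ∘ₗ (lact o).flip (ract o t b)) N ?_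
  rintro s11 s12 rfl q hq c hc
  simp only [LinearMap.comp_apply, LinearMap.flip_apply, lact_star S.isModel,
    lact_ract S.isModel c]
  refine S.lact_starSpan (F := valSpan k val deg) S.tri_mem hs hc hb
    (LinearMap.inr k k A ∘ₗ lact o q ∘ₗ ract o t) N ?_
  intro s' t' c' b' h1 h2 h3 hc' hb'
  have h4 := congrArg Multiset.card h1
  have := card_pos h3
  simp only [Multiset.card_add] at h4 hn
  simp only [LinearMap.comp_apply, ← ract_star S.isModel]
  refine hN s11 t' (s' + s3) ?_ (by simp +contextual) q hq b' hb' _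
    (hC _ ?_ _ _ _ _ rfl (S.starSpan_le hC ?_ hc') ht).1
  · calc s11 + t' + (s' + s3) = s11 + (s' + t') + s3 := by abel
      _ = _ := by rw [h1]; abel
  · rw [Multiset.card_add]; omega
  · omega

theorem lact_ract_mem_normalSpan {s1 s2 s3 : Multiset I}
    (hn : (s1 + s2 + s3).card = n) (hs : s2 ≠ 0) {u t : k × A} {b : A}
    (hu : u ∈ normalSpan o val deg s1) (hb : b ∈ valSpan k val deg s2)
    (ht : t ∈ normalSpan o val deg s3) :
    ((0, lact o u (ract o t b)) : k × A) ∈ normalSpan o val deg (s1 + s2 + s3) :=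
  S.lact_ract_mem hC hD _ hn hs hu hb ht fun _ _ _ h _ _ hq _ hb _ ht =>
    mem_evSpan_cast (last_mem_normalSpan hq hb ht) h

/-- The same argument as for `lact_ract_mem`; the factor that has crossed the letter is passed on by
`(b' ≺ c') · x = b' · (c' ≻ x)`. -/
theorem lact_dot_mem {s1 s2 s3 : Multiset I}
    (hn : (s1 + s2 + s3).card = n) (hs : s2 ≠ 0) {u x : k × A} {b : A}
    (hu : u ∈ normalSpan o val deg s1) (hb : b ∈ valSpan k val deg s2)
    (hx : x ∈ normalSpan o val deg s3) (hs3 : s3 ≠ 0) :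
    ((0, o .dot (lact o u b) x.2) : k × A) ∈ normalSpan o val deg (s1 + s2 + s3) := by
  have := card_pos hs
  simp only [Multiset.card_add] at hn
  refine mem_of_mem_splitSpan (hD s1 (by omega) hu)
    (LinearMap.inr k k A ∘ₗ (o .dot).flip x.2 ∘ₗ (lact o).flip b) _ ?_
  rintro s11 s12 rfl q hq c hc
  simp only [LinearMap.comp_apply, LinearMap.flip_apply, lact_star S.isModel]
  refine S.lact_starSpan (F := valSpan k val deg) S.tri_mem hs hc hb
    (LinearMap.inr k k A ∘ₗ (o .dot).flip x.2 ∘ₗ lact o q) _ ?_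
  intro s' t' c' b' h1 h2 h3 hc' hb'
  have h4 := congrArg Multiset.card h1
  have := card_pos h3
  simp only [Multiset.card_add] at h4 hn
  simp only [LinearMap.comp_apply, LinearMap.flip_apply, lact_ract S.isModel, ract_dot S.isModel]
  have h5 := (hC _ (by rw [Multiset.card_add]; omega) _ _ _ _ rfl
    (S.starSpan_le hC (by omega) hc') hx).2.1
  refine mem_evSpan_cast (S.dot_mem_normalSpan hq hb' h5 (by simp [hs3])) ?_
  calc s11 + t' + (s' + s3) = s11 + (s' + t') + s3 := by abel
      _ = _ := by rw [h1]; abel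

/-- Each operation changes a tree at one end only: `≻` multiplies the first subtree on the left by
`x`, `≺` multiplies the last subtree on the right, and `·` uses `(b ≺ t) · y = b · (t ≻ y)`. The
recursive products omit a letter, so their degree is below `n`. The product `*` is the sum of the
three. -/
theorem closedAt : ClosedAt o val deg n := by
  intro s t x y hn hx hy
  have hL : (0, lact o x y.2) ∈ normalSpan o val deg (s + t) := by
    refine mem_of_mem_span (LinearMap.inr k k A ∘ₗ lact o x ∘ₗ LinearMap.snd k k A) hy ?_
    clear hy
    rintro _ ⟨y, hy, rfl, rfl⟩
    cases y with
    | nil =>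
      simp only [PTree.ev, map_zero, LinearMap.comp_apply, LinearMap.snd_apply, LinearMap.flip_apply,
        LinearMap.zero_apply]
      exact zero_mem _
    | last q b t =>
      have hb := card_pos (S.deg_ne b)
      simp only [PTree.degree, Multiset.card_add] at hn
      have h1 := (hC _ (by rw [Multiset.card_add]; omega) _ _ _ _ rfl hx
        (Submodule.subset_span ⟨q, hy.1, rfl, rfl⟩)).1
      have := S.lact_ract_mem_normalSpan hC hD (by simp only [Multiset.card_add]; omega)
        (S.deg_ne b) h1 (Submodule.subset_span ⟨b, rfl, rfl⟩)
        (Submodule.subset_span ⟨t, hy.2.2, rfl, rfl⟩)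
      rw [lact_star S.isModel] at this
      exact mem_evSpan_cast this (by simp [PTree.degree, add_assoc])
    | more q b r =>
      have hb := card_pos (S.deg_ne b)
      simp only [PTree.degree, Multiset.card_add] at hn
      have h1 := (hC _ (by rw [Multiset.card_add]; omega) _ _ _ _ rfl hx
        (Submodule.subset_span ⟨q, hy.1, rfl, rfl⟩)).1
      have := S.lact_dot_mem hC hD (by simp only [Multiset.card_add]; omega)
        (S.deg_ne b) h1 (Submodule.subset_span ⟨b, rfl, rfl⟩)
        (Submodule.subset_span ⟨r, hy.2.2.1, rfl, rfl⟩) (S.degree_ne_zero hy.2.2.2.ne_nil)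
      rw [lact_star S.isModel, ← dot_lact S.isModel] at this
      exact mem_evSpan_cast this (by simp [PTree.degree, add_assoc])
  have hR : ∀ s t x y, (s + t).card = n → x ∈ normalSpan o val deg s →
      y ∈ normalSpan o val deg t → (0, ract o x y.2) ∈ normalSpan o val deg (s + t) := by
    clear hn hx hy hL s t x y
    intro s t x y hn hx hy
    refine mem_of_mem_span (LinearMap.inr k k A ∘ₗ ract o x ∘ₗ LinearMap.snd k k A) hy ?_
    clear hy
    rintro _ ⟨y, hy, rfl, rfl⟩
    cases y with
    | nil =>
      simp only [PTree.ev, map_zero, LinearMap.comp_apply, LinearMap.snd_apply, LinearMap.flip_apply,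
        LinearMap.zero_apply]
      exact zero_mem _
    | last q b t =>
      have hb := card_pos (S.deg_ne b)
      simp only [PTree.degree, Multiset.card_add] at hn
      have h1 := (hC _ (by rw [Multiset.card_add]; omega) _ _ _ _ rfl
        (Submodule.subset_span ⟨t, hy.2.2, rfl, rfl⟩) hx).1
      have := last_mem_normalSpan (o := o) (Submodule.subset_span ⟨q, ⟨hy.1, hy.2.1⟩, rfl, rfl⟩)
        (Submodule.subset_span ⟨b, rfl, rfl⟩) h1
      rw [ract_star S.isModel, lact_ract S.isModel] at this
      exact mem_evSpan_cast this (by simp only [PTree.degree]; abel)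
    | more q b r =>
      have hb := card_pos (S.deg_ne b)
      simp only [PTree.degree, Multiset.card_add] at hn
      have h1 := (hC _ (by rw [Multiset.card_add]; omega) _ _ _ _ rfl hx
        (Submodule.subset_span ⟨r, hy.2.2.1, rfl, rfl⟩)).2.2.1
      have := S.dot_mem_normalSpan (Submodule.subset_span ⟨q, ⟨hy.1, hy.2.1⟩, rfl, rfl⟩)
        (Submodule.subset_span ⟨b, rfl, rfl⟩) h1
        (by simp [S.degree_ne_zero hy.2.2.2.ne_nil])
      rw [← dot_ract S.isModel] at this
      exact mem_evSpan_cast this (by simp only [PTree.degree]; abel)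
  have hM : (0, o .dot x.2 y.2) ∈ normalSpan o val deg (s + t) := by
    by_cases ht : t = 0
    · subst ht
      rw [S.evSpan_zero hy]
      simp only [map_zero]
      exact zero_mem _
    refine mem_of_mem_span (LinearMap.inr k k A ∘ₗ (o .dot).flip y.2 ∘ₗ LinearMap.snd k k A) hx ?_
    clear hx
    rintro _ ⟨x, hx, rfl, rfl⟩
    cases x with
    | nil =>
      simp only [PTree.ev, map_zero, LinearMap.comp_apply, LinearMap.snd_apply, LinearMap.flip_apply,
        LinearMap.zero_apply]
      exact zero_mem _
    | last q b t' =>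
      have hb := card_pos (S.deg_ne b)
      simp only [PTree.degree, Multiset.card_add] at hn
      have h1 := (hC _ (by rw [Multiset.card_add]; omega) _ _ _ _ rfl
        (Submodule.subset_span ⟨t', hx.2.2, rfl, rfl⟩) hy).2.1
      have := S.dot_mem_normalSpan (Submodule.subset_span ⟨q, ⟨hx.1, hx.2.1⟩, rfl, rfl⟩)
        (Submodule.subset_span ⟨b, rfl, rfl⟩) h1 (by simp [ht])
      rw [← ract_dot S.isModel, ← lact_ract S.isModel] at this
      exact mem_evSpan_cast this (by simp only [PTree.degree]; abel)
    | more q b r =>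
      have hb := card_pos (S.deg_ne b)
      simp only [PTree.degree, Multiset.card_add] at hn
      have h1 := (hC _ (by rw [Multiset.card_add]; omega) _ _ _ _ rfl
        (Submodule.subset_span ⟨r, hx.2.2.1, rfl, rfl⟩) hy).2.2.2
      have := S.dot_mem_normalSpan (Submodule.subset_span ⟨q, ⟨hx.1, hx.2.1⟩, rfl, rfl⟩)
        (Submodule.subset_span ⟨b, rfl, rfl⟩) h1 (by simp [ht])
      rw [← dot_assoc S.isModel] at this
      exact mem_evSpan_cast this (by simp only [PTree.degree]; abel)
  refine ⟨?_, hL, hR s t x y hn hx hy, hM⟩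
  -- Units are treated apart: in degree zero only scalars occur, and only in nonzero degrees is `*`
  -- the plain sum of the three operations.
  by_cases hs : s = 0
  · subst hs
    have h1 : star o x y = x.1 • y := by
      rw [S.evSpan_zero hx]
      ext <;> simp [star_apply]
    rw [h1, zero_add]
    exact Submodule.smul_mem _ _ hy
  by_cases ht : t = 0
  · subst ht
    have h1 : star o x y = y.1 • x := by
      rw [S.evSpan_zero hy]
      ext <;> simp [star_apply, mul_comm]
    rw [h1, add_zero]
    exact Submodule.smul_mem _ _ hx
  have h1 : star o x y = (0, ract o y x.2) + (0, lact o x y.2) + (0, o .dot x.2 y.2) := by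
    rw [S.evSpan_fst hs hx, S.evSpan_fst ht hy]
    ext <;> simp [star_apply, ract_apply, lact_apply]
  rw [h1]
  exact add_mem (add_mem (mem_evSpan_cast (hR t s y x (by rwa [add_comm]) hy hx) (add_comm t s)) hL)
    hM

end LetterSystem
end closed
end FunctorialPBW

namespace FunctorialPBW

/-! ### Decomposition of normal trees into products of nonbare trees and `*`-products from `E` -/

section decomposition

variable {k : Type u} [Field k] {A : Type u} [AddCommGroup A] [Module k A] {γ I : Type}

/-- The span of the values of normal trees that are not bare and of the products `x * a`, `a ∈ E`,
in degree `s`. -/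
def quotSpan (o : TriDendOp → A →ₗ[k] A →ₗ[k] A) (val : γ → A) (deg : γ → Multiset I)
    (E : Multiset I → Submodule k A) (s : Multiset I) : Submodule k (k × A) :=
  nonbareSpan o val deg s ⊔ Submodule.span k {x | ∃ s1 s2, s1 + s2 = s ∧ s2 ≠ 0 ∧
    ∃ u ∈ normalSpan o val deg s1, ∃ a ∈ E s2, star o u (0, a) = x}

variable {o : TriDendOp → A →ₗ[k] A →ₗ[k] A} {val : γ → A} {deg : γ → Multiset I}
  {E : Multiset I → Submodule k A}

theorem star_mem_quotSpan {s s1 s2 : Multiset I} {x : k × A} {a : A} (hs : s1 + s2 = s)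
    (hs2 : s2 ≠ 0) (hx : x ∈ normalSpan o val deg s1) (ha : a ∈ E s2) :
    star o x (0, a) ∈ quotSpan o val deg E s :=
  Submodule.mem_sup_right (Submodule.subset_span ⟨s1, s2, hs, hs2, x, hx, a, ha, rfl⟩)

theorem mem_quotSpan_of_nonbare {s t : Multiset I} {x : k × A} (hx : x ∈ nonbareSpan o val deg s)
    (h : s = t) : x ∈ quotSpan o val deg E t :=
  h ▸ Submodule.mem_sup_left hx

theorem nonbareSpan_le_splitSpan (s : Multiset I) :
    nonbareSpan o val deg s ≤ splitSpan o val deg E s := fun x hx =>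
  Submodule.subset_span ⟨s, 0, by simp, x, hx, (1, 0), one_mem_starSpan, star_one o x⟩

namespace LetterSystem

variable (S : LetterSystem o val deg E)
include S

variable {n : ℕ} (hC : ∀ m ≤ n, ClosedAt o val deg m)
include hC

/-- A right action changes only the end of the root, so a nonempty first subtree survives. -/
theorem ract_mem_guardedSpan {s1 s2 : Multiset I} (hn : (s1 + s2).card ≤ n) {x y : k × A}
    (hx : x ∈ guardedSpan o val deg s1) (hy : y ∈ normalSpan o val deg s2) :
    (0, ract o y x.2) ∈ guardedSpan o val deg (s1 + s2) := by
  refine mem_of_mem_span (LinearMap.inr k k A ∘ₗ ract o y ∘ₗ LinearMap.snd k k A) hx ?_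
  clear hx
  rintro _ ⟨x, ⟨hx, hx'⟩, rfl, rfl⟩
  cases x with
  | nil => exact hx'.elim
  | last q b t =>
    simp only [PTree.degree, Multiset.card_add] at hn
    have h1 := (hC _ (by rw [Multiset.card_add]; omega) _ _ _ _ rfl
      (Submodule.subset_span ⟨t, hx.2.2, rfl, rfl⟩) hy).1
    have := last_mem_guardedSpan (o := o) (Submodule.subset_span ⟨q, ⟨hx.1, hx.2.1⟩, rfl, rfl⟩)
      (Submodule.subset_span ⟨b, rfl, rfl⟩) h1 (S.degree_ne_zero hx')
    rw [ract_star S.isModel, lact_ract S.isModel] at this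
    exact mem_evSpan_cast this (by simp only [PTree.degree]; abel)
  | more q b r =>
    simp only [PTree.degree, Multiset.card_add] at hn
    have h1 := (hC _ (by rw [Multiset.card_add]; omega) _ _ _ _ rfl hy
      (Submodule.subset_span ⟨r, hx.2.2.1, rfl, rfl⟩)).2.2.1
    have := S.dot_mem_guardedSpan (Submodule.subset_span ⟨q, ⟨hx.1, hx.2.1⟩, rfl, rfl⟩)
      (Submodule.subset_span ⟨b, rfl, rfl⟩) h1 (by simp [S.degree_ne_zero hx.2.2.2.ne_nil])
      (S.degree_ne_zero hx')
    rw [← dot_ract S.isModel] at this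
    exact mem_evSpan_cast this (by simp only [PTree.degree]; abel)

theorem dot_mem_guardedSpan' {s1 s2 : Multiset I} (hn : (s1 + s2).card ≤ n) (hs : s2 ≠ 0)
    {x y : k × A} (hx : x ∈ guardedSpan o val deg s1) (hy : y ∈ normalSpan o val deg s2) :
    (0, o .dot x.2 y.2) ∈ guardedSpan o val deg (s1 + s2) := by
  refine mem_of_mem_span (LinearMap.inr k k A ∘ₗ (o .dot).flip y.2 ∘ₗ LinearMap.snd k k A) hx ?_
  clear hx
  rintro _ ⟨x, ⟨hx, hx'⟩, rfl, rfl⟩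
  cases x with
  | nil => exact hx'.elim
  | last q b t =>
    simp only [PTree.degree, Multiset.card_add] at hn
    have h1 := (hC _ (by rw [Multiset.card_add]; omega) _ _ _ _ rfl
      (Submodule.subset_span ⟨t, hx.2.2, rfl, rfl⟩) hy).2.1
    have := S.dot_mem_guardedSpan (Submodule.subset_span ⟨q, ⟨hx.1, hx.2.1⟩, rfl, rfl⟩)
      (Submodule.subset_span ⟨b, rfl, rfl⟩) h1 (by simp [hs]) (S.degree_ne_zero hx')
    rw [← ract_dot S.isModel, ← lact_ract S.isModel] at this
    exact mem_evSpan_cast this (by simp only [PTree.degree]; abel)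
  | more q b r =>
    simp only [PTree.degree, Multiset.card_add] at hn
    have h1 := (hC _ (by rw [Multiset.card_add]; omega) _ _ _ _ rfl
      (Submodule.subset_span ⟨r, hx.2.2.1, rfl, rfl⟩) hy).2.2.2
    have := S.dot_mem_guardedSpan (Submodule.subset_span ⟨q, ⟨hx.1, hx.2.1⟩, rfl, rfl⟩)
      (Submodule.subset_span ⟨b, rfl, rfl⟩) h1 (by simp [hs]) (S.degree_ne_zero hx')
    rw [← dot_assoc S.isModel] at this
    exact mem_evSpan_cast this (by simp only [PTree.degree]; abel)

/-- For a root with one letter the last subtree acquires positive degree; a root with several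
letters is never bare. -/
theorem ract_mem_nonbareSpan {s1 s2 : Multiset I} (hn : (s1 + s2).card ≤ n) (hs : s2 ≠ 0)
    {x y : k × A} (hx : x ∈ normalSpan o val deg s1) (hy : y ∈ normalSpan o val deg s2) :
    (0, ract o y x.2) ∈ nonbareSpan o val deg (s1 + s2) := by
  refine mem_of_mem_span (LinearMap.inr k k A ∘ₗ ract o y ∘ₗ LinearMap.snd k k A) hx ?_
  clear hx
  rintro _ ⟨x, hx, rfl, rfl⟩
  cases x with
  | nil =>
    simp only [PTree.ev, map_zero, LinearMap.comp_apply, LinearMap.snd_apply]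
    exact zero_mem _
  | last q b t =>
    simp only [PTree.degree, Multiset.card_add] at hn
    have h1 := (hC _ (by rw [Multiset.card_add]; omega) _ _ _ _ rfl
      (Submodule.subset_span ⟨t, hx.2.2, rfl, rfl⟩) hy).1
    have := last_mem_nonbareSpan (o := o) (Submodule.subset_span ⟨q, ⟨hx.1, hx.2.1⟩, rfl, rfl⟩)
      (Submodule.subset_span ⟨b, rfl, rfl⟩) h1 (by simp [hs])
    rw [ract_star S.isModel, lact_ract S.isModel] at this
    exact mem_evSpan_cast this (by simp only [PTree.degree]; abel)
  | more q b r =>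
    simp only [PTree.degree, Multiset.card_add] at hn
    have := more_mem_nonbareSpan (o := o) (Submodule.subset_span ⟨q, ⟨hx.1, hx.2.1⟩, rfl, rfl⟩)
      (Submodule.subset_span ⟨b, rfl, rfl⟩) (S.ract_mem_guardedSpan hC
        (by rw [Multiset.card_add]; omega) (Submodule.subset_span ⟨r, hx.2.2, rfl, rfl⟩) hy)
    rw [← dot_ract S.isModel] at this
    exact mem_evSpan_cast this (by simp only [PTree.degree]; abel)

/-- In `x * a = x ≺ a + x ≻ a + x · a` the left side lies in `quotSpan` by definition and `x ≺ a` is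
nonbare. Hence `x ≻ a` and `x · a` are negatives of each other modulo `quotSpan`. -/
theorem lact_mem_quotSpan_iff {s s1 s2 : Multiset I} (hs : s1 + s2 = s) (hn : s.card ≤ n)
    (hs1 : s1 ≠ 0) (hs2 : s2 ≠ 0) {x : k × A} {a : A} (hx : x ∈ normalSpan o val deg s1)
    (ha : a ∈ E s2) : (0, lact o x a) ∈ quotSpan o val deg E s ↔
      (0, o .dot x.2 a) ∈ quotSpan o val deg E s := by
  have h1 : star o x (0, a) = (0, ract o (0, a) x.2) + (0, lact o x a) + (0, o .dot x.2 a) := by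
    rw [S.evSpan_fst hs1 hx]
    ext <;> simp [star_apply, ract_apply, lact_apply]
  have h2 := star_mem_quotSpan (o := o) hs hs2 hx ha
  rw [h1, add_assoc] at h2
  have h3 := mem_quotSpan_of_nonbare (E := E) (S.ract_mem_nonbareSpan hC (hs ▸ hn) hs2 hx
    (val_mem_normalSpan (S.le _ ha))) hs
  have h4 := (Submodule.add_mem_iff_right _ h3).1 h2
  exact ⟨fun h => (Submodule.add_mem_iff_right _ h).1 h4,
    fun h => (Submodule.add_mem_iff_left _ h).1 h4⟩

variable (hD : ∀ s : Multiset I, s.card < n → normalSpan o val deg s ≤ splitSpan o val deg E s)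
include hD

/-- The induction is on the degree of `u`, with the total degree fixed at `n`. One alternates
between `u ≻ a` and `u · a` by `lact_mem_quotSpan_iff`, and in the only case that does not end in a
nonbare tree the left factor has lost a nonempty subtree. -/
theorem lact_mem_quotSpan (m : ℕ) : ∀ (s s1 s2 : Multiset I) (u : k × A) (a : A), s1.card = m →
    s1 + s2 = s → s.card = n → s2 ≠ 0 → u ∈ normalSpan o val deg s1 → a ∈ E s2 →
    (0, lact o u a) ∈ quotSpan o val deg E s := by
  induction m using Nat.strong_induction_on with
  | _ m ih =>
  have hC' : ∀ m < n, ClosedAt o val deg m := fun m hm => hC m hm.le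
  -- The case of a nonbare left factor. General `u` is reduced to it at the end, where a factor of
  -- `u` may be moved past `a`; therefore degrees up to `m` are allowed.
  have main : ∀ (s s1 s2 : Multiset I) (q : k × A) (a : A), s1.card ≤ m →
      s1 + s2 = s → s.card = n → s2 ≠ 0 → q ∈ nonbareSpan o val deg s1 → a ∈ E s2 →
      (0, lact o q a) ∈ quotSpan o val deg E s := by
    intro s s1 s2 q a hm hs hn hs2 hq ha
    by_cases hs1 : s1 = 0
    · subst hs1
      rw [S.evSpan_zero hq, show lact o (q.1, 0) a = q.1 • a by simp [lact_apply],
        show ((0, q.1 • a) : k × A) = q.1 • (0, a) by ext <;> simp]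
      refine Submodule.smul_mem _ _ ?_
      rw [← one_star o (0, a)]
      exact star_mem_quotSpan hs hs2 one_mem_evSpan ha
    -- It is easier to see the shape of `q · a`: the factor `a` is multiplied into the end of the
    -- root of `q`.
    rw [S.lact_mem_quotSpan_iff hC hs hn.le hs1 hs2 (nonbareSpan_le _ hq) ha]
    refine mem_of_mem_span (LinearMap.inr k k A ∘ₗ (o .dot).flip a ∘ₗ LinearMap.snd k k A) hq ?_
    clear hq
    rintro _ ⟨q, ⟨hq, hq'⟩, rfl, rfl⟩
    have hs' := congrArg Multiset.card hs
    cases q with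
    | nil => exact absurd rfl hs1
    | more q b r =>
      simp only [PTree.degree, Multiset.card_add] at hs' hm
      have := more_mem_nonbareSpan (o := o) (Submodule.subset_span ⟨q, ⟨hq.1, hq.2.1⟩, rfl, rfl⟩)
        (Submodule.subset_span ⟨b, rfl, rfl⟩) (S.dot_mem_guardedSpan' hC
          (by rw [Multiset.card_add]; omega) hs2 (Submodule.subset_span ⟨r, hq.2.2, rfl, rfl⟩)
          (val_mem_normalSpan (S.le _ ha)))
      rw [← dot_assoc S.isModel] at this
      exact mem_quotSpan_of_nonbare this (by simp only [PTree.degree, ← hs]; abel)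
    | last q b t =>
      simp only [PTree.degree, Multiset.card_add] at hs' hm
      have hb0 := card_pos (S.deg_ne b)
      have hs20 := card_pos hs2
      have ht : t ≠ .nil := by
        rintro rfl
        exact hq' trivial
      have ht0 := S.degree_ne_zero ht
      have ht1 := card_pos ht0
      have hqm := Submodule.subset_span (R := k) (s := {x | ∃ t : PTree γ, (t.Normal ∧ ¬ t.Bare) ∧
        t.degree deg = q.degree deg ∧ t.ev o val = x}) ⟨q, ⟨hq.1, hq.2.1⟩, rfl, rfl⟩
      have hbm : val b ∈ valSpan k val deg (deg b) := Submodule.subset_span ⟨b, rfl, rfl⟩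
      change (0, o .dot (lact o _ (ract o _ (val b))) a) ∈ _
      rw [lact_ract S.isModel, ract_dot S.isModel]
      -- The tree `q ≻ b ≺ t` times `a` has become `(q ≻ b) · (t ≻ a)`. Splitting `t` as `q' * c`
      -- and moving `c` past `a` gives terms `(q ≻ b) · (q' ≻ a' ≺ c')`.
      refine mem_of_mem_splitSpan (hD _ (by omega) (Submodule.subset_span ⟨t, hq.2.2, rfl, rfl⟩))
        (LinearMap.inr k k A ∘ₗ o .dot (lact o (q.ev o val) (val b)) ∘ₗ (lact o).flip a) _ ?_
      intro t1 t2 ht12 q' hq' c hc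
      change (0, o .dot (lact o (q.ev o val) (val b)) (lact o (star o q' c) a)) ∈ _
      rw [lact_star S.isModel]
      refine S.lact_starSpan (F := E) S.tri_mem' hs2 hc ha (LinearMap.inr k k A ∘ₗ
        o .dot (lact o (q.ev o val) (val b)) ∘ₗ lact o q') _ ?_
      intro s' t' c' a' h1 h2 h3 hc' ha'
      have h4 := congrArg Multiset.card h1
      have h5 := congrArg Multiset.card ht12
      simp only [Multiset.card_add] at h4 h5
      have h30 := card_pos h3
      have hc'm := S.starSpan_le hC' (s := s') (by omega) hc'
      change (0, o .dot (lact o (q.ev o val) (val b)) (lact o q' (ract o c' a'))) ∈ _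
      have hdeg : q.degree deg + deg b + (t1 + t' + s') = s := by
        rw [← hs, PTree.degree, ← ht12, add_assoc t1, add_comm t', h1]
        abel
      -- If `q'` has positive degree, this is a root with several letters. If only `c'` has, it is
      -- `q ≻ (b · a') ≺ c'`, again nonbare. If neither has, `(q ≻ b) · a'` remains.
      by_cases ht1 : t1 = 0
      · subst ht1
        rw [S.evSpan_zero hq', show lact o (q'.1, 0) (ract o c' a') = q'.1 • ract o c' a' by
          simp [lact_apply], map_smul, show ∀ x : A, ((0, q'.1 • x) : k × A) = q'.1 • (0, x) from
          fun x => by ext <;> simp]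
        refine Submodule.smul_mem _ _ ?_
        by_cases hs'0 : s' = 0
        · subst hs'0
          rw [starSpan_zero hc', show ract o (c'.1, 0) a' = c'.1 • a' by
            simp [ract_apply], map_smul, show ∀ x : A, ((0, c'.1 • x) : k × A) = c'.1 • (0, x) from
            fun x => by ext <;> simp]
          refine Submodule.smul_mem _ _ ?_
          have hx := last_mem_normalSpan (o := o) hqm hbm one_mem_evSpan
          rw [ract_one, add_zero] at hx
          have hd : q.degree deg + deg b + t' = s := by simpa [add_assoc] using hdeg
          -- Back from `(q ≻ b) · a'` to `(q ≻ b) ≻ a'`. The left factor is now a bare tree, which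
          -- is why the induction runs over all normal `u`, but it no longer contains `t`, so its
          -- degree is smaller.
          rw [← S.lact_mem_quotSpan_iff hC hd hn.le (by simp [S.deg_ne b]) h3 hx ha']
          exact ih _ (by rw [Multiset.card_add]; omega) s _ _ _ _ rfl hd hn h3 hx ha'
        · have := last_mem_nonbareSpan (o := o) hqm (S.dot_mem hbm (S.le _ ha')) hc'm hs'0
          rw [dot_ract S.isModel, dot_lact S.isModel] at this
          exact mem_quotSpan_of_nonbare this (by rw [← hdeg]; abel)
      · have := more_mem_nonbareSpan (o := o) hqm hbm
          (last_mem_guardedSpan hq' (S.le _ ha') hc'm ht1)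
        exact mem_quotSpan_of_nonbare this (by rw [← hdeg])
  intro s s1 s2 u a hm hs hn hs2 hu ha
  have hs20 := card_pos hs2
  have hs' := congrArg Multiset.card hs
  simp only [Multiset.card_add] at hs'
  refine mem_of_mem_splitSpan (hD _ (by omega) hu) (LinearMap.inr k k A ∘ₗ (lact o).flip a) _ ?_
  intro s11 s12 h12 q hq c hc
  change (0, lact o (star o q c) a) ∈ _
  rw [lact_star S.isModel]
  refine S.lact_starSpan (F := E) S.tri_mem' hs2 hc ha (LinearMap.inr k k A ∘ₗ lact o q) _ ?_
  intro s' t' c' a' h1 h2 h3 hc' ha'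
  have h4 := congrArg Multiset.card h1
  have h5 := congrArg Multiset.card h12
  simp only [Multiset.card_add] at h4 h5
  have h30 := card_pos h3
  change (0, lact o q (ract o c' a')) ∈ _
  have hdeg : s11 + t' + s' = s := by
    rw [← hs, ← h12, add_assoc, add_comm t', h1]
    abel
  by_cases hs'0 : s' = 0
  · subst hs'0
    rw [starSpan_zero hc', show ract o (c'.1, 0) a' = c'.1 • a' by
      simp [ract_apply], map_smul, show ∀ x : A, ((0, c'.1 • x) : k × A) = c'.1 • (0, x) from
      fun x => by ext <;> simp]
    refine Submodule.smul_mem _ _ (main s s11 t' q a' (by omega) ?_ hn h3 hq ha')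
    simpa using hdeg
  · exact mem_quotSpan_of_nonbare (last_mem_nonbareSpan hq (S.le _ ha')
      (S.starSpan_le hC' (by omega) hc') hs'0) hdeg

-- In `u * a` the factor `u` has lower degree and splits as `q * c`; by associativity `a` joins `c`.
omit hC in
theorem quotSpan_le_splitSpan {s : Multiset I} (hn : s.card = n) :
    quotSpan o val deg E s ≤ splitSpan o val deg E s := by
  refine sup_le (nonbareSpan_le_splitSpan s) (Submodule.span_le.2 ?_)
  rintro _ ⟨s1, s2, rfl, hs2, u, hu, a, ha, rfl⟩
  have := card_pos hs2
  rw [Multiset.card_add] at hn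
  refine mem_of_mem_splitSpan (hD s1 (by omega) hu) ((star o).flip (0, a)) _ ?_
  intro s11 s12 h12 q hq c hc
  rw [LinearMap.flip_apply, star_assoc S.isModel]
  exact Submodule.subset_span ⟨s11, s12 + s2, by rw [← h12, add_assoc], q, hq, _,
    S.starSpan_star hs2 hc ha, rfl⟩

/-- Only a bare tree `q ≻ b` needs an argument. Its letter is a combination of elements of `E`,
covered by `lact_mem_quotSpan`, and of products `b' · a` with `a ∈ E`, for which `q ≻ (b' · a) = (q
≻ b') · a` is exchanged with `(q ≻ b') ≻ a`. -/
theorem normalSpan_le_splitSpan {s : Multiset I} (hn : s.card = n) :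
    normalSpan o val deg s ≤ splitSpan o val deg E s := by
  refine Submodule.span_le.2 ?_
  rintro _ ⟨t, ht, rfl, rfl⟩
  by_cases hb : t.Bare
  · match t, hb with
    | .last q b .nil, _ =>
      refine S.quotSpan_le_splitSpan hD hn ?_
      have hqm : q.ev o val ∈ normalSpan o val deg (q.degree deg) :=
        Submodule.subset_span ⟨q, ht.1, rfl, rfl⟩
      have hqm' : q.ev o val ∈ nonbareSpan o val deg (q.degree deg) :=
        Submodule.subset_span ⟨q, ⟨ht.1, ht.2.1⟩, rfl, rfl⟩
      suffices h : valSpan k val deg (deg b) ≤ (quotSpan o val deg E (q.degree deg + deg b)).comap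
          (LinearMap.inr k k A ∘ₗ lact o (q.ev o val)) by
        have := h (Submodule.subset_span ⟨b, rfl, rfl⟩)
        simpa [PTree.ev, ract_one, PTree.degree] using this
      simp only [PTree.degree, add_zero] at hn
      refine (S.le_sup _).trans (sup_le ?_ (Submodule.span_le.2 ?_))
      · intro a ha
        exact S.lact_mem_quotSpan hC hD _ _ _ _ _ _ rfl rfl hn (S.deg_ne b) hqm ha
      · rintro _ ⟨s1, s2, h12, hs1, hs2, b', hb', a, ha, rfl⟩
        change ((0, lact o (q.ev o val) (o .dot b' a)) : k × A) ∈
          quotSpan o val deg E (q.degree deg + deg b)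
        have hx := last_mem_normalSpan (o := o) hqm' hb' one_mem_evSpan
        rw [ract_one, add_zero] at hx
        have hd : q.degree deg + s1 + s2 = q.degree deg + deg b := by rw [← h12, add_assoc]
        rw [dot_lact S.isModel]
        refine (S.lact_mem_quotSpan_iff hC hd hn.le (by simp [hs1]) hs2 hx ha).1 ?_
        exact S.lact_mem_quotSpan hC hD _ _ _ _ _ _ rfl hd hn hs2 hx ha
  · exact nonbareSpan_le_splitSpan _ (Submodule.subset_span ⟨t, ⟨ht, hb⟩, rfl, rfl⟩)

end LetterSystem

namespace LetterSystem

variable (S : LetterSystem o val deg E)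
include S

/-- The two statements feed each other: closure in degree `n` needs splittings below `n`, and
splittings in degree `n` need closure up to `n`. -/
theorem closedAt_and_le (n : ℕ) : ClosedAt o val deg n ∧ ∀ s : Multiset I, s.card = n →
    normalSpan o val deg s ≤ splitSpan o val deg E s := by
  induction n using Nat.strong_induction_on with
  | _ n ih =>
    have h1 := S.closedAt (fun m hm => (ih m hm).1) (fun s hs => (ih _ hs).2 s rfl)
    refine ⟨h1, fun s hs => S.normalSpan_le_splitSpan (fun m hm => ?_)
      (fun s hs => (ih _ hs).2 s rfl) hs⟩
    rcases hm.lt_or_eq with hm | rfl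
    · exact (ih m hm).1
    · exact h1

/-- The values of normal trees of degree `s`, for all `s`, are closed under the operations. -/
theorem op_mem_normalSpan (e : TriDendOp) {s t : Multiset I} {x y : A}
    (hx : ((0, x) : k × A) ∈ normalSpan o val deg s)
    (hy : ((0, y) : k × A) ∈ normalSpan o val deg t) :
    ((0, o e x y) : k × A) ∈ normalSpan o val deg (s + t) := by
  have h1 := (S.closedAt_and_le _).1 s t _ _ rfl hx hy
  have h2 := (S.closedAt_and_le _).1 t s _ _ rfl hy hx
  cases e
  · rw [add_comm]
    simpa [ract_apply] using h2.2.2.1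
  · simpa [lact_apply] using h1.2.1
  · exact h1.2.2.2

end LetterSystem
end decomposition
end FunctorialPBW

namespace FunctorialPBW

/-! ## Symmetrized products -/

section symProd

variable {k : Type u} [Field k] {A : Type u} [AddCommGroup A] [Module k A]

/-- The `·`-product of a nonempty list (zero for the empty list). -/
def listProd (o : TriDendOp → A →ₗ[k] A →ₗ[k] A) : List A → A
  | [] => 0
  | [a] => a
  | a :: b :: l => o .dot a (listProd o (b :: l))

/-- The sum of the `·`-products of all permutations of a list. -/
def symProd (o : TriDendOp → A →ₗ[k] A →ₗ[k] A) (l : List A) : A :=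
  (l.permutations.map (listProd o)).sum

variable (o : TriDendOp → A →ₗ[k] A →ₗ[k] A)

theorem symProd_perm {l l' : List A} (h : l.Perm l') : symProd o l = symProd o l' :=
  (h.permutations.map _).sum_eq

theorem listProd_cons (a : A) {l : List A} (h : l ≠ []) :
    listProd o (a :: l) = o .dot a (listProd o l) := by
  cases l with
  | nil => exact absurd rfl h
  | cons b l => rfl

theorem exists_listProd_append_cons (l1 l2 : List A) :
    ∃ f : A →ₗ[k] A, ∀ x, listProd o (l1 ++ x :: l2) = f x := by
  induction l1 with
  | nil =>
    cases l2 with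
    | nil => exact ⟨LinearMap.id, fun _ => rfl⟩
    | cons b l => exact ⟨(o .dot).flip (listProd o (b :: l)), fun _ => rfl⟩
  | cons a l1 ih =>
    obtain ⟨f, hf⟩ := ih
    refine ⟨o .dot a ∘ₗ f, fun x => ?_⟩
    rw [List.cons_append, listProd_cons o a (by simp), hf]
    rfl

theorem map_listProd {B : Type u} [AddCommGroup B] [Module k B]
    {o' : TriDendOp → B →ₗ[k] B →ₗ[k] B} (f : A →ₗ[k] B)
    (hf : ∀ e x y, f (o e x y) = o' e (f x) (f y)) (l : List A) :
    f (listProd o l) = listProd o' (l.map f) := by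
  induction l with
  | nil => exact map_zero f
  | cons a l ih =>
    cases l with
    | nil => rfl
    | cons b l =>
      rw [listProd_cons o a (by simp), hf, ih, List.map_cons (l := b :: l),
        listProd_cons o' _ (by simp)]

theorem map_symProd {B : Type u} [AddCommGroup B] [Module k B]
    {o' : TriDendOp → B →ₗ[k] B →ₗ[k] B} (f : A →ₗ[k] B)
    (hf : ∀ e x y, f (o e x y) = o' e (f x) (f y)) (l : List A) :
    f (symProd o l) = symProd o' (l.map f) := by
  rw [symProd, symProd, map_list_sum, List.map_map, ← List.map_permutations, List.map_map]
  congr 2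
  funext l
  exact map_listProd o f hf l

variable {o}

theorem listProd_append (h : (triDend k).IsModel o) {l l' : List A} (hl : l ≠ []) (hl' : l' ≠ []) :
    listProd o (l ++ l') = o .dot (listProd o l) (listProd o l') := by
  induction l with
  | nil => exact absurd rfl hl
  | cons a l ih =>
    rw [List.cons_append, listProd_cons o a (by simp [hl'])]
    cases l with
    | nil => rfl
    | cons b l => rw [ih (by simp), listProd_cons o a (by simp), dot_assoc h]

/-- The straightening relation of the PBW theorem: a transposition of neighbours costs a product
with one factor fewer. -/
theorem listProd_swap (h : (triDend k).IsModel o) (l1 l2 : List A) (a b : A) :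
    listProd o (l1 ++ a :: b :: l2) - listProd o (l1 ++ b :: a :: l2) =
      listProd o (l1 ++ (o .dot a b - o .dot b a) :: l2) := by
  obtain ⟨f, hf⟩ := exists_listProd_append_cons o l1 l2
  have key : ∀ a b, listProd o (l1 ++ a :: b :: l2) = f (o .dot a b) := by
    intro a b
    rw [← hf]
    clear hf
    induction l1 with
    | nil =>
      cases l2 with
      | nil => rfl
      | cons c l2 => exact (dot_assoc h _ _ _).symm
    | cons c l1 ih =>
      rw [List.cons_append, List.cons_append, listProd_cons o c (by simp), ih,
        listProd_cons o c (by simp)]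
  rw [key, key, hf, map_sub]

variable {β I : Type} {val : β → A} {deg : β → Multiset I}

/-- The degree of a list. -/
def listDeg (deg : β → Multiset I) (l : List β) : Multiset I := (l.map deg).sum

/-- The span of the `·`-products of letters of total degree `s`. -/
def prodSpan (o : TriDendOp → A →ₗ[k] A →ₗ[k] A) (val : β → A) (deg : β → Multiset I)
    (s : Multiset I) : Submodule k A :=
  Submodule.span k {x | ∃ l : List β, l ≠ [] ∧ listDeg deg l = s ∧ listProd o (l.map val) = x}

/-- The span of the symmetrized products of letters of total degree `s`. -/
abbrev symSpan (o : TriDendOp → A →ₗ[k] A →ₗ[k] A) (val : β → A) (deg : β → Multiset I)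
    (s : Multiset I) : Submodule k A :=
  valSpan k (fun l : {l : List β // l ≠ []} => symProd o (l.1.map val))
    (fun l => listDeg deg l.1) s

theorem symSpan_le_prodSpan (s : Multiset I) : symSpan o val deg s ≤ prodSpan o val deg s := by
  refine Submodule.span_le.2 ?_
  rintro _ ⟨⟨l, hl⟩, rfl, rfl⟩
  refine list_sum_mem fun x hx => ?_
  rw [← List.map_permutations, List.map_map] at hx
  obtain ⟨l', hl', rfl⟩ := List.mem_map.1 hx
  have hp := List.mem_permutations.1 hl'
  refine Submodule.subset_span ⟨l', ?_, (hp.map _).sum_eq, rfl⟩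
  rintro rfl
  exact hl (List.nil_perm.1 hp)

variable (h : (triDend k).IsModel o)
  (hbr : ∀ {s t x y}, x ∈ valSpan k val deg s → y ∈ valSpan k val deg t →
    o .dot x y - o .dot y x ∈ valSpan k val deg (s + t))
include h hbr

/-- A permutation is a chain of adjacent transpositions, each of which costs a shorter product that
`ih` covers. The prefix `l1` is there so that the induction on permutations can pass a common head
to it. -/
theorem listProd_sub_mem_symSpan {n : ℕ}
    (ih : ∀ l : List β, l ≠ [] → l.length < n →
      listProd o (l.map val) ∈ symSpan o val deg (listDeg deg l))
    {l l' : List β} (hp : l.Perm l') : ∀ l1 : List β, (l1 ++ l).length = n →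
      listProd o ((l1 ++ l).map val) - listProd o ((l1 ++ l').map val) ∈
        symSpan o val deg (listDeg deg (l1 ++ l)) := by
  induction hp with
  | nil =>
    intro l1 _
    rw [sub_self]
    exact zero_mem _
  | cons a _ ih' =>
    intro l1 hn
    have := ih' (l1 ++ [a]) (by simpa using hn)
    simpa using this
  | swap a b l2 =>
    intro l1 hn
    have hb : ∀ a, val a ∈ valSpan k val deg (deg a) := fun a =>
      Submodule.subset_span ⟨a, rfl, rfl⟩
    have := listProd_swap h (l1.map val) (l2.map val) (val b) (val a)
    simp only [List.map_append, List.map_cons, this]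
    obtain ⟨f, hf⟩ := exists_listProd_append_cons o (l1.map val) (l2.map val)
    rw [hf]
    refine mem_of_mem_span f (hbr (hb b) (hb a)) ?_
    rintro _ ⟨c, hc, rfl⟩
    rw [← hf]
    have := ih (l1 ++ c :: l2) (by simp) (by simp at hn ⊢; omega)
    simpa [listDeg, hc, add_assoc] using this
  | trans h1 h2 ih1 ih2 =>
    intro l1 hn
    have e1 : (l1 ++ _).Perm (l1 ++ _) := h1.append_left l1
    have := add_mem (ih1 l1 hn) ((show listDeg deg (l1 ++ _) = listDeg deg (l1 ++ _) from
      (e1.map deg).sum_eq) ▸ ih2 l1 (e1.length_eq ▸ hn))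
    simpa using this

/-- Up to shorter terms a product equals each of its rearrangements, hence `n!` times it equals its
symmetrization. -/
theorem listProd_mem_symSpan [CharZero k] (n : ℕ) : ∀ l : List β, l ≠ [] → l.length = n →
    listProd o (l.map val) ∈ symSpan o val deg (listDeg deg l) := by
  induction n using Nat.strong_induction_on with
  | _ n ih =>
  intro l hl hn
  -- Stated for an arbitrary list of permutations, so that it can be proved by induction on that
  -- list.
  have key : ∀ L : List (List β), (∀ l' ∈ L, l'.Perm l) →
      L.length • listProd o (l.map val) - (L.map fun l' => listProd o (l'.map val)).sum ∈
        symSpan o val deg (listDeg deg l) := by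
    intro L hL
    induction L with
    | nil => simp
    | cons l' L ihL =>
      have h1 := listProd_sub_mem_symSpan h hbr (fun l hl hn => ih _ hn l hl rfl)
        (hL l' (by simp)).symm [] hn
      have h2 := add_mem h1 (ihL fun l' hl' => hL l' (by simp [hl']))
      rw [List.map_cons, List.sum_cons, List.length_cons, succ_nsmul]
      rw [List.nil_append, List.nil_append] at h2
      convert h2 using 1
      abel
  have h1 := key l.permutations fun l' hl' => List.mem_permutations.1 hl'
  have h2 : (l.permutations.map fun l' => listProd o (l'.map val)).sum ∈
      symSpan o val deg (listDeg deg l) := by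
    refine Submodule.subset_span ⟨⟨l, hl⟩, rfl, ?_⟩
    simp only [symProd]
    rw [← List.map_permutations, List.map_map]
    rfl
  have h3 := add_mem h1 h2
  -- Characteristic zero enters here: the coefficient `n!` is invertible.
  rw [sub_add_cancel, ← Nat.cast_smul_eq_nsmul k] at h3
  refine (Submodule.smul_mem_iff _ ?_).1 h3
  rw [List.length_permutations]
  exact_mod_cast Nat.factorial_ne_zero _

theorem symSpan_eq_prodSpan [CharZero k] (s : Multiset I) :
    symSpan o val deg s = prodSpan o val deg s := by
  refine le_antisymm (symSpan_le_prodSpan s) (Submodule.span_le.2 ?_)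
  rintro _ ⟨l, hl, rfl, rfl⟩
  exact listProd_mem_symSpan h hbr _ l hl rfl

/-- Symmetrized products of letters that span a graded post-Lie subalgebra. -/
theorem letterSystem_symProd [CharZero k] (hdeg : ∀ b, deg b ≠ 0)
    (htr : ∀ {s t x y}, x ∈ valSpan k val deg s → y ∈ valSpan k val deg t →
      o .prec x y - o .succ y x ∈ valSpan k val deg (s + t)) :
    LetterSystem o (fun l : {l : List β // l ≠ []} => symProd o (l.1.map val))
      (fun l => listDeg deg l.1) (valSpan k val deg) := by
  have hle : ∀ s, valSpan k val deg s ≤ prodSpan o val deg s := fun s => by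
    refine Submodule.span_le.2 ?_
    rintro _ ⟨b, rfl, rfl⟩
    exact Submodule.subset_span ⟨[b], by simp, by simp [listDeg], rfl⟩
  have hdot : ∀ {s t x y}, x ∈ prodSpan o val deg s → y ∈ prodSpan o val deg t →
      o .dot x y ∈ prodSpan o val deg (s + t) := by
    intro s t x y hx hy
    refine mem_of_mem_span ((o .dot).flip y) hx ?_
    rintro _ ⟨l, hl, rfl, rfl⟩
    refine mem_of_mem_span (o .dot (listProd o (l.map val))) hy ?_
    rintro _ ⟨l', hl', rfl, rfl⟩
    refine Submodule.subset_span ⟨l ++ l', by simp [hl], by simp [listDeg], ?_⟩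
    rw [List.map_append, listProd_append h (by simpa using hl) (by simpa using hl')]
  refine ⟨h, ?_, ?_, ?_, ?_, htr, ?_⟩
  · rintro ⟨l, hl⟩
    cases l with
    | nil => exact absurd rfl hl
    | cons b l => simp [listDeg, hdeg]
  · intro s
    change _ ≤ symSpan o val deg s
    rw [symSpan_eq_prodSpan h hbr]
    exact hle s
  · intro s t x y hx hy
    change _ ∈ symSpan o val deg _ at hx hy ⊢
    rw [symSpan_eq_prodSpan h hbr] at *
    exact hdot hx hy
  · intro s t x a hx ha
    change _ ∈ symSpan o val deg _ at hx
    change _ ∈ symSpan o val deg _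
    rw [symSpan_eq_prodSpan h hbr] at *
    refine mem_of_mem_span ((o .prec).flip a - o .succ a) hx ?_
    clear hx
    rintro _ ⟨l, hl, rfl, rfl⟩
    change o .prec _ a - o .succ a _ ∈ _
    induction l with
    | nil => exact absurd rfl hl
    | cons b l ih =>
      have hb : val b ∈ valSpan k val deg (deg b) := Submodule.subset_span ⟨b, rfl, rfl⟩
      cases l with
      | nil =>
        have := hle _ (htr hb ha)
        simpa [listDeg, listProd] using this
      | cons c l =>
        -- The operation `◁ a` is a derivation of `·`: the correction terms cancel by `(b ≺ a) · y =
        -- b · (a ≻ y)`. Induction on the number of factors therefore reduces to single letters.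
        have h1 := hdot (hle _ hb) (ih (by simp))
        have h2 := hdot (hle _ (htr hb ha)) (Submodule.subset_span (s := {x | ∃ l' : List β,
          l' ≠ [] ∧ listDeg deg l' = listDeg deg (c :: l) ∧ listProd o (l'.map val) = x})
          ⟨c :: l, by simp, rfl, rfl⟩)
        have h0 := (isModel_triDend_iff o).1 h
        rw [List.map_cons, listProd_cons o _ (by simp), (h0 _ _ _).2.1, ← (h0 _ _ _).2.2.2.2.2.1]
        have e1 : listDeg deg (b :: c :: l) + t = deg b + (listDeg deg (c :: l) + t) := by
          simp [listDeg, add_assoc]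
        have e2 : deg b + t + listDeg deg (c :: l) = deg b + (listDeg deg (c :: l) + t) := by
          abel
        rw [e1]
        rw [e2] at h2
        convert add_mem h1 h2 using 1
        rw [map_sub, map_sub, LinearMap.sub_apply, (h0 (val b) a _).2.2.2.2.1]
        abel
  · intro s
    change symSpan o val deg s ≤ _
    rw [symSpan_eq_prodSpan h hbr]
    refine Submodule.span_le.2 ?_
    rintro _ ⟨l, hl, rfl, rfl⟩
    -- The last factor is split off, as it is the right factor that has to be in `E`.
    obtain ⟨l, b, rfl⟩ := List.eq_nil_or_concat l |>.resolve_left hl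
    have hb : val b ∈ valSpan k val deg (deg b) := Submodule.subset_span ⟨b, rfl, rfl⟩
    cases l with
    | nil =>
      refine Submodule.mem_sup_left ?_
      simpa [listDeg, listProd] using hb
    | cons c l =>
      refine Submodule.mem_sup_right (Submodule.subset_span ⟨listDeg deg (c :: l), deg b,
        by simp [listDeg, add_assoc], by simp [listDeg, hdeg], hdeg b,
        listProd o ((c :: l).map val), ?_, val b, hb, ?_⟩)
      · change _ ∈ symSpan o val deg _
        rw [symSpan_eq_prodSpan h hbr]
        exact Submodule.subset_span ⟨c :: l, by simp, rfl, rfl⟩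
      · simp only [List.concat_eq_append, List.map_append]
        rw [listProd_append h (by simp) (by simp)]
        rfl

end symProd
end FunctorialPBW

namespace FunctorialPBW

/-! ## Left-normed brackets in post-Lie algebras -/

theorem Mon.vars_ne_nil {E X : Type} (t : Mon E X) : t.vars ≠ [] := by
  induction t with
  | var x => simp [Mon.vars]
  | node e l r hl _ => simp [Mon.vars, hl]

/-- Nonassociative monomials in one binary operation. -/
abbrev Magma (J : Type) : Type := Mon Unit J

/-- The smallest value of a function on the variables of a monomial. -/
def Mon.minKey {E X : Type} (κ : X → ℕ) : Mon E X → ℕ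
  | .var x => κ x
  | .node _ l r => min (l.minKey κ) (r.minKey κ)

/-- The first monomial of the list contains a variable with the smallest key. -/
def MinFirst {J : Type} (κ : J → ℕ) : List (Magma J) → Prop
  | [] => False
  | m :: l => ∀ m' ∈ l, m.minKey κ ≤ m'.minKey κ

/-- The multiset of variables of a list of monomials. -/
def listVars {J : Type} (l : List (Magma J)) : Multiset J := (l.map fun m => (m.vars : Multiset J)).sum

section bracket

variable {k : Type u} [Field k] {A : Type u} [AddCommGroup A] [Module k A] {J : Type}
  (o : PostLieOp → A →ₗ[k] A →ₗ[k] A) (g : J → A)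

/-- The left-normed bracket of a nonempty list (zero for the empty list). -/
def listBracket : List A → A
  | [] => 0
  | a :: l => l.foldl (fun x y => o .bracket x y) a

/-- The value of a monomial under the operation `◁`. -/
def triVal (m : Magma J) : A := m.eval (fun _ => o .triangle) g

/-- The left-normed bracket of the values of monomials. -/
def bracketVal (l : List (Magma J)) : A := listBracket o (l.map (triVal o g))

theorem listBracket_concat {l : List A} (h : l ≠ []) (a : A) :
    listBracket o (l ++ [a]) = o .bracket (listBracket o l) a := by
  cases l with
  | nil => exact absurd rfl h
  | cons b l => simp [listBracket]

theorem bracketVal_concat {l : List (Magma J)} (h : l ≠ []) (m : Magma J) :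
    bracketVal o g (l ++ [m]) = o .bracket (bracketVal o g l) (triVal o g m) := by
  rw [bracketVal, List.map_append, List.map_singleton, listBracket_concat o (by simpa using h)]
  rfl

theorem bracketVal_singleton (m : Magma J) : bracketVal o g [m] = triVal o g m := rfl

theorem map_bracketVal {B : Type u} [AddCommGroup B] [Module k B]
    {o' : PostLieOp → B →ₗ[k] B →ₗ[k] B} (f : A →ₗ[k] B)
    (hf : ∀ e x y, f (o e x y) = o' e (f x) (f y)) (l : List (Magma J)) :
    f (bracketVal o g l) = bracketVal o' (fun j => f (g j)) l := by
  have h1 : ∀ m : Magma J, f (triVal o g m) = triVal o' (fun j => f (g j)) m := by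
    intro m
    induction m with
    | var x => rfl
    | node e l r hl hr =>
      simp only [triVal] at hl hr
      simp only [triVal, Mon.eval, hf, hl, hr]
  induction l using List.reverseRecOn with
  | nil => exact map_zero f
  | append_singleton l m ih =>
    by_cases hl : l = []
    · subst hl
      exact h1 m
    · rw [bracketVal_concat o g hl, hf, ih, h1, bracketVal_concat o' _ hl]

/-- The span of the left-normed brackets of `n` monomials with variables `s`. -/
def bracketSpan (n : ℕ) (s : Multiset J) : Submodule k A :=
  Submodule.span k {x | ∃ l : List (Magma J), l ≠ [] ∧ l.length = n ∧ listVars l = s ∧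
    bracketVal o g l = x}

variable {o g}

theorem bracketSpan_cast {n : ℕ} {s t : Multiset J} {x : A} (hx : x ∈ bracketSpan o g n s)
    (h : s = t) : x ∈ bracketSpan o g n t := h ▸ hx

theorem bracketVal_mem {l : List (Magma J)} (hl : l ≠ []) :
    bracketVal o g l ∈ bracketSpan o g l.length (listVars l) :=
  Submodule.subset_span ⟨l, hl, rfl, rfl, rfl⟩

theorem bracketSpan_one {s : Multiset J} {x : A} {W : Type u} [AddCommGroup W]
    [Module k W] (f : A →ₗ[k] W) (N : Submodule k W) (hx : x ∈ bracketSpan o g 1 s)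
    (h : ∀ m : Magma J, (m.vars : Multiset J) = s → f (triVal o g m) ∈ N) : f x ∈ N := by
  refine mem_of_mem_span f hx ?_
  rintro _ ⟨l, -, hl, hs, rfl⟩
  obtain ⟨m, rfl⟩ := List.length_eq_one_iff.1 hl
  exact h m (by simpa [listVars] using hs)

theorem bracket_mem_concat {n : ℕ} {s t : Multiset J} {x y : A} (hx : x ∈ bracketSpan o g n s)
    (hy : y ∈ bracketSpan o g 1 t) : o .bracket x y ∈ bracketSpan o g (n + 1) (s + t) := by
  refine bracketSpan_one (o .bracket x) _ hy ?_
  rintro m rfl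
  refine mem_of_mem_span ((o .bracket).flip (triVal o g m)) hx ?_
  rintro _ ⟨l, hl, rfl, rfl, rfl⟩
  exact Submodule.subset_span ⟨l ++ [m], by simp, by simp, by simp [listVars],
    bracketVal_concat o g hl m⟩

variable (h : (postLie k).IsModel o)
include h

/-- Since `◁ w` is a derivation of the bracket, it acts on a left-normed bracket entry by entry, and
the number of entries does not change. -/
theorem tri_mem_of_tri_mem_one {t : Multiset J} {w : A}
    (hw : ∀ (s : Multiset J) (x : A), x ∈ bracketSpan o g 1 s →
      o .triangle x w ∈ bracketSpan o g 1 (s + t))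
    {n : ℕ} {s : Multiset J} {x : A} (hx : x ∈ bracketSpan o g n s) :
    o .triangle x w ∈ bracketSpan o g n (s + t) := by
  refine mem_of_mem_span ((o .triangle).flip w) hx ?_
  rintro _ ⟨l, hl, rfl, rfl, rfl⟩
  rw [LinearMap.flip_apply]
  clear hx
  induction l using List.reverseRecOn with
  | nil => exact absurd rfl hl
  | append_singleton l m ih =>
    have hm := bracketVal_mem (o := o) (g := g) (l := [m]) (by simp)
    by_cases hl' : l = []
    · subst hl'
      exact hw _ _ hm
    · rw [bracketVal_concat o g hl', ((isModel_postLie_iff o).1 h _ _ _).2.2.1]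
      have h1 := bracket_mem_concat (ih hl') hm
      have h2 := bracket_mem_concat (bracketVal_mem (o := o) (g := g) hl') (hw _ _ hm)
      have e1 : listVars l + t + listVars [m] = listVars (l ++ [m]) + t := by
        simp only [listVars, List.map_append, List.sum_append]
        abel
      have e2 : listVars l + (listVars [m] + t) = listVars (l ++ [m]) + t := by
        simp only [listVars, List.map_append, List.sum_append]
        abel
      rw [List.length_append]
      exact add_mem (bracketSpan_cast h1 e1) (bracketSpan_cast h2 e2)

theorem tri_mem_one {s t : Multiset J} {x y : A} {n : ℕ} (hx : x ∈ bracketSpan o g n s)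
    (hy : y ∈ bracketSpan o g 1 t) : o .triangle x y ∈ bracketSpan o g n (s + t) := by
  refine tri_mem_of_tri_mem_one h (fun s x hx => ?_) hx
  refine bracketSpan_one (o .triangle x) _ hy ?_
  rintro m rfl
  refine bracketSpan_one ((o .triangle).flip (triVal o g m)) _ hx ?_
  rintro m' rfl
  exact Submodule.subset_span ⟨[.node () m' m], by simp, rfl, by simp [listVars, Mon.vars], rfl⟩

/-- The last post-Lie identity expresses `x ◁ [v, m]` through `◁` by `v`, by `m`, by `v ◁ m` and by
`m ◁ v`, all of fewer bracket entries than `[v, m]`. The number of entries is tracked because `m ◁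
v` must again be a combination of single monomials. -/
theorem tri_mem (r : ℕ) : ∀ {n : ℕ} {s t : Multiset J} {x y : A}, x ∈ bracketSpan o g n s →
    y ∈ bracketSpan o g r t → o .triangle x y ∈ bracketSpan o g n (s + t) := by
  induction r with
  | zero =>
    intro n s t x y hx hy
    refine mem_of_mem_span (o .triangle x) hy ?_
    rintro _ ⟨l, hl, hl', -, -⟩
    exact absurd (List.length_eq_zero_iff.1 hl') hl
  | succ r ih =>
    intro n s t x y hx hy
    refine mem_of_mem_span (o .triangle x) hy ?_
    rintro _ ⟨l, hl, hlr, rfl, rfl⟩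
    obtain ⟨l, m, rfl⟩ := List.eq_nil_or_concat l |>.resolve_left hl
    rw [List.concat_eq_append] at *
    have hm := bracketVal_mem (o := o) (g := g) (l := [m]) (by simp)
    by_cases hl' : l = []
    · subst hl'
      exact tri_mem_one h hx hm
    have hv := bracketVal_mem (o := o) (g := g) hl'
    obtain rfl : l.length = r := by simpa using hlr
    have e : listVars (l ++ [m]) = listVars l + listVars [m] := by simp [listVars]
    refine tri_mem_of_tri_mem_one h (fun s x hx => ?_) hx
    have h4 := ((isModel_postLie_iff o).1 h x (bracketVal o g l) (bracketVal o g [m])).2.2.2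
    rw [bracketVal_concat o g hl', e, ← bracketVal_singleton, ← h4]
    refine sub_mem (sub_mem ?_ ?_) (sub_mem ?_ ?_)
    · exact bracketSpan_cast (tri_mem_one h (ih hx hv) hm) (by abel)
    · exact ih hx (tri_mem_one h hv hm)
    · exact bracketSpan_cast (ih (tri_mem_one h hx hm) hv) (by abel)
    · exact bracketSpan_cast (tri_mem_one h hx (ih hm hv)) (by abel)

/-- The Jacobi identity `[x, [y, z]] = [[x, y], z] - [[x, z], y]` makes the right argument shorter
and keeps the first entry `m` in its place. -/
theorem bracket_mem_perm (m : Magma J) (l2 : List (Magma J)) (hl2 : l2 ≠ []) : ∀ l1 : List (Magma J),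
    o .bracket (bracketVal o g (m :: l1)) (bracketVal o g l2) ∈ Submodule.span k
      {x | ∃ l : List (Magma J), l.Perm (l1 ++ l2) ∧ bracketVal o g (m :: l) = x} := by
  induction l2 using List.reverseRecOn with
  | nil => exact absurd rfl hl2
  | append_singleton l2 m2 ih =>
    intro l1
    by_cases hl : l2 = []
    · subst hl
      exact Submodule.subset_span ⟨l1 ++ [m2], by simp, bracketVal_concat o g (l := m :: l1)
        (by simp) m2⟩
    · have h2 := ((isModel_postLie_iff o).1 h (bracketVal o g (m :: l1)) (bracketVal o g l2)
        (triVal o g m2)).2.1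
      rw [bracketVal_concat o g hl, ← h2]
      refine sub_mem ?_ ?_
      · refine mem_of_mem_span ((o .bracket).flip (triVal o g m2)) (ih hl l1) ?_
        rintro _ ⟨l, hp, rfl⟩
        exact Submodule.subset_span ⟨l ++ [m2], by simpa using hp.append_right [m2],
          bracketVal_concat o g (l := m :: l) (by simp) m2⟩
      · rw [← bracketVal_concat o g (by simp), List.cons_append]
        refine Submodule.span_mono ?_ (ih hl (l1 ++ [m2]))
        rintro _ ⟨l, hp, rfl⟩
        refine ⟨l, hp.trans ?_, rfl⟩
        rw [List.append_assoc]
        exact List.perm_append_comm.append_left l1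

/-- Antisymmetry brings `m` to the front of the bracket that ends with it, `bracket_mem_perm` makes
the result left-normed, and the later entries are appended unchanged. -/
theorem bracketVal_mem_perm {l : List (Magma J)} {m : Magma J} (hm : m ∈ l) :
    bracketVal o g l ∈ Submodule.span k
      {x | ∃ l' : List (Magma J), (m :: l').Perm l ∧ bracketVal o g (m :: l') = x} := by
  obtain ⟨l1, l2, rfl⟩ := List.append_of_mem hm
  by_cases hl : l1 = []
  · subst hl
    exact Submodule.subset_span ⟨l2, .refl _, rfl⟩
  · induction l2 using List.reverseRecOn with
    | nil =>
      -- Antisymmetry does not involve the third argument, so `0` fills it.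
      rw [bracketVal_concat o g hl, ((isModel_postLie_iff o).1 h _ _ 0).1, ← bracketVal_singleton]
      refine neg_mem (Submodule.span_mono ?_ (bracket_mem_perm h m l1 hl []))
      rintro _ ⟨l, hp, rfl⟩
      exact ⟨l, (hp.cons m).trans (List.perm_append_comm (l₁ := [m])), rfl⟩
    | append_singleton l2 m2 ih =>
      rw [← List.cons_append, ← List.append_assoc, bracketVal_concat o g (by simp)]
      refine mem_of_mem_span ((o .bracket).flip (triVal o g m2)) (ih (by simp)) ?_
      rintro _ ⟨l, hp, rfl⟩
      exact Submodule.subset_span ⟨l ++ [m2], by simpa using hp.append_right [m2],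
        bracketVal_concat o g (l := m :: l) (by simp) m2⟩

end bracket

/-! ### Brackets whose first entry contains the smallest variable -/

section minFirst

variable {k : Type u} [Field k] {A : Type u} [AddCommGroup A] [Module k A] {J : Type}
  {o : PostLieOp → A →ₗ[k] A →ₗ[k] A} {g : J → A}

/-- The span of the left-normed brackets of lists of monomials with variables `s` such that the
first monomial contains the smallest variable. -/
abbrev minFirstSpan (o : PostLieOp → A →ₗ[k] A →ₗ[k] A) (g : J → A) (κ : J → ℕ) (s : Multiset J) :
    Submodule k A :=
  valSpan k (fun l : {l : List (Magma J) // MinFirst κ l} => bracketVal o g l.1)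
    (fun l => listVars l.1) s

theorem MinFirst.ne_nil {κ : J → ℕ} {l : List (Magma J)} (h : MinFirst κ l) : l ≠ [] := by
  rintro rfl
  exact h

theorem listVars_ne_zero {l : List (Magma J)} (hl : l ≠ []) : listVars l ≠ 0 := by
  cases l with
  | nil => exact absurd rfl hl
  | cons m l => simp [listVars, Mon.vars_ne_nil]

/-- A monomial with the smallest key is moved to the front. In the multilinear part this cuts the
brackets down to the classical basis of the free Lie algebra on the set of monomials. -/
theorem mem_minFirstSpan (κ : J → ℕ) (h : (postLie k).IsModel o) {l : List (Magma J)}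
    (hl : l ≠ []) : bracketVal o g l ∈ minFirstSpan o g κ (listVars l) := by
  classical
  obtain ⟨m, hm, hmin⟩ := l.toFinset.exists_min_image (Mon.minKey κ) (by simpa using hl)
  rw [List.mem_toFinset] at hm
  refine Submodule.span_mono ?_ (bracketVal_mem_perm h hm)
  rintro _ ⟨l', hp, rfl⟩
  exact ⟨⟨m :: l', fun m' hm' => hmin m' (by simpa using hp.subset (by simp [hm']))⟩,
    (hp.map _).sum_eq, rfl⟩

theorem minFirstSpan_cast {κ : J → ℕ} {s t : Multiset J} {x : A} (hx : x ∈ minFirstSpan o g κ s)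
    (h : s = t) : x ∈ minFirstSpan o g κ t := h ▸ hx

theorem op_mem_minFirstSpan {κ : J → ℕ} (h : (postLie k).IsModel o) (e : PostLieOp)
    {s t : Multiset J} {x y : A} (hx : x ∈ minFirstSpan o g κ s) (hy : y ∈ minFirstSpan o g κ t) :
    o e x y ∈ minFirstSpan o g κ (s + t) := by
  refine mem_of_mem_span ((o e).flip y) hx ?_
  rintro _ ⟨⟨l, hl⟩, rfl, rfl⟩
  refine mem_of_mem_span (o e (bracketVal o g l)) hy ?_
  rintro _ ⟨⟨l', hl'⟩, rfl, rfl⟩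
  cases e with
  | bracket =>
    cases l with
    | nil => exact hl.elim
    | cons m l =>
      refine Submodule.span_le.2 ?_ (bracket_mem_perm h m l' hl'.ne_nil l)
      rintro _ ⟨l2, hp, rfl⟩
      refine minFirstSpan_cast (mem_minFirstSpan κ h (by simp)) ?_
      have := ((hp.cons m).map fun m => (m.vars : Multiset J)).sum_eq
      simpa [listVars, add_assoc] using this
  | triangle =>
    refine Submodule.span_le.2 ?_ (tri_mem h _ (bracketVal_mem hl.ne_nil)
      (bracketVal_mem hl'.ne_nil))
    rintro _ ⟨l2, hl2, -, hs, rfl⟩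
    exact minFirstSpan_cast (mem_minFirstSpan κ h hl2) hs

theorem gen_mem_minFirstSpan (κ : J → ℕ) (j : J) : g j ∈ minFirstSpan o g κ {j} :=
  Submodule.subset_span ⟨⟨[.var j], by simp [MinFirst]⟩, by simp [listVars, Mon.vars], rfl⟩

theorem eval_mem_minFirstSpan (κ : J → ℕ) (h : (postLie k).IsModel o) (t : Mon PostLieOp J) :
    t.eval o g ∈ minFirstSpan o g κ (t.vars : Multiset J) := by
  induction t with
  | var j => exact gen_mem_minFirstSpan κ j
  | node e l r hl hr =>
    rw [Mon.vars, ← Multiset.coe_add]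
    exact op_mem_minFirstSpan h e hl hr

end minFirst
end FunctorialPBW

namespace FunctorialPBW

/-! ## Linear independence of Schröder trees -/

section words

/-- The largest height of a letter of a word. -/
def height {I : Type} : List (ℕ × I) → ℕ
  | [] => 0
  | p :: w => max p.1 (height w)

theorem height_append {I : Type} (u v : List (ℕ × I)) :
    height (u ++ v) = max (height u) (height v) := by
  induction u with
  | nil => simp [height]
  | cons p u ih => simp [height, ih, max_assoc]

/-- The relation between the heights of the factors for each of the operations. -/
def TriDendOp.Rel : TriDendOp → ℕ → ℕ → Prop
  | .prec, m, n => n < m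
  | .succ, m, n => m < n
  | .dot, m, n => m = n

open Classical in
/-- The operations on the space of words whose letters have heights: the product of two words is
their concatenation if their heights are related in the way specified by the operation. -/
noncomputable def wordOp (k : Type u) [Field k] (I : Type) (e : TriDendOp) :
    (List (ℕ × I) →₀ k) →ₗ[k] (List (ℕ × I) →₀ k) →ₗ[k] (List (ℕ × I) →₀ k) :=
  Finsupp.linearCombination k (fun u => Finsupp.linearCombination k (fun v =>
    if e.Rel (height u) (height v) then Finsupp.single (u ++ v) 1 else 0))

open Classical in
theorem wordOp_single (k : Type u) [Field k] {I : Type} (e : TriDendOp) (u v : List (ℕ × I)) :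
    wordOp k I e (Finsupp.single u 1) (Finsupp.single v 1) =
      if e.Rel (height u) (height v) then Finsupp.single (u ++ v) 1 else 0 := by
  simp [wordOp]

open Classical in
/-- The element `x` if `P` holds, and zero otherwise. -/
noncomputable def keepIf {M : Type*} [AddMonoid M] (P : Prop) (x : M) : M := if P then x else 0

theorem keepIf_congr {M : Type*} [AddMonoid M] {P Q : Prop} {x : M} (h : P ↔ Q) :
    keepIf P x = keepIf Q x := by
  rw [propext h]

theorem keepIf_eq_add_add {M : Type*} [AddMonoid M] {P Q R S : Prop} {x : M} (h : S ↔ P ∨ Q ∨ R)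
    (h1 : ¬ (P ∧ Q)) (h2 : ¬ (P ∧ R)) (h3 : ¬ (Q ∧ R)) :
    keepIf S x = keepIf P x + keepIf Q x + keepIf R x := by
  by_cases hP : P <;> by_cases hQ : Q <;> by_cases hR : R <;> simp_all [keepIf]

/-- Either side of an identity, on three words, is their concatenation or zero according to a
condition on three heights. The identities thus become statements about comparisons of maxima. -/
theorem isModel_wordOp (k : Type u) [Field k] (I : Type) : (triDend k).IsModel (wordOp k I) := by
  classical
  have key : ∀ (e f : TriDendOp) (u v w : List (ℕ × I)),
      wordOp k I e (wordOp k I f (Finsupp.single u 1) (Finsupp.single v 1)) (Finsupp.single w 1) =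
        keepIf (f.Rel (height u) (height v) ∧ e.Rel (max (height u) (height v)) (height w))
          (Finsupp.single (u ++ v ++ w) 1) := by
    intro e f u v w
    rw [wordOp_single, keepIf]
    split_ifs with h1 h2 h2
    · rw [wordOp_single, height_append, if_pos h2.2]
    · rw [wordOp_single, height_append, if_neg fun h => h2 ⟨h1, h⟩]
    · exact absurd h2.1 h1
    · simp
  have key' : ∀ (e f : TriDendOp) (u v w : List (ℕ × I)),
      wordOp k I e (Finsupp.single u 1) (wordOp k I f (Finsupp.single v 1) (Finsupp.single w 1)) =
        keepIf (f.Rel (height v) (height w) ∧ e.Rel (height u) (max (height v) (height w)))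
          (Finsupp.single (u ++ v ++ w) 1) := by
    intro e f u v w
    rw [wordOp_single, keepIf]
    split_ifs with h1 h2 h2
    · rw [wordOp_single, height_append, if_pos h2.2, List.append_assoc]
    · rw [wordOp_single, height_append, if_neg fun h => h2 ⟨h1, h⟩]
    · exact absurd h2.1 h1
    · simp
  -- Identities are equalities of trilinear maps, so they may be tested on words.
  have ext3 : ∀ f g : (List (ℕ × I) →₀ k) →ₗ[k] (List (ℕ × I) →₀ k) →ₗ[k] (List (ℕ × I) →₀ k) →ₗ[k]
      (List (ℕ × I) →₀ k), (∀ u v w, f (Finsupp.single u 1) (Finsupp.single v 1)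
        (Finsupp.single w 1) = g (Finsupp.single u 1) (Finsupp.single v 1) (Finsupp.single w 1)) →
      ∀ a b c, f a b c = g a b c := by
    intro f g h a b c
    rw [show f = g from Finsupp.lhom_ext' fun u => LinearMap.ext_ring <| Finsupp.lhom_ext' fun v =>
      LinearMap.ext_ring <| Finsupp.lhom_ext' fun w => LinearMap.ext_ring <| h u v w]
  let o := wordOp k I
  let l (e f : TriDendOp) := (LinearMap.llcomp k _ _ _ (o e)) ∘ₗ (o f)
  let r (e f : TriDendOp) := (LinearMap.lcomp k _ (o f)) ∘ₗ (LinearMap.llcomp k (List (ℕ × I) →₀ k)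
    (List (ℕ × I) →₀ k) (List (ℕ × I) →₀ k)) ∘ₗ (o e)
  have hl : ∀ e f a b c, l e f a b c = o e (o f a b) c := fun _ _ _ _ _ => rfl
  have hr : ∀ e f a b c, r e f a b c = o e a (o f b c) := fun _ _ _ _ _ => rfl
  rw [isModel_triDend_iff]
  intro a b c
  refine ⟨ext3 (l .prec .prec) (r .prec .prec + r .prec .succ + r .prec .dot) ?_ a b c,
    ext3 (l .prec .dot) (r .dot .prec) ?_ a b c, ext3 (l .dot .dot) (r .dot .dot) ?_ a b c,
    ext3 (l .prec .succ) (r .succ .prec) ?_ a b c, ext3 (l .dot .prec) (r .dot .succ) ?_ a b c,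
    ext3 (l .dot .succ) (r .succ .dot) ?_ a b c,
    ext3 (l .succ .prec + l .succ .succ + l .succ .dot) (r .succ .succ) ?_ a b c⟩ <;>
  intro u v w <;>
  simp only [LinearMap.add_apply, hl, hr, o, key, key']
  -- The three summands are the three possible orders of the heights of two neighbouring words;
  -- exactly one of them occurs.
  · refine keepIf_eq_add_add ?_ ?_ ?_ ?_ <;> simp only [TriDendOp.Rel] <;> omega
  iterate 5
    · refine keepIf_congr ?_
      simp only [TriDendOp.Rel]
      omega
  · refine (keepIf_eq_add_add ?_ ?_ ?_ ?_).symm <;> simp only [TriDendOp.Rel] <;> omega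

theorem PTree.map_ev {k : Type u} [Field k] {γ : Type} {A B : Type u} [AddCommGroup A] [Module k A]
    [AddCommGroup B] [Module k B] {o : TriDendOp → A →ₗ[k] A →ₗ[k] A}
    {o' : TriDendOp → B →ₗ[k] B →ₗ[k] B} (f : A →ₗ[k] B)
    (hf : ∀ e x y, f (o e x y) = o' e (f x) (f y)) (val : γ → A) (t : PTree γ) :
    t.ev o' (fun b => f (val b)) = ((t.ev o val).1, f (t.ev o val).2) := by
  induction t with
  | nil => simp [ev]
  | last q b t hq ht => simp [ev, hq, ht, lact_apply, ract_apply, hf]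
  | more q b r hq hr => simp [ev, hq, hr, lact_apply, hf]

/-- Every vertex of the tree that is not finished is continued. -/
def PTree.Proper {γ : Type} : PTree γ → Prop
  | nil => True
  | last q _ t => q.Proper ∧ t.Proper
  | more q _ r => q.Proper ∧ r.Proper ∧ r ≠ nil

/-- The number of vertices in the longest path from the root. -/
def PTree.depth {γ : Type} : PTree γ → ℕ
  | nil => 0
  | last q _ t => max q.depth t.depth + 1
  | more q _ r => max (q.depth + 1) r.depth

theorem PTree.depth_le {γ : Type} (t : PTree γ) : t.depth ≤ t.letters.length := by
  induction t with
  | nil => simp [depth]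
  | last q b t hq ht => simp only [depth, letters, List.length_append, List.length_cons]; omega
  | more q b r hq hr => simp only [depth, letters, List.length_append, List.length_cons]; omega

/-- The sum of the words of a finite set. -/
noncomputable def wordSum (k : Type u) [Field k] {I : Type} (S : Finset (List (ℕ × I))) :
    List (ℕ × I) →₀ k := ∑ w ∈ S, Finsupp.single w 1

open Classical in
theorem wordSum_apply (k : Type u) [Field k] {I : Type} (S : Finset (List (ℕ × I)))
    (w : List (ℕ × I)) : wordSum k S w = if w ∈ S then 1 else 0 := by
  simp [wordSum, Finsupp.finsetSum_apply, Finsupp.single_apply]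

open Classical in
/-- The set of products of words of two sets. -/
noncomputable def mulSet {I : Type} (e : TriDendOp) (S T : Finset (List (ℕ × I))) :
    Finset (List (ℕ × I)) :=
  ((S ×ˢ T).filter fun p => e.Rel (height p.1) (height p.2)).image fun p => p.1 ++ p.2

theorem mem_mulSet {I : Type} {e : TriDendOp} {S T : Finset (List (ℕ × I))} {w : List (ℕ × I)} :
    w ∈ mulSet e S T ↔ ∃ u ∈ S, ∃ v ∈ T, e.Rel (height u) (height v) ∧ u ++ v = w := by
  simp only [mulSet, Finset.mem_image, Finset.mem_filter, Finset.mem_product, Prod.exists]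
  tauto

/-- Words of one length in the left factor make concatenation injective, so every product occurs
with coefficient one. -/
theorem wordOp_wordSum {k : Type u} [Field k] {I : Type} (e : TriDendOp)
    {S : Finset (List (ℕ × I))} (T : Finset (List (ℕ × I))) {n : ℕ}
    (hS : ∀ w ∈ S, w.length = n) :
    wordOp k I e (wordSum k S) (wordSum k T) = wordSum k (mulSet e S T) := by
  classical
  rw [wordSum, wordSum, wordSum, mulSet, Finset.sum_image, Finset.sum_filter, Finset.sum_product]
  · simp only [map_sum, LinearMap.sum_apply, wordOp_single]
    rw [Finset.sum_comm]
  · intro p hp q hq h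
    simp only [Finset.coe_filter, Finset.mem_product, Set.mem_ofPred_eq] at hp hq
    have := List.append_inj h ((hS _ hp.1.1).trans (hS _ hq.1.1).symm)
    exact Prod.ext this.1 this.2

open Classical in
/-- The one-letter words with the letter `x` and heights from `1` to `N`. -/
noncomputable def genSet {I : Type} (N : ℕ) (x : I) : Finset (List (ℕ × I)) :=
  (Finset.Icc 1 N).image fun j => [(j, x)]

theorem mem_genSet {I : Type} {N : ℕ} {x : I} {w : List (ℕ × I)} :
    w ∈ genSet N x ↔ ∃ j, 1 ≤ j ∧ j ≤ N ∧ [(j, x)] = w := by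
  simp [genSet, and_assoc]

/-- The words that occur in the value of a tree. -/
noncomputable def PTree.words {I : Type} (N : ℕ) : PTree I → Finset (List (ℕ × I))
  | nil => {[]}
  | last q x t => mulSet .succ (q.words N) (mulSet .prec (genSet N x) (t.words N))
  | more q x r => mulSet .dot (mulSet .succ (q.words N) (genSet N x)) (r.words N)

theorem PTree.mem_words_last {I : Type} {N : ℕ} {q t : PTree I} {x : I} {w : List (ℕ × I)} :
    w ∈ (last q x t).words N ↔ ∃ u ∈ q.words N, ∃ v ∈ t.words N, ∃ j, 1 ≤ j ∧ j ≤ N ∧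
      height u < j ∧ height v < j ∧ u ++ (j, x) :: v = w := by
  simp only [words, mem_mulSet, mem_genSet]
  constructor
  · rintro ⟨u, hu, _, ⟨_, ⟨j, h1, h2, rfl⟩, v, hv, h3, rfl⟩, h4, rfl⟩
    simp only [TriDendOp.Rel, height, height_append] at h3 h4
    exact ⟨u, hu, v, hv, j, h1, h2, by omega, by omega, rfl⟩
  · rintro ⟨u, hu, v, hv, j, h1, h2, h3, h4, rfl⟩
    refine ⟨u, hu, _, ⟨_, ⟨j, h1, h2, rfl⟩, v, hv, ?_, rfl⟩, ?_, rfl⟩ <;>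
    simp only [TriDendOp.Rel, height, height_append] <;> omega

theorem PTree.mem_words_more {I : Type} {N : ℕ} {q r : PTree I} {x : I} {w : List (ℕ × I)} :
    w ∈ (more q x r).words N ↔ ∃ u ∈ q.words N, ∃ v ∈ r.words N, ∃ j, 1 ≤ j ∧ j ≤ N ∧
      height u < j ∧ height v = j ∧ u ++ (j, x) :: v = w := by
  simp only [words, mem_mulSet, mem_genSet]
  constructor
  · rintro ⟨_, ⟨u, hu, _, ⟨j, h1, h2, rfl⟩, h3, rfl⟩, v, hv, h4, rfl⟩
    simp only [TriDendOp.Rel, height, height_append] at h3 h4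
    exact ⟨u, hu, v, hv, j, h1, h2, by omega, by omega, by simp⟩
  · rintro ⟨u, hu, v, hv, j, h1, h2, h3, h4, rfl⟩
    refine ⟨_, ⟨u, hu, _, ⟨j, h1, h2, rfl⟩, ?_, rfl⟩, v, hv, ?_, by simp⟩ <;>
    simp only [TriDendOp.Rel, height, height_append] <;> omega

theorem PTree.length_of_mem_words {I : Type} {N : ℕ} {t : PTree I} : ∀ {w : List (ℕ × I)},
    w ∈ t.words N → w.length = t.letters.length := by
  induction t with
  | nil => simp [words, letters]
  | last q x t hq ht =>
    intro w hw
    obtain ⟨u, hu, v, hv, j, -, -, -, -, rfl⟩ := mem_words_last.1 hw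
    simp [letters, hq hu, ht hv]
  | more q x r hq hr =>
    intro w hw
    obtain ⟨u, hu, v, hv, j, -, -, -, -, rfl⟩ := mem_words_more.1 hw
    simp [letters, hq hu, hr hv]

/-- All letters of the root are given the height `h` and the subtrees stay below it. The height is
prescribed rather than merely bounded because the rest of a root with several letters has to have
the same height as the first letter. -/
theorem PTree.exists_mem_words {I : Type} {N : ℕ} {t : PTree I} (ht : t.Proper) :
    t ≠ nil → ∀ h, t.depth ≤ h → h ≤ N → ∃ w ∈ t.words N, height w = h := by
  have key : ∀ q : PTree I, (q ≠ nil → ∀ h, q.depth ≤ h → h ≤ N → ∃ w ∈ q.words N, height w = h) →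
      ∀ h, q.depth < h → h ≤ N → ∃ w ∈ q.words N, height w < h := by
    intro q hq h h1 h2
    by_cases hn : q = nil
    · subst hn
      exact ⟨[], by simp [words], by simpa [depth, height] using h1⟩
    · obtain ⟨w, hw, hw'⟩ := hq hn _ le_rfl (by omega)
      exact ⟨w, hw, by omega⟩
  induction t with
  | nil => exact fun h => absurd rfl h
  | last q x t hq ht' =>
    intro _ h h1 h2
    simp only [depth] at h1
    obtain ⟨u, hu, hu'⟩ := key q (hq ht.1) h (by omega) h2
    obtain ⟨v, hv, hv'⟩ := key t (ht' ht.2) h (by omega) h2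
    refine ⟨_, mem_words_last.2 ⟨u, hu, v, hv, h, by omega, h2, hu', hv', rfl⟩, ?_⟩
    simp only [height, height_append]
    omega
  | more q x r hq hr =>
    intro _ h h1 h2
    simp only [depth] at h1
    obtain ⟨u, hu, hu'⟩ := key q (hq ht.1) h (by omega) h2
    obtain ⟨v, hv, hv'⟩ := hr ht.2.1 ht.2.2 h (by omega) h2
    refine ⟨_, mem_words_more.2 ⟨u, hu, v, hv, h, by omega, h2, hu', hv', rfl⟩, ?_⟩
    simp only [height, height_append]
    omega

theorem height_cons_le_of_suffix {I : Type} {p : ℕ × I} {u v w : List (ℕ × I)}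
    (h : u = v ++ p :: w) : p.1 ≤ height u := by
  subst h
  simp only [height, height_append]
  omega

/-- Both decompositions cut the word at the first letter of a given height, since everything before
it is lower. -/
theorem append_cons_inj_of_height_lt {I : Type} {u v u' v' : List (ℕ × I)} {p p' : ℕ × I}
    (h : u ++ p :: v = u' ++ p' :: v') (hu : height u < p.1) (hu' : height u' < p'.1)
    (hp : p.1 = p'.1) : u = u' ∧ p = p' ∧ v = v' := by
  rcases List.append_eq_append_iff.1 h with ⟨a, h1, h2⟩ | ⟨a, h1, h2⟩
  · cases a with
    | nil => simp_all
    | cons c a =>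
      obtain ⟨rfl, -⟩ : p = c ∧ _ := by simpa using h2
      have := height_cons_le_of_suffix h1
      omega
  · cases a with
    | nil => simp_all
    | cons c a =>
      obtain ⟨rfl, -⟩ : p' = c ∧ _ := by simpa using h2
      have := height_cons_le_of_suffix h1
      omega

/-- A word determines its tree: the first letter of maximal height is the first letter of the root,
and this height occurs again afterwards exactly when the root has further letters. -/
theorem PTree.eq_of_mem_words {I : Type} {N : ℕ} {t : PTree I} : ∀ {t' : PTree I}
    {w : List (ℕ × I)}, w ∈ t.words N → w ∈ t'.words N → t = t' := by
  induction t with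
  | nil =>
    intro t' w hw hw'
    obtain rfl : w = [] := by simpa [words] using hw
    have := length_of_mem_words hw'
    cases t' <;> simp [letters] at this ⊢
  | last q x t hq ht =>
    intro t' w hw hw'
    obtain ⟨u, hu, v, hv, j, -, -, h1, h2, rfl⟩ := mem_words_last.1 hw
    cases t' with
    | nil => simp [words] at hw'
    | last q' x' t' =>
      obtain ⟨u', hu', v', hv', j', -, -, h1', h2', h⟩ := mem_words_last.1 hw'
      have hj := congrArg height h
      simp only [height, height_append] at hj
      obtain ⟨rfl, hp, rfl⟩ := append_cons_inj_of_height_lt h h1' h1 (by simp only; omega)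
      rw [hq hu hu', ht hv hv', (Prod.mk.inj hp).2]
    | more q' x' r' =>
      obtain ⟨u', hu', v', hv', j', -, -, h1', h2', h⟩ := mem_words_more.1 hw'
      have hj := congrArg height h
      simp only [height, height_append] at hj
      obtain ⟨rfl, hp, rfl⟩ := append_cons_inj_of_height_lt h h1' h1 (by simp only; omega)
      omega
  | more q x r hq hr =>
    intro t' w hw hw'
    obtain ⟨u, hu, v, hv, j, -, -, h1, h2, rfl⟩ := mem_words_more.1 hw
    cases t' with
    | nil => simp [words] at hw'
    | last q' x' t' =>
      obtain ⟨u', hu', v', hv', j', -, -, h1', h2', h⟩ := mem_words_last.1 hw'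
      have hj := congrArg height h
      simp only [height, height_append] at hj
      obtain ⟨rfl, hp, rfl⟩ := append_cons_inj_of_height_lt h h1' h1 (by simp only; omega)
      omega
    | more q' x' r' =>
      obtain ⟨u', hu', v', hv', j', -, -, h1', h2', h⟩ := mem_words_more.1 hw'
      have hj := congrArg height h
      simp only [height, height_append] at hj
      obtain ⟨rfl, hp, rfl⟩ := append_cons_inj_of_height_lt h h1' h1 (by simp only; omega)
      rw [hq hu hu', hr hv hv', (Prod.mk.inj hp).2]

theorem height_pos_of_mem_genSet {I : Type} {N : ℕ} {x : I} {w : List (ℕ × I)}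
    (hw : w ∈ genSet N x) : 0 < height w := by
  obtain ⟨j, h, -, rfl⟩ := mem_genSet.1 hw
  simp only [height]
  omega

/-- The empty tree acts as the unit, and so does its word: the empty word has height `0`, below all
letters in use, because the heights of generators begin at `1`. -/
theorem lact_ev_wordSum {k : Type u} [Field k] {I : Type} {N : ℕ} {q : PTree I}
    (hq : q ≠ .nil → (q.ev (wordOp k I) fun x => wordSum k (genSet N x)).2 =
      wordSum k (q.words N)) {B : Finset (List (ℕ × I))} (hB : ∀ w ∈ B, 0 < height w) :
    lact (wordOp k I) (q.ev (wordOp k I) fun x => wordSum k (genSet N x)) (wordSum k B) =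
      wordSum k (mulSet .succ (q.words N) B) := by
  by_cases h : q = .nil
  · subst h
    have : mulSet .succ (PTree.nil.words N) B = B := by
      ext w
      simp only [mem_mulSet, PTree.words, Finset.mem_singleton, exists_eq_left, height,
        TriDendOp.Rel, List.nil_append]
      exact ⟨by rintro ⟨v, hv, -, rfl⟩; exact hv, fun hw => ⟨w, hw, hB w hw, rfl⟩⟩
    rw [this, PTree.ev, lact_one]
  · rw [lact_apply, PTree.ev_fst_of_ne_nil _ _ h, zero_smul, zero_add, hq h,
      wordOp_wordSum _ _ fun w => PTree.length_of_mem_words]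

theorem ract_ev_wordSum {k : Type u} [Field k] {I : Type} {N : ℕ} {q : PTree I}
    (hq : q ≠ .nil → (q.ev (wordOp k I) fun x => wordSum k (genSet N x)).2 =
      wordSum k (q.words N)) (x : I) :
    ract (wordOp k I) (q.ev (wordOp k I) fun x => wordSum k (genSet N x))
      (wordSum k (genSet N x)) = wordSum k (mulSet .prec (genSet N x) (q.words N)) := by
  by_cases h : q = .nil
  · subst h
    have : mulSet .prec (genSet N x) (PTree.nil.words N) = genSet N x := by
      ext w
      simp only [mem_mulSet, PTree.words, Finset.mem_singleton, exists_eq_left, height,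
        TriDendOp.Rel, List.append_nil]
      exact ⟨by rintro ⟨v, hv, -, rfl⟩; exact hv,
        fun hw => ⟨w, hw, height_pos_of_mem_genSet hw, rfl⟩⟩
    rw [this, PTree.ev, ract_one]
  · rw [ract_apply, PTree.ev_fst_of_ne_nil _ _ h, zero_smul, zero_add, hq h,
      wordOp_wordSum (n := 1)]
    intro w hw
    obtain ⟨j, -, -, rfl⟩ := mem_genSet.1 hw
    rfl

theorem PTree.ev_wordOp {k : Type u} [Field k] {I : Type} {N : ℕ} {t : PTree I} (ht : t.Proper) :
    t ≠ nil → (t.ev (wordOp k I) fun x => wordSum k (genSet N x)).2 = wordSum k (t.words N) := by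
  induction t with
  | nil => exact fun h => absurd rfl h
  | last q x t hq ht' =>
    intro _
    rw [ev, ract_ev_wordSum (ht' ht.2), lact_ev_wordSum (hq ht.1)]
    · rfl
    · intro w hw
      obtain ⟨u, hu, v, -, -, rfl⟩ := mem_mulSet.1 hw
      have := height_pos_of_mem_genSet hu
      rw [height_append]
      omega
  | more q x r hq hr =>
    intro _
    rw [ev, lact_ev_wordSum (hq ht.1) fun w => height_pos_of_mem_genSet, hr ht.2.1 ht.2.2,
      wordOp_wordSum (n := q.letters.length + 1)]
    · rfl
    · intro w hw
      obtain ⟨u, hu, v, hv, -, rfl⟩ := mem_mulSet.1 hw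
      obtain ⟨j, -, -, rfl⟩ := mem_genSet.1 hv
      simp [length_of_mem_words hu]

/-- The values of different trees in the free tridendriform algebra are linearly independent. -/
theorem linearIndependent_ev_gen (k : Type u) [Field k] (I : Type) :
    LinearIndependent k fun t : {t : PTree I // t.Proper ∧ t ≠ .nil} =>
      (t.1.ev (triDend k).op (triDend k).gen).2 := by
  classical
  rw [linearIndependent_iff']
  intro s c hc t ht
  -- This bounds the depth of `t`, so `t` has a word with heights up to `N`. That word occurs in no
  -- other tree, and its coefficient isolates `c t`.
  let N := ∑ t ∈ s, t.1.letters.length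
  have hN : t.1.letters.length ≤ N :=
    Finset.single_le_sum (f := fun t : {t : PTree I // t.Proper ∧ t ≠ .nil} => t.1.letters.length)
      (fun _ _ => Nat.zero_le _) ht
  obtain ⟨w, hw, -⟩ := PTree.exists_mem_words t.2.1 t.2.2 N (t.1.depth_le.trans hN) le_rfl
  let f := (triDend k).lift (wordOp k I) (isModel_wordOp k I) fun x => wordSum k (genSet N x)
  have hf : ∀ t : {t : PTree I // t.Proper ∧ t ≠ .nil},
      f (t.1.ev (triDend k).op (triDend k).gen).2 = wordSum k (t.1.words N) := by
    intro t
    rw [← PTree.ev_wordOp t.2.1 t.2.2]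
    have h := PTree.map_ev f ((triDend k).lift_op (isModel_wordOp k I) _) (triDend k).gen t.1
    rw [show (fun x => f ((triDend k).gen x)) = fun x => wordSum k (genSet N x) from
      funext fun x => (triDend k).lift_gen (isModel_wordOp k I) _ x] at h
    rw [h]
  have h := DFunLike.congr_fun (congrArg f hc) w
  rw [map_sum, Finsupp.finsetSum_apply, Finset.sum_eq_single_of_mem t ht] at h
  · simpa [hf, wordSum_apply, hw] using h
  · intro t' _ hne
    rw [map_smul, hf, Finsupp.smul_apply, wordSum_apply, if_neg, smul_zero]
    exact fun hw' => hne (Subtype.ext (PTree.eq_of_mem_words hw' hw))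

end words
end FunctorialPBW

namespace FunctorialPBW

/-! ## Normal trees with composite letters, encoded by trees -/

namespace PTree

variable {α β γ : Type}

/-- The tree with the letters replaced by their images under a map. -/
def map (f : α → β) : PTree α → PTree β
  | nil => nil
  | last q b t => last (q.map f) (f b) (t.map f)
  | more q b r => more (q.map f) (f b) (r.map f)

theorem map_map (f : α → β) (g : β → γ) (t : PTree α) : (t.map f).map g = t.map (g ∘ f) := by
  induction t with
  | nil => rfl
  | last q b t hq ht => simp [map, hq, ht]
  | more q b t hq ht => simp [map, hq, ht]

theorem letters_map (f : α → β) (t : PTree α) : (t.map f).letters = t.letters.map f := by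
  induction t with
  | nil => rfl
  | last q b t hq ht => simp [map, letters, hq, ht]
  | more q b t hq ht => simp [map, letters, hq, ht]

theorem degree_map {Γ : Type} [AddCommMonoid Γ] (f : α → β) (deg : β → Γ) (t : PTree α) :
    (t.map f).degree deg = t.degree fun a => deg (f a) := by
  induction t with
  | nil => rfl
  | last q b t hq ht => simp [map, degree, hq, ht]
  | more q b t hq ht => simp [map, degree, hq, ht]

theorem degree_eq_sum {Γ : Type} [AddCommMonoid Γ] (deg : α → Γ) (t : PTree α) :
    t.degree deg = (t.letters.map deg).sum := by
  induction t with
  | nil => rfl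
  | last q b t hq ht => simp [letters, degree, hq, ht, add_assoc]
  | more q b t hq ht => simp [letters, degree, hq, ht, add_assoc]

theorem map_degree {Γ Δ : Type} [AddCommMonoid Γ] [AddCommMonoid Δ] (f : Γ →+ Δ) (deg : α → Γ)
    (t : PTree α) : f (t.degree deg) = t.degree fun a => f (deg a) := by
  rw [degree_eq_sum, degree_eq_sum, map_list_sum, List.map_map]
  rfl

theorem degree_congr {Γ : Type} [AddCommMonoid Γ] {deg deg' : α → Γ} {t : PTree α}
    (h : ∀ b ∈ t.letters, deg b = deg' b) : t.degree deg = t.degree deg' := by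
  rw [degree_eq_sum, degree_eq_sum, List.map_congr_left h]

theorem map_eq_nil {f : α → β} {t : PTree α} : t.map f = nil ↔ t = nil := by
  cases t <;> simp [map]

theorem bare_map {f : α → β} {t : PTree α} : (t.map f).Bare ↔ t.Bare := by
  cases t with
  | nil => rfl
  | last q b t => cases t <;> rfl
  | more => rfl

theorem guarded_map {f : α → β} {t : PTree α} : (t.map f).Guarded ↔ t.Guarded := by
  cases t with
  | nil => rfl
  | last q b t => exact not_congr map_eq_nil
  | more => exact not_congr map_eq_nil

theorem normal_map {f : α → β} {t : PTree α} : (t.map f).Normal ↔ t.Normal := by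
  induction t with
  | nil => rfl
  | last q b t hq ht => simp only [map, Normal, hq, ht, bare_map]
  | more q b t hq ht => simp only [map, Normal, hq, ht, bare_map, guarded_map]

theorem map_injective {f : α → β} (hf : Function.Injective f) :
    Function.Injective (PTree.map f) := by
  intro t
  induction t with
  | nil => intro t' h; cases t' <;> simp [map] at h ⊢
  | last q b t hq ht =>
    intro t' h
    cases t' with
    | last q' b' t' =>
      simp only [map, last.injEq] at h
      rw [hq h.1, hf h.2.1, ht h.2.2]
    | _ => simp [map] at h
  | more q b t hq ht =>
    intro t' h
    cases t' with
    | more q' b' t' =>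
      simp only [map, more.injEq] at h
      rw [hq h.1, hf h.2.1, ht h.2.2]
    | _ => simp [map] at h

theorem exists_map_eq {f : α → β} {t : PTree β} {P : α → Prop}
    (h : ∀ b ∈ t.letters, ∃ a, f a = b ∧ P a) :
    ∃ t' : PTree α, t'.map f = t ∧ ∀ a ∈ t'.letters, P a := by
  induction t with
  | nil => exact ⟨nil, rfl, by simp [letters]⟩
  | last q b t hq ht =>
    simp only [letters, List.mem_append, List.mem_cons] at h
    obtain ⟨q', rfl, h1⟩ := hq fun b hb => h b (.inl hb)
    obtain ⟨a, rfl, h2⟩ := h b (.inr (.inl rfl))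
    obtain ⟨t', rfl, h3⟩ := ht fun b hb => h b (.inr (.inr hb))
    refine ⟨last q' a t', rfl, ?_⟩
    simp only [letters, List.mem_append, List.mem_cons]
    rintro c (h | rfl | h)
    exacts [h1 c h, h2, h3 c h]
  | more q b t hq ht =>
    simp only [letters, List.mem_append, List.mem_cons] at h
    obtain ⟨q', rfl, h1⟩ := hq fun b hb => h b (.inl hb)
    obtain ⟨a, rfl, h2⟩ := h b (.inr (.inl rfl))
    obtain ⟨t', rfl, h3⟩ := ht fun b hb => h b (.inr (.inr hb))
    refine ⟨more q' a t', rfl, ?_⟩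
    simp only [letters, List.mem_append, List.mem_cons]
    rintro c (h | rfl | h)
    exacts [h1 c h, h2, h3 c h]

theorem ev_map {k : Type u} [Field k] {A : Type u} [AddCommGroup A] [Module k A]
    (o : TriDendOp → A →ₗ[k] A →ₗ[k] A) (f : α → β) (val : β → A) (t : PTree α) :
    (t.map f).ev o val = t.ev o fun a => val (f a) := by
  induction t with
  | nil => rfl
  | last q b t hq ht => simp [map, ev, hq, ht]
  | more q b t hq ht => simp [map, ev, hq, ht]

theorem finite_setOf_length_le [Finite α] (n : ℕ) :
    {t : PTree α | t.letters.length ≤ n}.Finite := by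
  induction n with
  | zero =>
    refine (Set.finite_singleton nil).subset ?_
    intro t ht
    cases t <;> simp [letters] at ht ⊢
  | succ n ih =>
    have h := ih.prod ((Set.finite_univ (α := α)).prod ih)
    refine (((Set.finite_singleton nil).union (h.image fun p => last p.1 p.2.1 p.2.2)).union
      (h.image fun p => more p.1 p.2.1 p.2.2)).subset ?_
    intro t ht
    cases t with
    | nil => exact .inl (.inl rfl)
    | last q b t =>
      simp only [Set.mem_ofPred_eq, letters, List.length_append, List.length_cons] at ht
      exact .inl (.inr ⟨(q, b, t), ⟨show q.letters.length ≤ n by omega, trivial, show t.letters.length ≤ n by omega⟩, rfl⟩)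
    | more q b t =>
      simp only [Set.mem_ofPred_eq, letters, List.length_append, List.length_cons] at ht
      exact .inr ⟨(q, b, t), ⟨show q.letters.length ≤ n by omega, trivial, show t.letters.length ≤ n by omega⟩, rfl⟩

/-- A bare root is removed from the tree, and its letter is returned. -/
def peel : PTree (List α) → PTree (List α) × List α
  | last q b nil => (q, b)
  | t => (t, [])

/-- The letter `m` with the subtree `q` before it is put in front of the root; it is merged into
the first letter if the first subtree is empty. -/
def mergeFirst (q : PTree (List α)) (m : α) : PTree (List α) → PTree (List α)
  | last nil b u => last q (m :: b) u
  | more nil b u => more q (m :: b) u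
  | r => more q [m] r

theorem peel_of_not_bare {t : PTree (List α)} (h : ¬ t.Bare) : peel t = (t, []) := by
  cases t with
  | nil => rfl
  | last q b t =>
    cases t with
    | nil => exact absurd trivial h
    | _ => rfl
  | more => rfl

theorem mergeFirst_of_guarded (q : PTree (List α)) (m : α) {r : PTree (List α)}
    (h : r.Guarded) : mergeFirst q m r = more q [m] r := by
  cases r with
  | nil => exact h.elim
  | last q' b u =>
    cases q' with
    | nil => exact absurd rfl h
    | _ => rfl
  | more q' b u =>
    cases q' with
    | nil => exact absurd rfl h
    | _ => rfl

end PTree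

/-- The monomial `(…((x ◁ m₁) ◁ m₂)…) ◁ mᵣ`. -/
def Magma.mk {I : Type} (x : I) (l : List (Magma I)) : Magma I :=
  l.foldl (fun m m' => .node () m m') (.var x)

theorem Magma.vars_mk {I : Type} (x : I) (l : List (Magma I)) :
    ((Magma.mk x l).vars : Multiset I) = {x} + listVars l := by
  induction l using List.reverseRecOn with
  | nil => simp [mk, Mon.vars, listVars]
  | append_singleton l m ih =>
    have : Magma.mk x (l ++ [m]) = .node () (Magma.mk x l) m := by simp [mk]
    rw [this, Mon.vars, ← Multiset.coe_add, ih]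
    simp [listVars]

theorem Magma.exists_mk {I : Type} (m : Magma I) : ∃ x l, Magma.mk x l = m := by
  induction m with
  | var x => exact ⟨x, [], rfl⟩
  | node e m m' h _ =>
    obtain ⟨x, l, rfl⟩ := h
    exact ⟨x, l ++ [m'], by simp [mk]⟩

/-- The tree with composite letters encoded by a tree. -/
def PTree.decode {I : Type} : PTree I → PTree (List (Magma I))
  | nil => nil
  -- A normal tree may not have a bare subtree to the left of a letter. If one arises, its root is
  -- removed and the entries of the letter at that root become the arguments of `x` under `◁`.
  | last t x t' => last (peel t.decode).1 [Magma.mk x (peel t.decode).2] t'.decode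
  | more t x t' => mergeFirst (peel t.decode).1 (Magma.mk x (peel t.decode).2) t'.decode

/-- The decoding is undone from the first variable of the first letter, by induction on the degree.
Only surjectivity of the decoding is needed for the count. -/
theorem PTree.exists_decode {I : Type} (N : ℕ) : ∀ n : PTree (List (Magma I)),
    (n.degree listVars).card ≤ N → n.Normal → (∀ b ∈ n.letters, b ≠ []) →
      ∃ t : PTree I, t.Proper ∧ t.decode = n ∧ t.degree (fun x => {x}) = n.degree listVars := by
  induction N using Nat.strong_induction_on with
  | h N ih =>
  -- With `m = (…(x ◁ m₁)…) ◁ mᵣ`, the left subtree must decode to `q` itself if `r = 0`, and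
  -- otherwise to `q` with the bare root `[m₁, …, mᵣ]` on top. The degree has dropped by `x` in both
  -- cases; `s` is the degree of the rest of the tree.
  have hpeel : ∀ (q : PTree (List (Magma I))) (m : Magma I) (s : Multiset I),
      (q.degree listVars + m.vars + s).card ≤ N → q.Normal → ¬ q.Bare → (∀ b ∈ q.letters, b ≠ []) →
      ∃ (t : PTree I) (x : I), t.Proper ∧ (peel t.decode).1 = q ∧
        Magma.mk x (peel t.decode).2 = m ∧
        t.degree (fun x => {x}) + {x} = q.degree listVars + m.vars := by
    intro q m s hN hq hb hl
    obtain ⟨x, js, rfl⟩ := m.exists_mk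
    rw [Magma.vars_mk] at hN ⊢
    simp only [Multiset.card_add, Multiset.card_singleton] at hN
    by_cases hjs : js = []
    · subst hjs
      obtain ⟨t, h1, rfl, h3⟩ := ih (q.degree listVars).card (by omega) q le_rfl hq hl
      refine ⟨t, x, h1, ?_, ?_, ?_⟩
      · rw [peel_of_not_bare hb]
      · rw [peel_of_not_bare hb]
      · simp [h3, listVars]
    · obtain ⟨t, h1, h2, h3⟩ := ih ((last q js nil).degree listVars).card
        (by simp only [degree, Multiset.card_add, Multiset.card_zero]; omega) (last q js nil) le_rfl
        ⟨hq, hb, trivial⟩ (by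
          simp only [letters, List.mem_append, List.mem_singleton]
          rintro b (h | rfl)
          exacts [hl b h, hjs])
      refine ⟨t, x, h1, by rw [h2]; rfl, by rw [h2]; rfl, ?_⟩
      rw [h3, degree, degree]
      abel
  intro n hN hn hl
  cases n with
  | nil => exact ⟨nil, trivial, rfl, rfl⟩
  | last q b u =>
    simp only [letters, List.mem_append, List.mem_cons] at hl
    cases b with
    | nil => exact absurd rfl (hl [] (.inr (.inl rfl)))
    | cons m b =>
    have e : listVars (m :: b) = m.vars + listVars b := by simp [listVars]
    rw [degree, e] at hN
    obtain ⟨t, x, ht, h1, h2, h3⟩ := hpeel q m (listVars b + u.degree listVars)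
      (le_of_eq_of_le (by congr 1; abel) hN) hn.1 hn.2.1 fun b hb => hl b (.inl hb)
    simp only [Multiset.card_add] at hN
    have hm : 0 < (m.vars : Multiset I).card := by
      simpa [Multiset.card_pos] using List.length_pos_iff.2 m.vars_ne_nil
    by_cases hb : b = []
    · subst hb
      obtain ⟨t', ht', rfl, h3'⟩ := ih (u.degree listVars).card (by omega) u le_rfl hn.2.2
        fun b hb => hl b (.inr (.inr hb))
      refine ⟨last t x t', ⟨ht, ht'⟩, by rw [decode, h1, h2], ?_⟩
      rw [degree, degree, h3, h3', e]
      simp [listVars]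
    -- The remaining entries `b` of the first letter form a root with empty first subtree, which
    -- `mergeFirst` merges back into one letter.
    · obtain ⟨t', ht', h2', h3'⟩ := ih ((last nil b u).degree listVars).card
        (by simp only [degree, Multiset.card_add, Multiset.card_zero]; omega) (last nil b u) le_rfl
        ⟨trivial, id, hn.2.2⟩ (by
          simp only [letters, List.nil_append, List.mem_cons]
          rintro c (rfl | h)
          exacts [hb, hl c (.inr (.inr h))])
      refine ⟨more t x t', ⟨ht, ht', ?_⟩, by rw [decode, h1, h2, h2']; rfl, ?_⟩
      · rintro rfl
        simp [decode] at h2'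
      · rw [degree, degree, h3, h3', e, degree, degree]
        abel
  | more q b u =>
    simp only [letters, List.mem_append, List.mem_cons] at hl
    cases b with
    | nil => exact absurd rfl (hl [] (.inr (.inl rfl)))
    | cons m b =>
    have e : listVars (m :: b) = m.vars + listVars b := by simp [listVars]
    rw [degree, e] at hN
    obtain ⟨t, x, ht, h1, h2, h3⟩ := hpeel q m (listVars b + u.degree listVars)
      (le_of_eq_of_le (by congr 1; abel) hN) hn.1 hn.2.1 fun b hb => hl b (.inl hb)
    simp only [Multiset.card_add] at hN
    have hm : 0 < (m.vars : Multiset I).card := by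
      simpa [Multiset.card_pos] using List.length_pos_iff.2 m.vars_ne_nil
    by_cases hb : b = []
    · subst hb
      obtain ⟨t', ht', h2', h3'⟩ := ih (u.degree listVars).card (by omega) u le_rfl hn.2.2.1
        fun b hb => hl b (.inr (.inr hb))
      refine ⟨more t x t', ⟨ht, ht', ?_⟩, by
        rw [decode, h1, h2, h2', mergeFirst_of_guarded _ _ hn.2.2.2], ?_⟩
      · rintro rfl
        exact hn.2.2.2.ne_nil h2'.symm
      · rw [degree, degree, h3, h3', e]
        simp [listVars]
    · obtain ⟨t', ht', h2', h3'⟩ := ih ((more nil b u).degree listVars).card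
        (by simp only [degree, Multiset.card_add, Multiset.card_zero]; omega) (more nil b u) le_rfl
        ⟨trivial, id, hn.2.2⟩ (by
          simp only [letters, List.nil_append, List.mem_cons]
          rintro c (rfl | h)
          exacts [hb, hl c (.inr (.inr h))])
      refine ⟨more t x t', ⟨ht, ht', ?_⟩, by rw [decode, h1, h2, h2']; rfl, ?_⟩
      · rintro rfl
        simp [decode] at h2'
      · rw [degree, degree, h3, h3', e, degree, degree]
        abel

theorem le_sum_map_of_mem {α I : Type} (f : α → Multiset I) {l : List α} {b : α} (hb : b ∈ l) :
    f b ≤ (l.map f).sum := by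
  induction l with
  | nil => simp at hb
  | cons a l ih =>
    rw [List.map_cons, List.sum_cons]
    rcases List.mem_cons.1 hb with rfl | hb
    · exact Multiset.le_add_right _ _
    · exact (ih hb).trans (Multiset.le_add_left _ _)

/-! ### Lists of monomials and multisets of lists beginning with a smallest variable -/

section blocks

variable {I : Type} (κ : I → ℕ)

/-- The decomposition of a list of monomials into blocks that begin at the left-to-right minima. -/
def blocks : List (Magma I) → List (List (Magma I))
  | [] => []
  | m :: l =>
    have : (l.dropWhile fun m' => decide (m.minKey κ ≤ m'.minKey κ)).length < (m :: l).length :=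
      Nat.lt_succ_of_le (List.length_dropWhile_le _ _)
    (m :: l.takeWhile fun m' => decide (m.minKey κ ≤ m'.minKey κ)) ::
      blocks (l.dropWhile fun m' => decide (m.minKey κ ≤ m'.minKey κ))
termination_by l => l.length
decreasing_by exact this

/-- The key of the first monomial. -/
def headKey : List (Magma I) → ℕ
  | [] => 0
  | m :: _ => m.minKey κ

theorem blocks_flatten : ∀ {L : List (List (Magma I))}, (∀ l ∈ L, MinFirst κ l) →
    L.Pairwise (fun l l' => headKey κ l' < headKey κ l) → blocks κ L.flatten = L := by
  intro L
  induction L with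
  | nil => simp [blocks]
  | cons l L ih =>
    intro hL hp
    rw [List.pairwise_cons] at hp
    have hl := hL l (by simp)
    cases l with
    | nil => exact hl.elim
    | cons m l =>
      have h1 : (l ++ L.flatten).takeWhile (fun m' => decide (m.minKey κ ≤ m'.minKey κ)) = l ∧
          (l ++ L.flatten).dropWhile (fun m' => decide (m.minKey κ ≤ m'.minKey κ)) =
            L.flatten := by
        have hl' : ∀ m' ∈ l, decide (m.minKey κ ≤ m'.minKey κ) = true := fun m' hm' =>
          decide_eq_true (hl m' hm')
        rw [List.takeWhile_append_of_pos hl', List.dropWhile_append_of_pos hl']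
        cases L with
        | nil => simp
        | cons l' L =>
          have hl2 := hL l' (by simp)
          cases l' with
          | nil => exact hl2.elim
          | cons m' l' =>
            have hlt : m'.minKey κ < m.minKey κ := hp.1 (m' :: l') (by simp)
            simp [List.flatten_cons, hlt]
      rw [List.flatten_cons, List.cons_append, blocks, h1.1, h1.2,
        ih (fun l hl => hL l (by simp [hl])) hp.2]

theorem Mon.exists_minKey {E : Type} (m : Mon E I) : ∃ x ∈ m.vars, m.minKey κ = κ x := by
  induction m with
  | var x => exact ⟨x, by simp [vars], rfl⟩
  | node e l r hl hr =>
    obtain ⟨x, hx, h1⟩ := hl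
    obtain ⟨y, hy, h2⟩ := hr
    rcases min_choice (l.minKey κ) (r.minKey κ) with h | h
    · exact ⟨x, by simp [vars, hx], by rw [minKey, h, h1]⟩
    · exact ⟨y, by simp [vars, hy], by rw [minKey, h, h2]⟩

theorem exists_headKey {l : List (Magma I)} (hl : MinFirst κ l) :
    ∃ x ∈ listVars l, headKey κ l = κ x := by
  cases l with
  | nil => exact hl.elim
  | cons m l =>
    obtain ⟨x, hx, h⟩ := m.exists_minKey κ
    exact ⟨x, by simp [listVars, hx], h⟩

/-- The lists are concatenated in the order of decreasing head keys. Each then begins at a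
left-to-right minimum and contains no further one, so `blocks` recovers them. This matches products
of brackets, unordered, with plain lists of monomials. -/
theorem exists_blocks_eq (hκ : Function.Injective κ) {s : Multiset (List (Magma I))} (hs : s ≠ 0)
    (h : ∀ l ∈ s, MinFirst κ l) (hn : (s.map listVars).sum.Nodup) :
    ∃ m : List (Magma I), (blocks κ m : Multiset (List (Magma I))) = s ∧ m ≠ [] ∧
      listVars m = (s.map listVars).sum := by
  obtain ⟨L, rfl⟩ := Quot.exists_rep s
  have hp := List.perm_insertionSort (fun l l' => headKey κ l' ≤ headKey κ l) L
  have hsort : (L.insertionSort fun l l' => headKey κ l' ≤ headKey κ l).Pairwise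
      (fun l l' => headKey κ l' ≤ headKey κ l) := by
    have : Std.Total fun l l' : List (Magma I) => headKey κ l' ≤ headKey κ l :=
      ⟨fun a b => le_total _ _⟩
    have : IsTrans (List (Magma I)) fun l l' => headKey κ l' ≤ headKey κ l :=
      ⟨fun a b c h1 h2 => le_trans h2 h1⟩
    exact List.pairwise_insertionSort _ L
  generalize L.insertionSort (fun l l' => headKey κ l' ≤ headKey κ l) = L' at hp hsort
  have hp' : ((L : Multiset (List (Magma I)))) = L' := (Multiset.coe_eq_coe.2 hp).symm
  change (L : Multiset (List (Magma I))) ≠ 0 at hs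
  change ∀ l ∈ (L : Multiset (List (Magma I))), _ at h
  change (((L : Multiset (List (Magma I))).map listVars).sum).Nodup at hn
  change ∃ m : List (Magma I), (blocks κ m : Multiset (List (Magma I))) =
    (L : Multiset (List (Magma I))) ∧ m ≠ [] ∧
      listVars m = ((L : Multiset (List (Magma I))).map listVars).sum
  rw [hp'] at *
  -- Head keys are keys of variables of the lists; the lists share no variable and `κ` is injective,
  -- so no two head keys agree.
  have hstrict : L'.Pairwise fun l l' => headKey κ l' < headKey κ l := by
    have h2 : L'.Pairwise fun l l' => Disjoint (listVars l) (listVars l') := by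
      have h3 : (L'.map listVars).sum.Nodup := by simpa using hn
      clear hp hsort hs h hn hp'
      induction L' with
      | nil => simp
      | cons l L' ih =>
        rw [List.map_cons, List.sum_cons, Multiset.nodup_add] at h3
        refine List.pairwise_cons.2 ⟨fun l' hl' => ?_, ih h3.2.1⟩
        exact h3.2.2.mono_right (le_sum_map_of_mem _ hl')
    refine (hsort.imp₂ (fun _ _ h1 h2 => And.intro h1 h2) h2).imp_of_mem ?_
    rintro l l' hl hl' ⟨h3, h4⟩
    refine lt_of_le_of_ne h3 fun he => ?_
    obtain ⟨x, hx, h5⟩ := exists_headKey κ (h l hl)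
    obtain ⟨y, hy, h6⟩ := exists_headKey κ (h l' hl')
    rw [h5, h6] at he
    obtain rfl := hκ he
    exact Multiset.disjoint_left.1 h4 hx hy
  refine ⟨L'.flatten, by rw [blocks_flatten κ h hstrict], ?_, ?_⟩
  · intro h0
    cases L' with
    | nil => exact hs rfl
    | cons l L' =>
      have := (h l (by simp)).ne_nil
      simp [this] at h0
  · simp only [listVars, List.map_flatten, List.sum_flatten, List.map_map, Multiset.map_coe,
      Multiset.sum_coe]
    rfl

end blocks

/-- The total degree of a letter. -/
def blockVars {I : Type} (s : Multiset (List (Magma I))) : Multiset I := (s.map listVars).sum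

/-- The multiset contains every element exactly once. -/
def IsFull {I : Type} (s : Multiset I) : Prop := s.Nodup ∧ ∀ x, x ∈ s

/-- Normal trees whose letters are multisets of lists of monomials with variables in `I` in which
every variable occurs exactly once. -/
structure IsPattern {I : Type} (κ : I → ℕ) (n : PTree (Multiset (List (Magma I)))) : Prop where
  normal : n.Normal
  ne_nil : n ≠ .nil
  ne_zero : ∀ b ∈ n.letters, b ≠ 0
  minFirst : ∀ b ∈ n.letters, ∀ l ∈ b, MinFirst κ l
  full : IsFull (n.degree blockVars)

/-- Each letter is first turned from a multiset of lists into one list by `exists_blocks_eq`; the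
resulting normal tree is then encoded by `PTree.exists_decode`. A pattern is a function of the tree
found, so choosing such trees gives an injection. -/
theorem IsPattern.exists_tree {I : Type} {κ : I → ℕ} (hκ : Function.Injective κ)
    {n : PTree (Multiset (List (Magma I)))} (hn : IsPattern κ n) :
    ∃ t : PTree I, t.Proper ∧ t ≠ .nil ∧ IsFull (t.degree fun x => {x}) ∧
      t.decode.map (fun l => (blocks κ l : Multiset (List (Magma I)))) = n := by
  have h1 : ∀ b ∈ n.letters, ∃ m : List (Magma I),
      (blocks κ m : Multiset (List (Magma I))) = b ∧
        (m ≠ [] ∧ listVars m = blockVars (blocks κ m : Multiset (List (Magma I)))) := by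
    intro b hb
    have h2 : (b.map listVars).sum.Nodup := by
      refine Multiset.nodup_of_le ?_ hn.full.1
      rw [PTree.degree_eq_sum]
      exact le_sum_map_of_mem blockVars hb
    obtain ⟨m, rfl, h3, h4⟩ := exists_blocks_eq κ hκ (hn.ne_zero b hb) (hn.minFirst b hb) h2
    exact ⟨m, rfl, h3, h4⟩
  obtain ⟨n', rfl, hn'⟩ := PTree.exists_map_eq h1
  have hd : n'.degree listVars = (n'.map fun l =>
      (blocks κ l : Multiset (List (Magma I)))).degree blockVars := by
    rw [PTree.degree_map]
    exact PTree.degree_congr fun b hb => (hn' b hb).2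
  obtain ⟨t, ht, rfl, h3⟩ := PTree.exists_decode _ n' le_rfl (PTree.normal_map.1 hn.normal)
    fun b hb => (hn' b hb).1
  refine ⟨t, ht, ?_, ?_, rfl⟩
  · rintro rfl
    exact hn.ne_nil rfl
  · rw [h3, hd]
    exact hn.full

theorem finite_fullTree (I : Type) [Finite I] :
    Finite {t : PTree I // t.Proper ∧ t ≠ .nil ∧ IsFull (t.degree fun x => {x})} := by
  classical
  have := Fintype.ofFinite I
  refine ((PTree.finite_setOf_length_le (Fintype.card I)).subset
    (s := {t : PTree I | t.letters.length ≤ Fintype.card I}) ?_).to_subtype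
  rintro t ⟨-, -, h, -⟩
  have h1 : t.degree (fun x => {x}) = (t.letters : Multiset I) := by
    rw [PTree.degree_eq_sum]
    induction t.letters with
    | nil => rfl
    | cons x l ih => simp [ih]
  rw [h1] at h
  exact List.Nodup.length_le_card (Multiset.coe_nodup.1 h)

end FunctorialPBW

namespace FunctorialPBW

/-! ## A criterion of freeness of right modules -/

section criterion

variable {k : Type u} [Field k]

/-- A symmetric sequence of subspaces. -/
def SymmSeq.sub (M : SymmSeq k) (S : ∀ (I : Type) [Finite I], Submodule k (M.obj I))
    (hS : ∀ {I J : Type} [Finite I] [Finite J] (σ : I ≃ J), ∀ x ∈ S I, M.relabel σ x ∈ S J) :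
    SymmSeq k where
  obj I _ := S I
  relabel σ := (M.relabel σ).restrict (hS σ)
  relabel_refl x := Subtype.ext (M.relabel_refl x.1)
  relabel_trans σ τ x := Subtype.ext (M.relabel_trans σ τ x.1)

/-- The inclusion of a symmetric sequence of subspaces. -/
def SymmSeq.subHom (M : SymmSeq k) (S : ∀ (I : Type) [Finite I], Submodule k (M.obj I))
    (hS : ∀ {I J : Type} [Finite I] [Finite J] (σ : I ≃ J), ∀ x ∈ S I, M.relabel σ x ∈ S J) :
    SymmSeq.Hom (M.sub S hS) M where
  app I _ := (S I).subtype
  app_relabel _ _ := rfl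

variable {P : Operad k}

/-- A module is free on a symmetric sequence of subspaces if it is spanned by the results of the
action of the operad on these subspaces, and if morphisms from these subspaces extend to linear
maps that respect these actions. -/
theorem RightModule.isFree_of_sub (M : RightModule P)
    (S : ∀ (I : Type) [Finite I], Submodule k (M.obj I))
    (hS : ∀ {I J : Type} [Finite I] [Finite J] (σ : I ≃ J), ∀ x ∈ S I, M.relabel σ x ∈ S J)
    (hspan : ∀ (I : Type) [Finite I] (z : M.obj I), z ∈ Submodule.span k {z | ∃ (K : Type)
      (_ : Finite K) (J : K → Type) (_ : ∀ i, Finite (J i)) (σ : (Σ i, J i) ≃ I) (x : S K)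
      (q : ∀ i, P.obj (J i)), M.relabel σ (M.act x.1 q) = z})
    (hext : ∀ (N : RightModule P) (f : SymmSeq.Hom (M.sub S hS) N.toSymmSeq) (I : Type) [Finite I],
      ∃ g : M.obj I →ₗ[k] N.obj I, ∀ (K : Type) [Finite K] (J : K → Type) [∀ i, Finite (J i)]
        (σ : (Σ i, J i) ≃ I) (x : S K) (q : ∀ i, P.obj (J i)),
        g (M.relabel σ (M.act x.1 q)) = N.relabel σ (N.act (f.app K x) q)) :
    M.IsFree := by
  refine ⟨M.sub S hS, M.subHom S hS, fun N f => ?_⟩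
  choose g hg using fun (I : Type) (h : Finite I) => hext N f I
  -- Substituting the operadic unit into every input shows that `g` extends `f`.
  have hι : ∀ (I : Type) [h : Finite I] (x : S I), g I h x.1 = f.app I x := by
    intro I h x
    have h1 := hg I h I (fun _ => PUnit) (Equiv.sigmaPUnit I) x (fun _ => P.one)
    rw [N.act_one, M.act_one] at h1
    exact h1
  -- The spanning hypothesis as an extensionality principle; equivariance, compatibility with the
  -- action and uniqueness all follow from it.
  have hlin : ∀ (I : Type) [h : Finite I] {W : Type u} [AddCommGroup W] [Module k W]
      (F G : M.obj I →ₗ[k] W), (∀ (K : Type) [Finite K] (J : K → Type) [∀ i, Finite (J i)]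
        (σ : (Σ i, J i) ≃ I) (x : S K) (q : ∀ i, P.obj (J i)),
        F (M.relabel σ (M.act x.1 q)) = G (M.relabel σ (M.act x.1 q))) → ∀ z, F z = G z := by
    intro I _ W _ _ F G h z
    refine Submodule.span_induction ?_ (by simp) (fun _ _ _ _ h1 h2 => by simp [h1, h2])
      (fun c _ _ h1 => by simp [h1]) (hspan I z)
    rintro _ ⟨K, _, J, _, σ, x, q, rfl⟩
    exact h K J σ x q
  let actAt (N : RightModule P) {I : Type} [Finite I] {J : I → Type} [∀ i, Finite (J i)]
      (q : ∀ i, P.obj (J i)) : N.obj I →ₗ[k] N.obj (Σ i, J i) :=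
    { toFun := fun m => N.act m q
      map_add' := by simp
      map_smul' := by simp }
  refine ⟨{ app := fun I h => g I h, app_relabel := ?_, app_act := ?_ }, fun I h x => hι I x, ?_⟩
  · intro I J hI hJ σ x
    refine hlin I (g J hJ ∘ₗ M.relabel σ) (N.relabel σ ∘ₗ g I hI) (fun K _ J' _ τ x q => ?_) x
    simp only [LinearMap.comp_apply]
    rw [hg I hI K J' τ x q, ← M.relabel_trans, hg J hJ, N.relabel_trans]
  · intro I hI J hJ m q
    refine hlin I (g _ inferInstance ∘ₗ actAt M q) (actAt N q ∘ₗ g I hI)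
      (fun K _ J' _ τ x r => ?_) m
    simp only [LinearMap.comp_apply]
    change g _ _ (M.act _ q) = N.act _ q
    rw [hg I hI K J' τ x r, M.relabel_act, N.relabel_act]
    have h1 := fun (L : RightModule P) (m : L.obj K) => L.act_assoc m r fun i j => q (τ ⟨i, j⟩)
    -- An iterated action is written as a relabelled single action on `x`, the form in which `hg`
    -- applies.
    have h2 : ∀ (L : RightModule P) (m : L.obj K),
        L.act (L.act m r) (fun i => q (τ i)) = L.relabel (Equiv.sigmaAssoc _).symm
          (L.act m fun i => P.comp (r i) fun j => q (τ ⟨i, j⟩)) := by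
      intro L m
      rw [← h1, ← L.relabel_trans, Equiv.self_trans_symm, L.relabel_refl]
    rw [h2, h2, ← M.relabel_trans, ← N.relabel_trans]
    exact hg _ _ K _ _ x _
  · intro g' hg'
    have h3 : ∀ (I : Type) (h : Finite I), g'.app I = g I h := by
      intro I h
      refine LinearMap.ext fun z => hlin I _ _ (fun K _ J _ σ x q => ?_) z
      rw [g'.app_relabel, g'.app_act, hg I h]
      exact congrArg (fun y => N.relabel σ (N.act y q)) (hg' K x)
    obtain ⟨⟨a, _⟩, _⟩ := g'
    congr
    funext I h
    exact h3 I h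

end criterion
end FunctorialPBW

namespace FunctorialPBW

/-! ## Patterns and their values -/

namespace Mon

variable {E X Y Z : Type}

/-- The monomial with renamed variables. -/
def map (f : X → Y) : Mon E X → Mon E Y
  | .var x => .var (f x)
  | .node e l r => .node e (l.map f) (r.map f)

theorem vars_map (f : X → Y) (m : Mon E X) : (m.map f).vars = m.vars.map f := by
  induction m with
  | var x => rfl
  | node e l r hl hr => simp [map, vars, hl, hr]

theorem map_map (f : X → Y) (g : Y → Z) (m : Mon E X) : (m.map f).map g = m.map (g ∘ f) := by
  induction m with
  | var x => rfl
  | node e l r hl hr => simp [map, hl, hr]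

theorem map_injective {f : X → Y} (hf : Function.Injective f) :
    Function.Injective (Mon.map (E := E) f) := by
  intro m
  induction m with
  | var x =>
    intro m' h
    cases m' with
    | var y => rw [hf (Mon.var.inj h)]
    | node => simp [map] at h
  | node e l r hl hr =>
    intro m' h
    cases m' with
    | var y => simp [map] at h
    | node e' l' r' =>
      simp only [map, node.injEq] at h
      rw [h.1, hl h.2.1, hr h.2.2]

theorem eval_map {k : Type u} [Field k] {A : Type u} [AddCommGroup A] [Module k A]
    (o : E → A →ₗ[k] A →ₗ[k] A) (f : X → Y) (a : Y → A) (m : Mon E X) :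
    (m.map f).eval o a = m.eval o fun x => a (f x) := by
  induction m with
  | var x => rfl
  | node e l r hl hr => simp [map, eval, hl, hr]

theorem minKey_map (κ : Y → ℕ) (f : X → Y) (m : Mon E X) :
    (m.map f).minKey κ = m.minKey fun x => κ (f x) := by
  induction m with
  | var x => rfl
  | node e l r hl hr => simp [map, minKey, hl, hr]

theorem exists_map_subtype {P : X → Prop} {m : Mon E X} (h : ∀ x ∈ m.vars, P x) :
    ∃ m' : Mon E {x // P x}, m'.map Subtype.val = m := by
  induction m with
  | var x => exact ⟨.var ⟨x, h x (by simp [vars])⟩, rfl⟩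
  | node e l r hl hr =>
    obtain ⟨l', rfl⟩ := hl fun x hx => h x (by simp [vars, hx])
    obtain ⟨r', rfl⟩ := hr fun x hx => h x (by simp [vars, hx])
    exact ⟨.node e l' r', rfl⟩

end Mon

/-! ### Renaming of variables in lists of monomials -/

section lists

variable {I J : Type}

/-- The list of monomials with renamed variables. -/
def renameList (f : J → I) (l : List (Magma J)) : List (Magma I) := l.map (Mon.map f)

theorem listVars_renameList (f : J → I) (l : List (Magma J)) :
    listVars (renameList f l) = (listVars l).map f := by
  induction l with
  | nil => rfl
  | cons m l ih =>
    simp only [listVars, renameList, List.map_cons, List.sum_cons, Multiset.map_add,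
      Mon.vars_map] at ih ⊢
    rw [ih]
    rfl

theorem renameList_injective {f : J → I} (hf : Function.Injective f) :
    Function.Injective (renameList f) :=
  List.map_injective_iff.2 (Mon.map_injective hf)

theorem renameList_renameList {H : Type} (f : J → I) (g : I → H) (l : List (Magma J)) :
    renameList g (renameList f l) = renameList (g ∘ f) l := by
  simp [renameList, Mon.map_map]

theorem minFirst_renameList {κ : I → ℕ} {f : J → I} {l : List (Magma J)} :
    MinFirst κ (renameList f l) ↔ MinFirst (fun j => κ (f j)) l := by
  cases l with
  | nil => rfl
  | cons m l => simp [renameList, MinFirst, Mon.minKey_map]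

theorem bracketVal_renameList {k : Type u} [Field k] {A : Type u} [AddCommGroup A] [Module k A]
    (o : PostLieOp → A →ₗ[k] A →ₗ[k] A) (g : I → A) (f : J → I) (l : List (Magma J)) :
    bracketVal o g (renameList f l) = bracketVal o (fun j => g (f j)) l := by
  simp only [bracketVal, renameList, List.map_map]
  congr 1
  exact List.map_congr_left fun m _ => Mon.eval_map _ f g m

theorem mem_listVars {l : List (Magma I)} {x : I} : x ∈ listVars l ↔ ∃ m ∈ l, x ∈ m.vars := by
  induction l with
  | nil => simp [listVars]
  | cons m l ih =>
    rw [listVars] at ih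
    simp [listVars, ih]

theorem exists_renameList_subtype {P : I → Prop} {l : List (Magma I)}
    (h : ∀ x ∈ listVars l, P x) :
    ∃ l' : List (Magma {x // P x}), renameList Subtype.val l' = l := by
  induction l with
  | nil => exact ⟨[], rfl⟩
  | cons m l ih =>
    obtain ⟨l', rfl⟩ := ih fun x hx => h x (by
      rw [mem_listVars] at *
      obtain ⟨m', hm, hx⟩ := hx
      exact ⟨m', by simp [hm], hx⟩)
    obtain ⟨m', rfl⟩ := Mon.exists_map_subtype (m := m) (P := P)
      fun x hx => h x (mem_listVars.2 ⟨m, by simp, hx⟩)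
    exact ⟨m' :: l', rfl⟩

end lists

/-! ### Symmetrized products of multisets and values of trees with such letters -/

section multiSym

variable {k : Type u} [Field k] {A : Type u} [AddCommGroup A] [Module k A]
  (o : TriDendOp → A →ₗ[k] A →ₗ[k] A)

/-- The symmetrized product of a multiset. -/
def multiSym (s : Multiset A) : A := Quot.liftOn s (symProd o) fun _ _ h => symProd_perm o h

theorem multiSym_coe (l : List A) : multiSym o (l : Multiset A) = symProd o l := rfl

theorem map_multiSym {B : Type u} [AddCommGroup B] [Module k B]
    {o' : TriDendOp → B →ₗ[k] B →ₗ[k] B} (f : A →ₗ[k] B)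
    (hf : ∀ e x y, f (o e x y) = o' e (f x) (f y)) (s : Multiset A) :
    f (multiSym o s) = multiSym o' (s.map f) := by
  induction s using Quotient.inductionOn with
  | h l => exact map_symProd o f hf l

/-- The value of a tree whose letters are symmetrized products of values. -/
def symTreeVal {β : Type} (val : β → A) (n : PTree (Multiset β)) : A :=
  (n.ev o fun s => multiSym o (s.map val)).2

theorem map_symTreeVal {B : Type u} [AddCommGroup B] [Module k B]
    {o' : TriDendOp → B →ₗ[k] B →ₗ[k] B} (f : A →ₗ[k] B)
    (hf : ∀ e x y, f (o e x y) = o' e (f x) (f y)) {β : Type} (val : β → A)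
    (n : PTree (Multiset β)) :
    f (symTreeVal o val n) = symTreeVal o' (fun b => f (val b)) n := by
  have h := PTree.map_ev f hf (fun s => multiSym o (s.map val)) n
  simp only [map_multiSym o f hf, Multiset.map_map] at h
  exact (congrArg Prod.snd h).symm

theorem symTreeVal_map {β γ : Type} (f : γ → β) (val : β → A) (n : PTree (Multiset γ)) :
    symTreeVal o val (n.map (Multiset.map f)) = symTreeVal o (fun c => val (f c)) n := by
  simp only [symTreeVal, PTree.ev_map, Multiset.map_map]
  rfl

end multiSym

/-! ### Degree bookkeeping in an arbitrary family of subspaces graded by multisets -/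

section graded

variable {k : Type u} [Field k] {A : Type u} [AddCommGroup A] [Module k A] {I : Type}
  {G : Multiset I → Submodule k A}

theorem mem_graded_cast {s t : Multiset I} {x : A} (hx : x ∈ G s) (h : s = t) : x ∈ G t := h ▸ hx

theorem eval_mem_graded {E : Type} {o : E → A →ₗ[k] A →ₗ[k] A}
    (hG : ∀ e {s t x y}, x ∈ G s → y ∈ G t → o e x y ∈ G (s + t)) {J : Type} {g : J → A}
    {d : J → Multiset I} (hg : ∀ j, g j ∈ G (d j)) (m : Mon E J) :
    m.eval o g ∈ G (m.vars.map d).sum := by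
  induction m with
  | var j => simpa [Mon.eval, Mon.vars] using hg j
  | node e l r hl hr => simpa [Mon.eval, Mon.vars] using hG e hl hr

theorem bracketVal_mem_graded {o : PostLieOp → A →ₗ[k] A →ₗ[k] A}
    (hG : ∀ e {s t x y}, x ∈ G s → y ∈ G t → o e x y ∈ G (s + t)) {g : I → A}
    (hg : ∀ j, g j ∈ G {j}) (l : List (Magma I)) : bracketVal o g l ∈ G (listVars l) := by
  have h1 : ∀ m : Magma I, triVal o g m ∈ G m.vars := by
    intro m
    have := eval_mem_graded (o := fun _ : Unit => o .triangle) (fun e {s t x y} => hG .triangle)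
      hg m
    refine mem_graded_cast this ?_
    induction m.vars with
    | nil => rfl
    | cons x l ih => simp [ih]
  induction l using List.reverseRecOn with
  | nil => exact zero_mem _
  | append_singleton l m ih =>
    by_cases hl : l = []
    · subst hl
      exact mem_graded_cast (h1 m) (by simp [listVars])
    · rw [bracketVal_concat o g hl]
      exact mem_graded_cast (hG .bracket ih (h1 m)) (by simp [listVars])

variable {o : TriDendOp → A →ₗ[k] A →ₗ[k] A}
  (hG : ∀ e {s t x y}, x ∈ G s → y ∈ G t → o e x y ∈ G (s + t))
include hG

theorem postLieOps_mem_graded (e : PostLieOp) {s t : Multiset I} {x y : A} (hx : x ∈ G s)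
    (hy : y ∈ G t) : postLieOps o e x y ∈ G (s + t) := by
  cases e with
  | bracket => exact sub_mem (hG .dot hx hy) (mem_graded_cast (hG .dot hy hx) (add_comm _ _))
  | triangle => exact sub_mem (hG .prec hx hy) (mem_graded_cast (hG .succ hy hx) (add_comm _ _))

theorem multiSym_mem_graded {β : Type} {val : β → A} {d : β → Multiset I}
    (hval : ∀ b, val b ∈ G (d b)) (s : Multiset β) :
    multiSym o (s.map val) ∈ G (s.map d).sum := by
  have h1 : ∀ l : List β, listProd o (l.map val) ∈ G (l.map d).sum := by
    intro l
    induction l with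
    | nil => exact zero_mem _
    | cons b l ih =>
      by_cases hl : l = []
      · subst hl
        simpa [listProd] using hval b
      · rw [List.map_cons, List.map_cons, listProd_cons o _ (by simpa using hl)]
        simpa using hG .dot (hval b) ih
  induction s using Quotient.inductionOn with
  | h l =>
    change symProd o (l.map val) ∈ _
    rw [symProd, ← List.map_permutations, List.map_map]
    refine list_sum_mem fun x hx => ?_
    obtain ⟨l', hl', rfl⟩ := List.mem_map.1 hx
    refine mem_graded_cast (h1 l') ?_
    exact ((List.mem_permutations.1 hl').map d).sum_eq.trans (by simp)

theorem ev_mem_graded {β : Type} {val : β → A} {d : β → Multiset I}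
    (hval : ∀ b, val b ∈ G (d b)) (n : PTree β) :
    n ≠ .nil → (n.ev o val).2 ∈ G (n.degree d) := by
  have hl : ∀ (q : PTree β) {s : Multiset I} {x : A},
      (q ≠ .nil → (q.ev o val).2 ∈ G (q.degree d)) → x ∈ G s →
        lact o (q.ev o val) x ∈ G (q.degree d + s) := by
    intro q s x hq hx
    by_cases h : q = .nil
    · subst h
      rw [PTree.ev, lact_one]
      exact mem_graded_cast hx (by simp [PTree.degree])
    · rw [lact_apply, PTree.ev_fst_of_ne_nil o val h, zero_smul, zero_add]
      exact hG .succ (hq h) hx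
  have hr : ∀ (q : PTree β) {s : Multiset I} {x : A},
      (q ≠ .nil → (q.ev o val).2 ∈ G (q.degree d)) → x ∈ G s →
        ract o (q.ev o val) x ∈ G (s + q.degree d) := by
    intro q s x hq hx
    by_cases h : q = .nil
    · subst h
      rw [PTree.ev, ract_one]
      exact mem_graded_cast hx (by simp [PTree.degree])
    · rw [ract_apply, PTree.ev_fst_of_ne_nil o val h, zero_smul, zero_add]
      exact hG .prec hx (hq h)
  induction n with
  | nil => exact fun h => absurd rfl h
  | last q b t hq ht =>
    exact fun _ => mem_graded_cast (hl q hq (hr t ht (hval b))) (by simp [PTree.degree, add_assoc])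
  | more q b r hq hr =>
    intro _
    by_cases h : r = .nil
    · subst h
      simp [PTree.ev]
    · exact hG .dot (hl q hq (hval b)) (hr h)

theorem symTreeVal_mem_graded {β : Type} {val : β → A} {d : β → Multiset I}
    (hval : ∀ b, val b ∈ G (d b)) {n : PTree (Multiset β)} (hn : n ≠ .nil) :
    symTreeVal o val n ∈ G (n.degree fun s => (s.map d).sum) :=
  ev_mem_graded hG (fun s => multiSym_mem_graded hG hval s) n hn

end graded

namespace Variety

variable {k : Type u} [Field k] (V : Variety k) {X : Type}

/-- The subspace spanned by the monomials with a given multiset of variables. -/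
noncomputable def homog (s : Multiset X) : Submodule k (V.Free X) :=
  Submodule.span k {z | ∃ t : Mon V.Op X, (t.vars : Multiset X) = s ∧ t.eval V.op V.gen = z}

theorem gen_mem_homog (x : X) : V.gen x ∈ V.homog {x} :=
  Submodule.subset_span ⟨.var x, rfl, rfl⟩

theorem op_mem_homog (e : V.Op) {s t : Multiset X} {x y : V.Free X} (hx : x ∈ V.homog s)
    (hy : y ∈ V.homog t) : V.op e x y ∈ V.homog (s + t) := by
  refine mem_of_mem_span ((V.op e).flip y) hx ?_
  rintro _ ⟨m, rfl, rfl⟩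
  refine mem_of_mem_span (V.op e _) hy ?_
  rintro _ ⟨m', rfl, rfl⟩
  exact Submodule.subset_span ⟨.node e m m', by simp [Mon.vars], rfl⟩

theorem mkQ_single (t : Mon V.Op X) :
    (V.ideal X).mkQ (Finsupp.single t 1) = t.eval V.op V.gen := by
  rw [← V.lift_gen_id ((V.ideal X).mkQ (Finsupp.single t 1)), lift_mk, Poly.eval_single]

/-- Homogeneous components are closed under operations without any disjointness of variables, so
membership in the multilinear part is proved through them and transferred here. -/
theorem homog_eq_part {s : Multiset X} (hs : IsFull s) : V.homog s = V.Part X := by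
  refine le_antisymm (Submodule.span_mono ?_) (Submodule.span_mono ?_)
  · rintro _ ⟨t, rfl, rfl⟩
    exact ⟨t, Multiset.coe_nodup.1 hs.1, Set.eq_univ_of_forall hs.2, (V.mkQ_single t).symm⟩
  · rintro _ ⟨t, h1, h2, rfl⟩
    refine ⟨t, ?_, (V.mkQ_single t).symm⟩
    exact (Multiset.Nodup.ext (Multiset.coe_nodup.2 h1) hs.1).2 fun x =>
      iff_of_true (h2.symm ▸ Set.mem_univ x : x ∈ {x | x ∈ t.vars}) (hs.2 x)

end Variety
end FunctorialPBW

namespace FunctorialPBW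

/-! ## Generators of the tridendriform operad as a right module over the post-Lie operad -/

/-- Normal trees whose letters are nonempty multisets, in which every element occurs once. -/
structure IsGeneric {K : Type} (n : PTree (Multiset K)) : Prop where
  normal : n.Normal
  ne_nil : n ≠ .nil
  ne_zero : ∀ b ∈ n.letters, b ≠ 0
  full : IsFull (n.degree id)

theorem degree_map_multiset {K L : Type} (f : K → L) (n : PTree (Multiset K)) :
    (n.map (Multiset.map f)).degree id = (n.degree id).map f := by
  rw [PTree.degree_map]
  exact (PTree.map_degree (Multiset.mapAddMonoidHom f) id n).symm

theorem IsFull.map {K L : Type} {s : Multiset K} (hs : IsFull s) (σ : K ≃ L) :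
    IsFull (s.map σ) :=
  ⟨hs.1.map σ.injective, fun x => Multiset.mem_map.2 ⟨σ.symm x, hs.2 _, by simp⟩⟩

theorem IsGeneric.map {K L : Type} {n : PTree (Multiset K)} (hn : IsGeneric n) (σ : K ≃ L) :
    IsGeneric (n.map (Multiset.map σ)) where
  normal := PTree.normal_map.2 hn.normal
  ne_nil := mt PTree.map_eq_nil.1 hn.ne_nil
  ne_zero := by
    rw [PTree.letters_map]
    intro b hb
    obtain ⟨c, hc, rfl⟩ := List.mem_map.1 hb
    simpa using hn.ne_zero c hc
  full := by
    rw [degree_map_multiset]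
    exact hn.full.map σ

section operations

variable (k : Type u) [Field k]

/-- The operations of the free tridendriform algebra. -/
noncomputable def triOp (I : Type) :
    TriDendOp → (triDend k).Free I →ₗ[k] (triDend k).Free I →ₗ[k] (triDend k).Free I :=
  (triDend k).op

/-- The operations of the free post-Lie algebra. -/
noncomputable def lieOp (I : Type) :
    PostLieOp → (postLie k).Free I →ₗ[k] (postLie k).Free I →ₗ[k] (postLie k).Free I :=
  (postLie k).op

theorem isModel_triOp (I : Type) : (triDend k).IsModel (triOp k I) := (triDend k).isModel_free I

theorem isModel_lieOp (I : Type) : (postLie k).IsModel (lieOp k I) := (postLie k).isModel_free I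

theorem triOp_mem_homog {I : Type} (e : TriDendOp) {s t : Multiset I} {x y : (triDend k).Free I}
    (hx : x ∈ (triDend k).homog s) (hy : y ∈ (triDend k).homog t) :
    triOp k I e x y ∈ (triDend k).homog (s + t) := (triDend k).op_mem_homog e hx hy

theorem lieOp_mem_homog {I : Type} (e : PostLieOp) {s t : Multiset I} {x y : (postLie k).Free I}
    (hx : x ∈ (postLie k).homog s) (hy : y ∈ (postLie k).homog t) :
    lieOp k I e x y ∈ (postLie k).homog (s + t) := (postLie k).op_mem_homog e hx hy

variable {k} {A : Type u} [AddCommGroup A] [Module k A]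

/-- The homomorphism from the free tridendriform algebra that extends a map. -/
noncomputable def triLift {o : TriDendOp → A →ₗ[k] A →ₗ[k] A} (h : (triDend k).IsModel o)
    {I : Type} (a : I → A) : (triDend k).Free I →ₗ[k] A := (triDend k).lift o h a

/-- The homomorphism from the free post-Lie algebra that extends a map. -/
noncomputable def lieLift {o : PostLieOp → A →ₗ[k] A →ₗ[k] A} (h : (postLie k).IsModel o)
    {I : Type} (a : I → A) : (postLie k).Free I →ₗ[k] A := (postLie k).lift o h a

theorem triLift_gen {o : TriDendOp → A →ₗ[k] A →ₗ[k] A} (h : (triDend k).IsModel o) {I : Type}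
    (a : I → A) (x : I) : triLift h a ((triDend k).gen x) = a x := (triDend k).lift_gen h a x

theorem lieLift_gen {o : PostLieOp → A →ₗ[k] A →ₗ[k] A} (h : (postLie k).IsModel o) {I : Type}
    (a : I → A) (x : I) : lieLift h a ((postLie k).gen x) = a x := (postLie k).lift_gen h a x

theorem triLift_op {o : TriDendOp → A →ₗ[k] A →ₗ[k] A} (h : (triDend k).IsModel o) {I : Type}
    (a : I → A) (e : TriDendOp) (x y : (triDend k).Free I) :
    triLift h a (triOp k I e x y) = o e (triLift h a x) (triLift h a y) :=
  (triDend k).lift_op h a e x y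

theorem lieLift_op {o : PostLieOp → A →ₗ[k] A →ₗ[k] A} (h : (postLie k).IsModel o) {I : Type}
    (a : I → A) (e : PostLieOp) (x y : (postLie k).Free I) :
    lieLift h a (lieOp k I e x y) = o e (lieLift h a x) (lieLift h a y) :=
  (postLie k).lift_op h a e x y

theorem rename_eq_triLift {I J : Type} (f : I → J) :
    (triDend k).rename f = triLift (isModel_triOp k J) fun x => (triDend k).gen (f x) := rfl

theorem rename_eq_lieLift {I J : Type} (f : I → J) :
    (postLie k).rename f = lieLift (isModel_lieOp k J) fun x => (postLie k).gen (f x) := rfl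

theorem map_postLieOps {B : Type u} [AddCommGroup B] [Module k B]
    {o : TriDendOp → A →ₗ[k] A →ₗ[k] A} {o' : TriDendOp → B →ₗ[k] B →ₗ[k] B} (f : A →ₗ[k] B)
    (hf : ∀ e x y, f (o e x y) = o' e (f x) (f y)) (e : PostLieOp) (x y : A) :
    f (postLieOps o e x y) = postLieOps o' e (f x) (f y) := by
  cases e
  · exact (map_sub _ _ _).trans (congrArg₂ _ (hf .dot x y) (hf .dot y x))
  · exact (map_sub _ _ _).trans (congrArg₂ _ (hf .prec x y) (hf .succ y x))

end operations

/-- Normal trees whose letters are symmetrized products of brackets span all monomials. -/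
theorem eval_mem_normalSpan {k : Type u} [Field k] [CharZero k] {A : Type u} [AddCommGroup A]
    [Module k A] {I : Type} (κ : I → ℕ) {o : TriDendOp → A →ₗ[k] A →ₗ[k] A}
    (h : (triDend k).IsModel o) (g : I → A) (t : Mon TriDendOp I) :
    ((0, t.eval o g) : k × A) ∈ normalSpan o
      (fun l : {l : List {l : List (Magma I) // MinFirst κ l} // l ≠ []} =>
        symProd o (l.1.map fun l => bracketVal (postLieOps o) g l.1))
      (fun l => listDeg (fun l => listVars l.1) l.1) (t.vars : Multiset I) := by
  have hP := isModel_postLieOps o h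
  -- The role of `E` is played by the span of the min-first brackets, a post-Lie subalgebra by
  -- `op_mem_minFirstSpan`.
  have S := letterSystem_symProd (o := o)
    (val := fun l : {l : List (Magma I) // MinFirst κ l} => bracketVal (postLieOps o) g l.1)
    (deg := fun l => listVars l.1) h
    (fun {s t x y} hx hy => op_mem_minFirstSpan (o := postLieOps o) hP .bracket hx hy)
    (fun l => listVars_ne_zero l.2.ne_nil)
    (fun {s t x y} hx hy => op_mem_minFirstSpan (o := postLieOps o) hP .triangle hx hy)
  induction t with
  | var x =>
    have h1 := gen_mem_minFirstSpan (o := postLieOps o) (g := g) κ x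
    exact val_mem_normalSpan (o := o) (S.le {x} h1)
  | node e l r hl hr =>
    exact mem_evSpan_cast (S.op_mem_normalSpan e hl hr) (Multiset.coe_add _ _)

section values

variable (k : Type u) [Field k]

/-- The value of a tree at the generators of the free tridendriform algebra. -/
noncomputable def genericVal {K : Type} (n : PTree (Multiset K)) : (triDend k).Free K :=
  symTreeVal (triOp k K) (triDend k).gen n

theorem genericVal_mem {K : Type} {n : PTree (Multiset K)} (hn : IsGeneric n) :
    genericVal k n ∈ (triDend k).Part K := by
  have h := symTreeVal_mem_graded (o := triOp k K) (G := (triDend k).homog)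
    (fun e _ _ _ _ => triOp_mem_homog k e) (d := fun x => {x})
    (fun x => (triDend k).gen_mem_homog x) hn.ne_nil
  simp only [Multiset.sum_map_singleton] at h
  exact (triDend k).homog_eq_part hn.full ▸ h

theorem rename_genericVal {K L : Type} (f : K → L) (n : PTree (Multiset K)) :
    (triDend k).rename f (genericVal k n) = genericVal k (n.map (Multiset.map f)) := by
  rw [genericVal, rename_eq_triLift, map_symTreeVal (triOp k K) (o' := triOp k L) _
    (triLift_op (isModel_triOp k L) _), genericVal, symTreeVal_map]
  congr 1
  funext x
  exact triLift_gen _ _ x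

/-- The span of the values of generic trees. -/
noncomputable def genericSpan (K : Type) : Submodule k ((triDend k).Part K) :=
  Submodule.span k {z | ∃ n : PTree (Multiset K), IsGeneric n ∧ z.1 = genericVal k n}

theorem relabel_mem_genericSpan {K L : Type} (σ : K ≃ L) :
    ∀ x ∈ genericSpan k K, (triDend k).relabelPart σ x ∈ genericSpan k L := by
  intro x hx
  refine mem_of_mem_span ((triDend k).relabelPart σ) hx ?_
  rintro ⟨_, _⟩ ⟨n, hn, rfl⟩
  exact Submodule.subset_span ⟨_, hn.map σ, rename_genericVal k σ n⟩

/-- The value of a pattern in the free tridendriform algebra. -/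
noncomputable def patternVal {I : Type} (n : PTree (Multiset (List (Magma I)))) :
    (triDend k).Free I :=
  symTreeVal (triOp k I) (bracketVal (postLieOps (triOp k I)) (triDend k).gen) n

theorem patternVal_mem {I : Type} {κ : I → ℕ} {n : PTree (Multiset (List (Magma I)))}
    (hn : IsPattern κ n) : patternVal k n ∈ (triDend k).Part I := by
  have h1 : ∀ (e : PostLieOp) {s t : Multiset I} {x y : (triDend k).Free I},
      x ∈ (triDend k).homog s → y ∈ (triDend k).homog t →
        postLieOps (triOp k I) e x y ∈ (triDend k).homog (s + t) :=
    fun e _ _ _ _ => postLieOps_mem_graded (o := triOp k I) (G := (triDend k).homog)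
      (fun e _ _ _ _ => triOp_mem_homog k e) e
  have h := symTreeVal_mem_graded (o := triOp k I) (G := (triDend k).homog)
    (fun e _ _ _ _ => triOp_mem_homog k e) (d := listVars)
    (fun l => bracketVal_mem_graded (o := postLieOps (triOp k I)) (G := (triDend k).homog) h1
      (fun x => (triDend k).gen_mem_homog x) l) hn.ne_nil
  exact (triDend k).homog_eq_part hn.full ▸ h

/-- Patterns span the multilinear part of the free tridendriform algebra. -/
theorem mem_span_patternVal [CharZero k] {I : Type} (κ : I → ℕ) {z : (triDend k).Free I}
    (hz : z ∈ (triDend k).Part I) :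
    z ∈ Submodule.span k {z | ∃ n, IsPattern κ n ∧ patternVal k n = z} := by
  refine Submodule.span_le.2 ?_ hz
  rintro _ ⟨t, ht, ht', rfl⟩
  rw [SetLike.mem_coe, Variety.mkQ_single]
  refine mem_of_mem_span (LinearMap.snd k k _)
    (eval_mem_normalSpan κ (isModel_triOp k I) (triDend k).gen t) ?_
  rintro _ ⟨n, hn, hd, rfl⟩
  -- A symmetrized product depends only on the multiset of its factors, so the order of the list can
  -- be forgotten.
  refine Submodule.subset_span ⟨n.map fun l => ((l.1.map Subtype.val : List (List (Magma I))) :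
    Multiset (List (Magma I))), ⟨PTree.normal_map.2 hn, ?_, ?_, ?_, ?_⟩, ?_⟩
  · rw [Ne, PTree.map_eq_nil]
    rintro rfl
    have := t.vars_ne_nil
    simp [PTree.degree] at hd
    exact this (Multiset.coe_eq_zero _ |>.1 hd.symm)
  · rw [PTree.letters_map]
    intro b hb
    obtain ⟨l, -, rfl⟩ := List.mem_map.1 hb
    exact fun h => l.2 (List.map_eq_nil_iff.1 (Multiset.coe_eq_zero _ |>.1 h))
  · rw [PTree.letters_map]
    intro b hb
    obtain ⟨l, -, rfl⟩ := List.mem_map.1 hb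
    intro l' hl'
    obtain ⟨l'', -, rfl⟩ := List.mem_map.1 (Multiset.mem_coe.1 hl')
    exact l''.2
  · rw [PTree.degree_map]
    have : (fun l : {l : List {l : List (Magma I) // MinFirst κ l} // l ≠ []} =>
        blockVars ((l.1.map Subtype.val : List (List (Magma I))) : Multiset (List (Magma I)))) =
        fun l => listDeg (fun l => listVars l.1) l.1 := by
      funext l
      simp [blockVars, listDeg]
    rw [this, hd]
    exact ⟨Multiset.coe_nodup.2 ht, fun x => (ht'.symm ▸ Set.mem_univ x : x ∈ {x | x ∈ t.vars})⟩
  · rw [patternVal, symTreeVal, PTree.ev_map]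
    simp only [Multiset.map_coe, List.map_map, multiSym_coe]
    rfl

/-- The element of the post-Lie operad given by a bracket of monomials. -/
noncomputable def bracketPart {J : Type} {l : List (Magma J)} (hl : IsFull (listVars l)) :
    (postLie k).Part J :=
  ⟨bracketVal (lieOp k J) (postLie k).gen l, by
    have h := bracketVal_mem_graded (o := lieOp k J) (G := (postLie k).homog)
      (fun e _ _ _ _ => lieOp_mem_homog k e) (fun x => (postLie k).gen_mem_homog x) l
    exact (postLie k).homog_eq_part hl ▸ h⟩

/-- The key is arbitrary, so that on each set of inputs of a substitution it can be the one induced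
from the set of all variables. -/
theorem span_bracketPart {J : Type} (κ : J → ℕ) :
    Submodule.span k (Set.range fun l : {l : List (Magma J) // MinFirst κ l ∧ IsFull (listVars l)} =>
      bracketPart k l.2.2) = ⊤ := by
  rw [eq_top_iff]
  rintro ⟨z, hz⟩ -
  have h1 : z ∈ (Submodule.span k (Set.range
      fun l : {l : List (Magma J) // MinFirst κ l ∧ IsFull (listVars l)} =>
        bracketPart k l.2.2)).map ((postLie k).Part J).subtype := by
    rw [Submodule.map_span]
    refine Submodule.span_le.2 ?_ hz
    rintro _ ⟨t, ht, ht', rfl⟩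
    rw [SetLike.mem_coe, Variety.mkQ_single]
    refine Submodule.span_mono ?_ (eval_mem_minFirstSpan κ (isModel_lieOp k J) t)
    rintro _ ⟨l, hl, rfl⟩
    refine ⟨_, ⟨⟨l.1, l.2, ?_⟩, rfl⟩, rfl⟩
    change listVars l.1 = _ at hl
    rw [hl]
    exact ⟨Multiset.coe_nodup.2 ht, fun x => (ht'.symm ▸ Set.mem_univ x : x ∈ {x | x ∈ t.vars})⟩
  obtain ⟨y, hy, rfl⟩ := h1
  exact hy

theorem relabel_bracketPart {J J' : Type} (τ : J ≃ J') {l : List (Magma J)}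
    (hl : IsFull (listVars l)) {l' : List (Magma J')} (hl' : IsFull (listVars l'))
    (h : l' = renameList τ l) :
    bracketPart k hl' = (postLie k).relabelPart τ (bracketPart k hl) := by
  subst h
  refine Subtype.ext ?_
  change bracketVal (lieOp k J') _ _ = (postLie k).rename τ (bracketVal (lieOp k J) _ l)
  rw [bracketVal_renameList, rename_eq_lieLift,
    map_bracketVal (lieOp k J) _ (o' := lieOp k J') _ (lieLift_op (isModel_lieOp k J') _)]
  congr 1
  funext x
  exact (lieLift_gen (isModel_lieOp k J') (fun x => (postLie k).gen (τ x)) x).symm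

end values

/-- The pattern obtained by the substitution of lists of monomials into a generic tree. -/
def substPattern {I K : Type} {J : K → Type} (σ : (Σ i, J i) ≃ I) (n : PTree (Multiset K))
    (l : ∀ i, List (Magma (J i))) : PTree (Multiset (List (Magma I))) :=
  n.map (Multiset.map fun i => renameList (fun j => σ ⟨i, j⟩) (l i))

/-- All maps involved are homomorphisms of free algebras, and these commute with values of trees and
of brackets; what remains is a comparison on variables. So patterns are exactly the results of the
action of brackets on generic trees. -/
theorem patternVal_substPattern (k : Type u) [Field k] {I K : Type} [Finite I] [Finite K]
    {J : K → Type} [∀ i, Finite (J i)] (σ : (Σ i, J i) ≃ I) {n : PTree (Multiset K)}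
    (hn : IsGeneric n) {l : ∀ i, List (Magma (J i))} (hl : ∀ i, IsFull (listVars (l i))) :
    ((phi k).rightModule.relabel σ ((phi k).rightModule.act
      (⟨genericVal k n, genericVal_mem k hn⟩ : (triDend k).Part K)
        fun i => bracketPart k (hl i))).1 = patternVal k (substPattern σ n l) := by
  have h1 := isModel_triOp k
  have h2 : ∀ {X Y : Type} (a : X → (triDend k).Free Y) (e : PostLieOp) (x y : (triDend k).Free X),
      triLift (h1 Y) a (postLieOps (triOp k X) e x y) =
        postLieOps (triOp k Y) e (triLift (h1 Y) a x) (triLift (h1 Y) a y) :=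
    fun {X Y} a => map_postLieOps (triLift (h1 Y) a) (triLift_op (h1 Y) a)
  change (triDend k).rename σ (triLift (h1 _)
    (fun i => (triDend k).rename (Sigma.mk i) (lieLift (isModel_postLieOps _ (h1 _)) (triDend k).gen
      (bracketVal (lieOp k _) (postLie k).gen (l i)))) (genericVal k n)) = _
  rw [genericVal, map_symTreeVal (triOp k K) (o' := triOp k _) _ (triLift_op (h1 _) _),
    rename_eq_triLift, map_symTreeVal (triOp k _) (o' := triOp k I) _ (triLift_op (h1 _) _),
    patternVal, substPattern, symTreeVal_map]
  congr 1
  funext i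
  rw [triLift_gen, rename_eq_triLift, bracketVal_renameList,
    map_bracketVal (lieOp k (J i)) _ (o' := postLieOps (triOp k _)) _
      (lieLift_op (isModel_postLieOps _ (h1 _)) _),
    map_bracketVal (postLieOps (triOp k (J i))) _ (o' := postLieOps (triOp k (Σ i, J i))) _
      (h2 _),
    map_bracketVal (postLieOps (triOp k (Σ i, J i))) _ (o' := postLieOps (triOp k I)) _
      (h2 _)]
  congr 1
  funext j
  rw [lieLift_gen, triLift_gen, triLift_gen]

end FunctorialPBW

namespace FunctorialPBW

/-! ## Freeness of the tridendriform operad as a right module -/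

theorem exists_equiv_of_range_eq {α β γ : Type} {f : α → γ} {g : β → γ}
    (hf : Function.Injective f) (hg : Function.Injective g) (h : Set.range f = Set.range g) :
    ∃ e : α ≃ β, ∀ a, g (e a) = f a := by
  refine ⟨(Equiv.ofInjective f hf).trans ((Equiv.setCongr h).trans (Equiv.ofInjective g hg).symm),
    fun a => ?_⟩
  have := Equiv.apply_ofInjective_symm hg ((Equiv.setCongr h) ((Equiv.ofInjective f hf) a))
  exact this

/-- A presentation of a pattern as the result of a substitution. -/
structure Presentation (I : Type) where
  K : Type
  J : K → Type
  [finite : Finite K]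
  [finite' : ∀ i, Finite (J i)]
  σ : (Σ i, J i) ≃ I
  tree : PTree (Multiset K)
  words : ∀ i, List (Magma (J i))
  isGeneric : IsGeneric tree
  ne_nil : ∀ i, words i ≠ []
  full : ∀ i, IsFull (listVars (words i))

attribute [instance] Presentation.finite Presentation.finite'

namespace Presentation

variable {I : Type} (p : Presentation I)

/-- The presented pattern. -/
def pattern : PTree (Multiset (List (Magma I))) := substPattern p.σ p.tree p.words

/-- The list of monomials substituted for `i`. -/
def word (i : p.K) : List (Magma I) := renameList (fun j => p.σ ⟨i, j⟩) (p.words i)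

theorem pattern_eq : p.pattern = p.tree.map (Multiset.map p.word) := rfl

theorem mem_listVars_word (i : p.K) (x : I) : x ∈ listVars (p.word i) ↔ ∃ j, p.σ ⟨i, j⟩ = x := by
  rw [word, listVars_renameList, Multiset.mem_map]
  exact ⟨fun ⟨j, _, h⟩ => ⟨j, h⟩, fun ⟨j, h⟩ => ⟨j, (p.full i).2 j, h⟩⟩

/-- Different inputs receive disjoint nonempty sets of variables. -/
theorem word_injective : Function.Injective p.word := by
  intro i i' h
  obtain ⟨x, hx⟩ := Multiset.exists_mem_of_ne_zero (listVars_ne_zero (l := p.word i) (by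
    simpa [word, renameList] using p.ne_nil i))
  obtain ⟨j, h1⟩ := (p.mem_listVars_word i x).1 hx
  obtain ⟨j', h2⟩ := (p.mem_listVars_word i' x).1 (h ▸ hx)
  exact congrArg Sigma.fst (p.σ.injective (h1.trans h2.symm))

theorem range_word : Set.range p.word = {l | l ∈ p.pattern.degree id} := by
  ext l
  rw [pattern_eq, degree_map_multiset]
  simp only [Set.mem_range, Set.mem_ofPred_eq, Multiset.mem_map]
  exact ⟨fun ⟨i, h⟩ => ⟨i, p.isGeneric.full.2 i, h⟩, fun ⟨i, _, h⟩ => ⟨i, h⟩⟩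

variable {k : Type u} [Field k]

/-- The symmetric sequence of generators. -/
noncomputable abbrev genericSeq (k : Type u) [Field k] : SymmSeq k :=
  (phi k).rightModule.sub (fun K _ => genericSpan k K) fun σ => relabel_mem_genericSpan k σ

/-- The generator given by a generic tree. -/
noncomputable def genericElt {K : Type} [Finite K] {n : PTree (Multiset K)}
    (hn : IsGeneric n) : (genericSeq k).obj K :=
  (⟨⟨genericVal k n, genericVal_mem k hn⟩, Submodule.subset_span ⟨n, hn, rfl⟩⟩ : genericSpan k K)

/-- The element of the post-Lie operad given by a bracket of monomials. -/
noncomputable def bracketElt (k : Type u) [Field k] {J : Type} [Finite J] {l : List (Magma J)}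
    (hl : IsFull (listVars l)) : (PostLie k).obj J := bracketPart k hl

/-- The value of a presentation in a right module. -/
noncomputable def value [Finite I] (N : RightModule (PostLie k))
    (f : SymmSeq.Hom (genericSeq k) N.toSymmSeq) : N.obj I :=
  N.relabel p.σ (N.act (f.app p.K (genericElt p.isGeneric)) fun i => bracketElt k (p.full i))

/-- Presentations of one pattern are isomorphic: the inputs are identified by the substituted words,
the variables of each input by their images in `I`. Equivariance of `f` and of the action then gives
equal values in `N`. -/
theorem value_eq [Finite I] (N : RightModule (PostLie k))
    (f : SymmSeq.Hom (genericSeq k) N.toSymmSeq) {p p' : Presentation I}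
    (h : p.pattern = p'.pattern) : p.value N f = p'.value N f := by
  obtain ⟨θ, hθ⟩ := exists_equiv_of_range_eq p.word_injective p'.word_injective (by
    rw [range_word, range_word, h])
  have hs : ∀ (p : Presentation I) (i : p.K), Function.Injective fun j => p.σ ⟨i, j⟩ := by
    intro p i j j' h
    simpa using p.σ.injective h
  have hτ : ∀ i, ∃ τ : p.J i ≃ p'.J (θ i), ∀ j, p'.σ ⟨θ i, τ j⟩ = p.σ ⟨i, j⟩ := by
    intro i
    refine exists_equiv_of_range_eq (hs p i) (hs p' (θ i)) ?_
    ext x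
    exact (p.mem_listVars_word i x).symm.trans (hθ i ▸ p'.mem_listVars_word (θ i) x)
  choose τ hτ using hτ
  have hw : ∀ i, p'.words (θ i) = renameList (τ i) (p.words i) := by
    intro i
    refine renameList_injective (hs p' (θ i)) ?_
    rw [renameList_renameList]
    refine (hθ i).trans ?_
    rw [word]
    congr 1
    funext j
    exact (hτ i j).symm
  have ht : p'.tree = p.tree.map (Multiset.map θ) := by
    refine PTree.map_injective (Multiset.map_injective p'.word_injective) ?_
    have h1 : Multiset.map p'.word ∘ Multiset.map θ = Multiset.map p.word := by
      funext s
      simp only [Function.comp_apply, Multiset.map_map, hθ]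
    rw [PTree.map_map, h1, ← pattern_eq, ← h, pattern_eq]
  have hx : f.app p'.K (genericElt p'.isGeneric) =
      N.relabel θ (f.app p.K (genericElt p.isGeneric)) := by
    rw [← f.app_relabel]
    congr 1
    refine Subtype.ext (Subtype.ext ?_)
    change genericVal k p'.tree = (triDend k).rename θ (genericVal k p.tree)
    rw [rename_genericVal, ht]
  rw [value, value, hx, N.relabel_act]
  have hq : (fun i => bracketElt k (p'.full (θ i))) =
      fun i => (PostLie k).relabel (τ i) (bracketElt k (p.full i)) :=
    funext fun i => relabel_bracketPart k (τ i) (p.full i) (p'.full (θ i)) (hw i)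
  have hq' := congrArg (fun q => N.relabel p'.σ (N.relabel (Equiv.sigmaCongrLeft θ)
    (N.act (f.app p.K (genericElt p.isGeneric)) q))) hq
  refine Eq.trans ?_ hq'.symm
  rw [N.act_relabel, ← N.relabel_trans, ← N.relabel_trans]
  exact congrArg (fun e => N.relabel e _) (Equiv.ext fun ⟨i, j⟩ => (hτ i j).symm)

end Presentation

/-- The condition on smallest variables is local: it holds for the pattern if it holds for each word
with the key pulled back along `σ`. -/
theorem isPattern_substPattern {I K : Type} {J : K → Type} (κ : I → ℕ) (σ : (Σ i, J i) ≃ I)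
    {n : PTree (Multiset K)} (hn : IsGeneric n) {l : ∀ i, List (Magma (J i))}
    (hl : ∀ i, IsFull (listVars (l i))) (hκ : ∀ i, MinFirst (fun j => κ (σ ⟨i, j⟩)) (l i)) :
    IsPattern κ (substPattern σ n l) where
  normal := PTree.normal_map.2 hn.normal
  ne_nil := mt PTree.map_eq_nil.1 hn.ne_nil
  ne_zero := by
    rw [substPattern, PTree.letters_map]
    intro b hb
    obtain ⟨c, hc, rfl⟩ := List.mem_map.1 hb
    simpa using hn.ne_zero c hc
  minFirst := by
    rw [substPattern, PTree.letters_map]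
    intro b hb
    obtain ⟨c, hc, rfl⟩ := List.mem_map.1 hb
    intro l' hl'
    obtain ⟨i, -, rfl⟩ := Multiset.mem_map.1 hl'
    exact minFirst_renameList.2 (hκ i)
  full := by
    have h1 : (substPattern σ n l).degree blockVars =
        ((n.degree id).sigma fun i => listVars (l i)).map σ := by
      rw [substPattern, PTree.degree_map, Multiset.sigma, Multiset.map_bind]
      have h2 := PTree.map_degree (Γ := Multiset K) (Δ := Multiset I)
        { toFun := fun s => s.bind fun i => ((listVars (l i)).map (Sigma.mk i)).map σ
          map_zero' := by simp
          map_add' := by simp } id n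
      refine Eq.trans ?_ h2.symm
      congr 1
      funext s
      simp only [blockVars, Multiset.map_map, Multiset.bind, Multiset.join]
      congr 1
      refine Multiset.map_congr rfl fun i _ => ?_
      simp only [Function.comp_apply, listVars_renameList]
    rw [h1]
    refine IsFull.map ⟨hn.full.1.sigma fun i => (hl i).1, fun x => ?_⟩ σ
    exact Multiset.mem_sigma.2 ⟨hn.full.2 _, (hl _).2 _⟩

/-- The inputs are the lists that occur in the pattern, and the variables of an input are those of
the list. As every element of `I` occurs exactly once, the lists have disjoint sets of variables
that cover `I`, and no list occurs twice. -/
theorem IsPattern.exists_presentation {I : Type} [Finite I] {κ : I → ℕ}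
    {n : PTree (Multiset (List (Magma I)))} (hn : IsPattern κ n) :
    ∃ p : Presentation I, p.pattern = n := by
  classical
  obtain ⟨T, hTn⟩ : ∃ T, T = n.degree id := ⟨_, rfl⟩
  have hT : n.degree blockVars = T.bind listVars := hTn ▸
    (PTree.map_degree (Γ := Multiset (List (Magma I))) (Δ := Multiset I)
      { toFun := fun s => s.bind listVars
        map_zero' := by simp
        map_add' := by simp } id n).symm
  have hfull := hn.full
  rw [hT] at hfull
  have hmin : ∀ l ∈ T, MinFirst κ l := by
    intro l hl
    have : ∀ L : List (Multiset (List (Magma I))), l ∈ (L.map id).sum → ∃ b ∈ L, l ∈ b := by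
      intro L
      induction L with
      | nil => simp
      | cons b L ih =>
        rw [List.map_cons, List.sum_cons, Multiset.mem_add]
        rintro (h | h)
        · exact ⟨b, by simp, h⟩
        · obtain ⟨b, hb, h⟩ := ih h
          exact ⟨b, by simp [hb], h⟩
    obtain ⟨b, hb, h⟩ := this n.letters (by rw [← PTree.degree_eq_sum, ← hTn]; exact hl)
    exact hn.minFirst b hb l h
  have hdisj : ∀ l T', T = l ::ₘ T' → (listVars l).Nodup ∧
      ∀ l' ∈ T', Disjoint (listVars l) (listVars l') := by
    intro l T' h
    have h1 := hfull.1
    rw [h, Multiset.cons_bind, Multiset.nodup_add] at h1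
    exact ⟨h1.1, fun l' hl' => h1.2.2.mono_right (Multiset.le_bind T' hl')⟩
  have hnd : ∀ l ∈ T, (listVars l).Nodup := by
    intro l hl
    obtain ⟨T', hT'⟩ := Multiset.exists_cons_of_mem hl
    exact (hdisj l T' hT').1
  have hTnd : T.Nodup := by
    refine Multiset.nodup_iff_ne_cons_cons.2 fun l T' h => ?_
    have h1 := (hdisj l _ h).2 l (Multiset.mem_cons_self _ _)
    obtain ⟨x, hx⟩ := Multiset.exists_mem_of_ne_zero
      (listVars_ne_zero (hmin l (by rw [h]; simp)).ne_nil)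
    exact Multiset.disjoint_left.1 h1 hx hx
  have huniq : ∀ l ∈ T, ∀ l' ∈ T, ∀ x, x ∈ listVars l → x ∈ listVars l' → l = l' := by
    intro l hl l' hl' x hx hx'
    by_contra hne
    obtain ⟨T', hT'⟩ := Multiset.exists_cons_of_mem hl
    rw [hT', Multiset.mem_cons] at hl'
    exact Multiset.disjoint_left.1 ((hdisj l T' hT').2 l' (hl'.resolve_left (Ne.symm hne))) hx hx'
  have hex : ∀ l : {l // l ∈ T}, ∃ l' : List (Magma {x // x ∈ listVars l.1}),
      renameList Subtype.val l' = l.1 := fun l => exists_renameList_subtype fun x hx => hx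
  choose w hw using hex
  have hex' : ∀ b ∈ n.letters, ∃ b' : Multiset {l // l ∈ T}, b'.map Subtype.val = b ∧ True := by
    intro b hb
    have hb' : ∀ l ∈ b, l ∈ T := by
      intro l hl
      have := le_sum_map_of_mem id hb
      rw [← PTree.degree_eq_sum, ← hTn] at this
      exact Multiset.mem_of_le this hl
    lift b to Multiset {l // l ∈ T} using hb'
    exact ⟨b, rfl, trivial⟩
  obtain ⟨n', rfl, -⟩ := PTree.exists_map_eq hex'
  have hd : (n'.degree id).map Subtype.val = T := (degree_map_multiset _ _).symm.trans hTn.symm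
  let σ : (Σ l : {l // l ∈ T}, {x // x ∈ listVars l.1}) ≃ I := by
    refine Equiv.ofBijective (fun x => x.2.1) ⟨?_, ?_⟩
    · rintro ⟨⟨l, hl⟩, x, hx⟩ ⟨⟨l', hl'⟩, x', hx'⟩ (rfl : x = x')
      obtain rfl := huniq l hl l' hl' x hx hx'
      rfl
    · intro x
      obtain ⟨l, hl, hx⟩ := Multiset.mem_bind.1 (hfull.2 x)
      exact ⟨⟨⟨l, hl⟩, x, hx⟩, rfl⟩
  have : Finite {l // l ∈ T} := (Multiset.finite_toSet T).to_subtype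
  refine ⟨Presentation.mk {l // l ∈ T} (fun l => {x // x ∈ listVars l.1}) σ n' w
    ⟨?_, ?_, ?_, ?_, ?_⟩ ?_ ?_, ?_⟩
  · exact PTree.normal_map.1 hn.normal
  · exact mt PTree.map_eq_nil.2 hn.ne_nil
  · intro b hb
    have := hn.ne_zero (b.map Subtype.val) (by
      rw [PTree.letters_map]
      exact List.mem_map_of_mem hb)
    simpa using this
  · exact Multiset.Nodup.of_map Subtype.val (by rw [hd]; exact hTnd)
  · intro l
    have : l.1 ∈ (n'.degree id).map Subtype.val := by
      rw [hd]
      exact l.2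
    obtain ⟨l', hl', h⟩ := Multiset.mem_map.1 this
    exact Subtype.ext h ▸ hl'
  · intro l h
    have := hw l
    rw [h] at this
    exact (hmin l.1 l.2).ne_nil this.symm
  · intro l
    have h1 : (listVars (w l)).map Subtype.val = listVars l.1 := by
      rw [← listVars_renameList, hw]
    refine ⟨Multiset.Nodup.of_map Subtype.val (by rw [h1]; exact hnd l.1 l.2), fun x => ?_⟩
    have : x.1 ∈ (listVars (w l)).map Subtype.val := by
      rw [h1]
      exact x.2
    obtain ⟨y, hy, h⟩ := Multiset.mem_map.1 this
    exact Subtype.ext h ▸ hy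
  · change n'.map (Multiset.map fun l => renameList _ (w l)) = n'.map (Multiset.map Subtype.val)
    congr 2
    funext l
    exact hw l

end FunctorialPBW

namespace FunctorialPBW

/-! ### Patterns form a basis -/

section freeness

variable {k : Type u} [Field k]

/-- The value of a pattern as an element of the tridendriform operad. -/
noncomputable def patternElt (k : Type u) [Field k] {I : Type} {κ : I → ℕ}
    (n : {n : PTree (Multiset (List (Magma I))) // IsPattern κ n}) : (triDend k).Part I :=
  ⟨patternVal k n.1, patternVal_mem k n.2⟩

theorem span_patternElt [CharZero k] {I : Type} (κ : I → ℕ) :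
    ⊤ ≤ Submodule.span k (Set.range (patternElt k (κ := κ))) := by
  rintro ⟨z, hz⟩ -
  have h1 : z ∈ (Submodule.span k (Set.range (patternElt k (κ := κ)))).map
      ((triDend k).Part I).subtype := by
    rw [Submodule.map_span]
    refine Submodule.span_mono ?_ (mem_span_patternVal k κ hz)
    rintro _ ⟨n, hn, rfl⟩
    exact ⟨_, ⟨⟨n, hn⟩, rfl⟩, rfl⟩
  obtain ⟨y, hy, rfl⟩ := h1
  exact hy

theorem ev_gen_mem {I : Type} {t : PTree I} (ht : t ≠ .nil) (h : IsFull (t.degree fun x => {x})) :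
    (t.ev (triDend k).op (triDend k).gen).2 ∈ (triDend k).Part I := by
  have h1 := ev_mem_graded (o := triOp k I) (G := (triDend k).homog)
    (fun e _ _ _ _ => triOp_mem_homog k e) (fun x => (triDend k).gen_mem_homog x) t ht
  exact (triDend k).homog_eq_part h ▸ h1

/-- The number of patterns is at most the number of trees in which every element of `I` occurs once,
which is at most the dimension of the multilinear part because these trees are independent, which is
at most the number of patterns because they span. A spanning family of this size is a basis. -/
theorem linearIndependent_patternElt [CharZero k] {I : Type} [Finite I] {κ : I → ℕ}
    (hκ : Function.Injective κ) : LinearIndependent k (patternElt k (κ := κ)) := by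
  have hΘ := finite_fullTree I
  choose t h1 h2 h3 h4 using
    fun n : {n : PTree (Multiset (List (Magma I))) // IsPattern κ n} => n.2.exists_tree hκ
  have hinj : Function.Injective fun n => (⟨t n, h1 n, h2 n, h3 n⟩ :
      {t : PTree I // t.Proper ∧ t ≠ .nil ∧ IsFull (t.degree fun x => {x})}) := by
    intro n n' h
    refine Subtype.ext ?_
    have h' : t n = t n' := congrArg Subtype.val h
    rw [← h4 n, ← h4 n', h']
  have hΩ := Finite.of_injective _ hinj
  have := Fintype.ofFinite {n : PTree (Multiset (List (Magma I))) // IsPattern κ n}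
  have := Fintype.ofFinite
    {t : PTree I // t.Proper ∧ t ≠ .nil ∧ IsFull (t.degree fun x => {x})}
  have hfin : FiniteDimensional k ((triDend k).Part I) :=
    Module.finite_def.2 (Submodule.fg_def.2
      ⟨_, Set.finite_range _, top_le_iff.1 (span_patternElt κ)⟩)
  have hLI : LinearIndependent k fun t : {t : PTree I // t.Proper ∧ t ≠ .nil ∧
      IsFull (t.degree fun x => {x})} =>
        (⟨_, ev_gen_mem t.2.2.1 t.2.2.2⟩ : (triDend k).Part I) := by
    refine LinearIndependent.of_comp ((triDend k).Part I).subtype ?_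
    exact (linearIndependent_ev_gen k I).comp
      (fun t : {t : PTree I // t.Proper ∧ t ≠ .nil ∧ IsFull (t.degree fun x => {x})} =>
        (⟨t.1, t.2.1, t.2.2.1⟩ : {t : PTree I // t.Proper ∧ t ≠ .nil}))
      (fun t t' h => by
        have h' : t.1 = t'.1 := Subtype.mk.inj h
        exact Subtype.ext h')
  refine linearIndependent_of_top_le_span_of_card_eq_finrank (span_patternElt κ) ?_
  refine le_antisymm ((Fintype.card_le_of_injective _ hinj).trans hLI.fintype_card_le_finrank) ?_
  exact finrank_le_of_span_eq_top (top_le_iff.1 (span_patternElt κ))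

theorem genericSpan_hom_ext {K : Type} [Finite K] {W : Type u} [AddCommGroup W] [Module k W]
    (F G : (Presentation.genericSeq k).obj K →ₗ[k] W)
    (h : ∀ (n : PTree (Multiset K)) (hn : IsGeneric n),
      F (Presentation.genericElt hn) = G (Presentation.genericElt hn)) : F = G := by
  have h1 : ∀ F G : genericSpan k K →ₗ[k] W, (∀ (n : PTree (Multiset K)) (hn : IsGeneric n),
      F (Presentation.genericElt hn) = G (Presentation.genericElt hn)) → F = G := by
    intro F G h
    refine (Submodule.linearMap_eq_iff_of_eq_span F G rfl).2 ?_
    rintro ⟨x, n, hn, hx⟩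
    obtain rfl : x = ⟨genericVal k n, genericVal_mem k hn⟩ := Subtype.ext hx
    exact h n hn
  exact h1 F G h

/-- The tridendriform operad is free as a right module over the post-Lie operad. -/
theorem isFree_rightModule_phi [CharZero k] : (phi k).rightModule.IsFree := by
  refine RightModule.isFree_of_sub _ (fun K _ => genericSpan k K)
    (fun σ => relabel_mem_genericSpan k σ) ?_ ?_
  · intro I _ z
    -- Patterns span for every key; injectivity matters only for independence.
    obtain ⟨κ, -⟩ : ∃ κ : I → ℕ, Function.Injective κ := ⟨_, (Countable.exists_injective_nat I).choose_spec⟩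
    refine Submodule.span_mono ?_ (span_patternElt (k := k) κ (trivial : z ∈ ⊤))
    rintro _ ⟨n, rfl⟩
    obtain ⟨p, hp⟩ := n.2.exists_presentation
    refine ⟨p.K, p.finite, p.J, p.finite', p.σ, Presentation.genericElt p.isGeneric,
      fun i => Presentation.bracketElt k (p.full i), Subtype.ext ?_⟩
    exact (patternVal_substPattern k p.σ p.isGeneric p.full).trans (congrArg (patternVal k) hp)
  · intro N f I _
    obtain ⟨κ, hκ⟩ := Countable.exists_injective_nat I
    choose p hp using fun n : {n : PTree (Multiset (List (Magma I))) // IsPattern κ n} =>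
      n.2.exists_presentation
    let b := Module.Basis.mk (linearIndependent_patternElt (k := k) hκ) (span_patternElt κ)
    -- The extension is prescribed on the basis of patterns through arbitrarily chosen
    -- presentations; `value_eq` makes the choice irrelevant.
    let g : (triDend k).Part I →ₗ[k] N.obj I := b.constr k fun n => (p n).value N f
    have hg : ∀ n, g (patternElt k n) = (p n).value N f := by
      intro n
      have := b.constr_basis k (fun n => (p n).value N f) n
      rwa [Module.Basis.mk_apply] at this
    refine ⟨g, ?_⟩
    intro K _ J _ σ x q
    let F : (Presentation.genericSeq k).obj K →ₗ[k] N.obj I :=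
      { toFun := fun x => g ((phi k).rightModule.relabel σ ((phi k).rightModule.act x.1 q))
        map_add' := fun x y => by
          change g ((phi k).rightModule.relabel σ ((phi k).rightModule.act (x.1 + y.1) q)) = _
          rw [map_add, add_apply, map_add]
          exact map_add g _ _
        map_smul' := fun c x => by
          change g ((phi k).rightModule.relabel σ ((phi k).rightModule.act (c • x.1) q)) = _
          rw [map_smul, smul_apply, map_smul]
          exact map_smul g c _ }
    let G : (Presentation.genericSeq k).obj K →ₗ[k] N.obj I :=
      { toFun := fun x => N.relabel σ (N.act (f.app K x) q)
        map_add' := by simp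
        map_smul' := by simp }
    refine LinearMap.congr_fun (f := F) (g := G) ?_ x
    refine genericSpan_hom_ext F G fun n hn => ?_
    have hF : (g ∘ₗ (phi k).rightModule.relabel σ).compMultilinearMap
          ((phi k).rightModule.act (Presentation.genericElt hn).1) =
        (N.relabel σ).compMultilinearMap (N.act (f.app K (Presentation.genericElt hn))) := by
      -- By multilinearity it suffices to substitute brackets that are min-first for the key induced
      -- from `I`. The result is then a pattern for `κ`, that is, a basis element on which `g` is
      -- known.
      refine MultilinearMap.ext_of_span_eq_top
        (fun i => span_bracketPart k (fun j => κ (σ ⟨i, j⟩))) fun l => ?_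
      let p' : Presentation I := ⟨K, J, σ, n, fun i => (l i).1, hn,
        fun i => (l i).2.1.ne_nil, fun i => (l i).2.2⟩
      have hp' := isPattern_substPattern κ σ hn (fun i => (l i).2.2) (fun i => (l i).2.1)
      refine Eq.trans ?_ (Presentation.value_eq N f (p := p ⟨_, hp'⟩) (p' := p') (hp _))
      rw [← hg]
      refine congrArg g (Subtype.ext ?_)
      exact patternVal_substPattern k σ hn fun i => (l i).2.2
    exact congrArg (fun m => m q) hF

end freeness
end FunctorialPBW

namespace FunctorialPBW

/-! ## Schur functors and relative composite products -/

section schur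

variable {k : Type u} [Field k]

/-- The symmetric sequence of multilinear maps from `A` to `W`. -/
noncomputable def multilinearSeq (k : Type u) [Field k] (A W : Type u) [AddCommGroup A] [Module k A]
    [AddCommGroup W] [Module k W] : SymmSeq k where
  obj I _ := MultilinearMap k (fun _ : I => A) W
  relabel σ := (MultilinearMap.domDomCongrLinearEquiv k k A W σ).toLinearMap
  relabel_refl _ := rfl
  relabel_trans _ _ _ := rfl

/-- An equivariant family of multilinear maps on `A` indexed by the elements of `T`. -/
structure MultilinearFamily (T : SymmSeq k) (A W : Type u) [AddCommGroup A] [Module k A]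
    [AddCommGroup W] [Module k W] where
  app : ∀ (I : Type) [Finite I], T.obj I →ₗ[k] MultilinearMap k (fun _ : I => A) W
  app_relabel : ∀ {I J : Type} [Finite I] [Finite J] (σ : I ≃ J) (x : T.obj I) (a : J → A),
    app J (T.relabel σ x) a = app I x fun i => a (σ i)

namespace MultilinearFamily

variable {T : SymmSeq k} {A W : Type u} [AddCommGroup A] [Module k A] [AddCommGroup W] [Module k W]

/-- A family of multilinear maps as a morphism of symmetric sequences. -/
def toHom (g : MultilinearFamily T A W) : SymmSeq.Hom T (multilinearSeq k A W) where
  app I _ := g.app I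
  app_relabel σ x := MultilinearMap.ext (g.app_relabel σ x)

/-- The family of multilinear maps given by a morphism of symmetric sequences. -/
def ofHom (g : SymmSeq.Hom T (multilinearSeq k A W)) : MultilinearFamily T A W where
  app I _ := g.app I
  app_relabel σ x a := congrArg (fun m : MultilinearMap k _ W => m a) (g.app_relabel σ x)

/-- A linear map applied to the values. -/
noncomputable def postcomp {W' : Type u} [AddCommGroup W'] [Module k W']
    (g : MultilinearFamily T A W) (f : W →ₗ[k] W') : MultilinearFamily T A W' where
  app I _ := (f.compMultilinearMapₗ k) ∘ₗ g.app I
  app_relabel σ x a := congrArg f (g.app_relabel σ x a)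

/-- A linear map applied to the arguments. -/
noncomputable def precomp {B : Type u} [AddCommGroup B] [Module k B]
    (g : MultilinearFamily T B W) (c : A →ₗ[k] B) : MultilinearFamily T A W where
  app I _ := (MultilinearMap.compLinearMapₗ fun _ => c) ∘ₗ g.app I
  app_relabel σ x a := g.app_relabel σ x fun j => c (a j)

/-- A family of multilinear maps on the generators of the sequence `T`. -/
noncomputable def restrict {S : SymmSeq k} (ι : SymmSeq.Hom S T) (g : MultilinearFamily T A W) :
    MultilinearFamily S A W where
  app I _ := g.app I ∘ₗ ι.app I
  app_relabel σ x a := by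
    rw [LinearMap.comp_apply, ι.app_relabel, g.app_relabel]
    rfl

end MultilinearFamily

variable (T : SymmSeq k) (A : Type u) [AddCommGroup A] [Module k A]

/-- The linear combinations of formal expressions `x(a₁, …, aₙ)` with `x` in `T` and `aᵢ` in `A`. -/
abbrev SchurPre : Type u := (Σ n : ℕ, T.obj (Fin n) × (Fin n → A)) →₀ k

variable {T A} in
/-- The evaluation of formal expressions. -/
noncomputable def schurEval {W : Type u} [AddCommGroup W] [Module k W]
    (g : MultilinearFamily T A W) : SchurPre T A →ₗ[k] W :=
  Finsupp.linearCombination k fun x =>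
    g.app (Fin x.1) x.2.1 x.2.2

/-- The formal expressions that vanish under all evaluations. -/
noncomputable def schurRel : Submodule k (SchurPre T A) where
  -- Testing against all targets takes the place of a list of relations for multilinearity and
  -- equivariance; the universal property is then immediate.
  carrier := {z | ∀ (W : Type u) [AddCommGroup W] [Module k W]
    (g : MultilinearFamily T A W), schurEval g z = 0}
  add_mem' hx hy W _ _ g := by rw [map_add, hx, hy, add_zero]
  zero_mem' W _ _ g := map_zero _
  smul_mem' c x hx W _ _ g := by rw [map_smul, hx, smul_zero]

/-- The Schur functor of a symmetric sequence. -/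
abbrev Schur : Type u := SchurPre T A ⧸ schurRel T A

namespace Schur

variable {T A} {W : Type u} [AddCommGroup W] [Module k W]

/-- The linear map defined by a family of multilinear maps. -/
noncomputable def desc (g : MultilinearFamily T A W) : Schur T A →ₗ[k] W :=
  (schurRel T A).liftQ (schurEval g) fun _ hz => hz W g

/-- Evaluations separate points, so identities in the Schur functor are checked in the target of an
arbitrary family. -/
theorem eq_of_desc {x y : Schur T A} (h : ∀ (W : Type u) [AddCommGroup W] [Module k W]
    (g : MultilinearFamily T A W), desc g x = desc g y) : x = y := by
  obtain ⟨x, rfl⟩ := Submodule.mkQ_surjective _ x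
  obtain ⟨y, rfl⟩ := Submodule.mkQ_surjective _ y
  refine (Submodule.Quotient.eq _).2 fun W _ _ g => ?_
  rw [map_sub, sub_eq_zero]
  exact h W g

/-- The element `x(aᵢ, i ∈ I)`. -/
noncomputable def mk {I : Type} [Finite I] (x : T.obj I) (a : I → A) : Schur T A :=
  (schurRel T A).mkQ (Finsupp.single
    ⟨Nat.card I, T.relabel (Finite.equivFin I) x, fun i => a ((Finite.equivFin I).symm i)⟩ 1)

/-- Equivariance removes the numbering of `I` chosen in `mk`. -/
theorem desc_mk (g : MultilinearFamily T A W) {I : Type} [Finite I] (x : T.obj I)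
    (a : I → A) :
    desc g (mk x a) = g.app I x a := by
  refine (Finsupp.linearCombination_single k _ _).trans ?_
  rw [one_smul]
  simp only
  rw [g.app_relabel]
  simp

theorem mk_single (x : Σ n : ℕ, T.obj (Fin n) × (Fin n → A)) :
    (schurRel T A).mkQ (Finsupp.single x 1) = mk x.2.1 x.2.2 := by
  refine eq_of_desc fun W _ _ g => ?_
  rw [desc_mk]
  exact (Finsupp.linearCombination_single k _ _).trans (one_smul _ _)

theorem hom_ext {f g : Schur T A →ₗ[k] W}
    (h : ∀ (n : ℕ) (x : T.obj (Fin n)) (a : Fin n → A), f (mk x a) = g (mk x a)) : f = g := by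
  refine Submodule.linearMap_qext _ (Finsupp.lhom_ext' fun x => LinearMap.ext_ring ?_)
  change f ((schurRel T A).mkQ (Finsupp.single x 1)) = g ((schurRel T A).mkQ (Finsupp.single x 1))
  rw [mk_single, h]

theorem span_mk : Submodule.span k (Set.range
    fun x : Σ n : ℕ, T.obj (Fin n) × (Fin n → A) => mk x.2.1 x.2.2) = ⊤ := by
  rw [eq_top_iff]
  intro z _
  obtain ⟨z, rfl⟩ := Submodule.mkQ_surjective _ z
  induction z using Finsupp.induction_linear with
  | zero => simp
  | add x y hx hy =>
    rw [map_add]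
    exact add_mem (hx trivial) (hy trivial)
  | single x c =>
    rw [← mul_one c, ← smul_eq_mul, ← Finsupp.smul_single, map_smul, mk_single]
    exact Submodule.smul_mem _ _ (Submodule.subset_span ⟨x, rfl⟩)

variable (T A) in
/-- The universal family of multilinear maps. -/
noncomputable def univ : MultilinearFamily T A (Schur T A) where
  app I _ :=
    { toFun := fun x =>
        { toFun := mk x
          map_update_add' := fun a i b c => eq_of_desc fun W _ _ g => by
            simp only [map_add, desc_mk, MultilinearMap.map_update_add]
          map_update_smul' := fun a i c b => eq_of_desc fun W _ _ g => by
            simp only [map_smul, desc_mk, MultilinearMap.map_update_smul] }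
      map_add' := fun x y => MultilinearMap.ext fun a => eq_of_desc fun W _ _ g => by
        change desc g (mk (x + y) a) = desc g (mk x a + mk y a)
        rw [map_add, desc_mk, desc_mk, desc_mk, map_add]
        rfl
      map_smul' := fun c x => MultilinearMap.ext fun a => eq_of_desc fun W _ _ g => by
        change desc g (mk (c • x) a) = desc g (c • mk x a)
        rw [map_smul, desc_mk, desc_mk, map_smul]
        rfl }
  app_relabel σ x a := eq_of_desc fun W _ _ g => by
    change desc g (mk (T.relabel σ x) a) = desc g (mk x fun i => a (σ i))
    rw [desc_mk, desc_mk, g.app_relabel]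

/-- The functoriality of the Schur functor. -/
noncomputable def map (T : SymmSeq k) {B : Type u} [AddCommGroup B] [Module k B] (c : A →ₗ[k] B) :
    Schur T A →ₗ[k] Schur T B := desc ((univ T B).precomp c)

theorem map_mk {B : Type u} [AddCommGroup B] [Module k B] (c : A →ₗ[k] B) {I : Type} [Finite I]
    (x : T.obj I) (a : I → A) : map T c (mk x a) = mk x fun i => c (a i) := desc_mk _ _ _

end Schur

/-- The Schur functor. -/
noncomputable def schurFunctor (T : SymmSeq k) : ModuleCat.{u} k ⥤ ModuleCat.{u} k where
  obj V := ModuleCat.of k (Schur T V)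
  map c := ModuleCat.ofHom (Schur.map T c.hom)
  map_id V := ModuleCat.hom_ext (Schur.hom_ext fun n x a => Schur.map_mk _ _ _)
  map_comp c d := ModuleCat.hom_ext (Schur.hom_ext fun n x a => by
    change Schur.map T (c ≫ d).hom _ = Schur.map T d.hom (Schur.map T c.hom _)
    rw [Schur.map_mk, Schur.map_mk, Schur.map_mk]
    rfl)

end schur

/-! ### The module of multilinear maps on an algebra -/

section relative

variable {k : Type u} [Field k] {P : Operad k}

/-- The composition of a multilinear map on a `P`-algebra with operations of the algebra. -/
noncomputable def Operad.Alg.multilinearAct (A : P.Alg) (W : Type u) [AddCommGroup W]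
    [Module k W] {I : Type} [Finite I] {J : I → Type} [∀ i, Finite (J i)] :
    MultilinearMap k (fun _ : I => A.carrier) W →ₗ[k] MultilinearMap k (fun i => P.obj (J i))
      (MultilinearMap k (fun _ : Σ i, J i => A.carrier) W) where
  toFun m :=
    { toFun := fun q => MultilinearMap.compMultilinearMap m fun i => A.act (q i)
      map_update_add' := fun q i x y => MultilinearMap.ext fun a => by
        have h : ∀ z, (fun i' => A.act (Function.update q i z i') fun j => a ⟨i', j⟩) =
            Function.update (fun i' => A.act (q i') fun j => a ⟨i', j⟩) i
              (A.act z fun j => a ⟨i, j⟩) := fun z => funext fun i' =>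
          Function.apply_update (fun i' (z : P.obj (J i')) => A.act z fun j => a ⟨i', j⟩)
            q i z i'
        change m (fun i' => A.act (Function.update q i (x + y) i') fun j => a ⟨i', j⟩) =
          m (fun i' => A.act (Function.update q i x i') fun j => a ⟨i', j⟩) +
          m (fun i' => A.act (Function.update q i y i') fun j => a ⟨i', j⟩)
        rw [h, h, h, map_add]
        exact MultilinearMap.map_update_add m _ i _ _
      map_update_smul' := fun q i c x => MultilinearMap.ext fun a => by
        have h : ∀ z, (fun i' => A.act (Function.update q i z i') fun j => a ⟨i', j⟩) =
            Function.update (fun i' => A.act (q i') fun j => a ⟨i', j⟩) i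
              (A.act z fun j => a ⟨i, j⟩) := fun z => funext fun i' =>
          Function.apply_update (fun i' (z : P.obj (J i')) => A.act z fun j => a ⟨i', j⟩)
            q i z i'
        change m (fun i' => A.act (Function.update q i (c • x) i') fun j => a ⟨i', j⟩) =
          c • m (fun i' => A.act (Function.update q i x i') fun j => a ⟨i', j⟩)
        rw [h, h, map_smul]
        exact MultilinearMap.map_update_smul m _ i _ _ }
  map_add' m m' := rfl
  map_smul' c m := rfl

/-- The right module of multilinear maps on a `P`-algebra. -/
noncomputable def Operad.Alg.multilinearModule (A : P.Alg) (W : Type u) [AddCommGroup W]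
    [Module k W] : RightModule P where
  toSymmSeq := multilinearSeq k A.carrier W
  act := A.multilinearAct W
  act_one {I _} m := MultilinearMap.ext fun a =>
    congrArg (show MultilinearMap k (fun _ : I => A.carrier) W from m)
      (funext fun i => A.act_one fun _ => a i)
  act_assoc {I _ _ _ _ _} m q r := MultilinearMap.ext fun a =>
    congrArg (show MultilinearMap k (fun _ : I => A.carrier) W from m)
      (funext fun i => (A.act_comp (q i) (r i) fun j => a ⟨i, j⟩).symm)
  relabel_act _ _ _ := MultilinearMap.ext fun _ => rfl
  act_relabel {I _ _ _ _ _} τ m q := MultilinearMap.ext fun a =>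
    congrArg (show MultilinearMap k (fun _ : I => A.carrier) W from m)
      (funext fun i => A.act_relabel (τ i) (q i) fun j => a ⟨i, j⟩)

variable {M : RightModule P} {A : P.Alg} {W : Type u} [AddCommGroup W] [Module k W]

/-- A family of multilinear maps indexed by a right module is balanced if it is compatible with the
action of the operad. -/
structure IsBalanced (g : MultilinearFamily M.toSymmSeq A.carrier W) : Prop where
  app_act : ∀ {I : Type} [Finite I] {J : I → Type} [∀ i, Finite (J i)] (m : M.obj I) (q : ∀ i, P.obj (J i))
    (a : (Σ i, J i) → A.carrier),
    g.app _ (M.act m q) a = g.app I m fun i => A.act (q i) fun j => a ⟨i, j⟩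

/-- A balanced family as a morphism of right modules. -/
def IsBalanced.toHom {g : MultilinearFamily M.toSymmSeq A.carrier W} (hg : IsBalanced g) :
    RightModule.Hom M (A.multilinearModule W) where
  toHom := g.toHom
  app_act m q := MultilinearMap.ext (hg.app_act m q)

theorem IsBalanced.ofHom (g : RightModule.Hom M (A.multilinearModule W)) :
    IsBalanced (A := A) (MultilinearFamily.ofHom g.toHom) where
  app_act m q a := congrArg (fun m : MultilinearMap k _ W => m a) (g.app_act m q)

theorem IsBalanced.postcomp {g : MultilinearFamily M.toSymmSeq A.carrier W} (hg : IsBalanced g)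
    {W' : Type u} [AddCommGroup W'] [Module k W'] (f : W →ₗ[k] W') :
    IsBalanced (g.postcomp f) where
  app_act m q a := congrArg f (hg.app_act m q a)

variable (M A) in
/-- The relations of the relative composite product. -/
noncomputable def relativeRel : Submodule k (Schur M.toSymmSeq A.carrier) :=
  Submodule.span k {z | ∃ (I : Type) (_ : Finite I) (J : I → Type) (_ : ∀ i, Finite (J i))
    (m : M.obj I) (q : ∀ i, P.obj (J i)) (a : (Σ i, J i) → A.carrier),
    z = Schur.mk (M.act m q) a - Schur.mk m fun i => A.act (q i) fun j => a ⟨i, j⟩}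

variable (M A) in
/-- The relative composite product of a right `P`-module and a `P`-algebra. -/
abbrev Relative : Type u := Schur M.toSymmSeq A.carrier ⧸ relativeRel M A

namespace Relative

/-- The element `m(aᵢ, i ∈ I)`. -/
noncomputable def mk {I : Type} [Finite I] (m : M.obj I) (a : I → A.carrier) : Relative M A :=
  (relativeRel M A).mkQ (Schur.mk m a)

/-- The linear map defined by a balanced family of multilinear maps. -/
noncomputable def desc (g : MultilinearFamily M.toSymmSeq A.carrier W) (hg : IsBalanced g) :
    Relative M A →ₗ[k] W :=
  (relativeRel M A).liftQ (Schur.desc g) (Submodule.span_le.2 (by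
    rintro _ ⟨I, _, J, _, m, q, a, rfl⟩
    change Schur.desc g _ = 0
    rw [map_sub, Schur.desc_mk, Schur.desc_mk, hg.app_act, sub_self]))

theorem desc_mk (g : MultilinearFamily M.toSymmSeq A.carrier W) (hg : IsBalanced g) {I : Type}
    [Finite I] (m : M.obj I) (a : I → A.carrier) : desc g hg (mk m a) = g.app I m a :=
  Schur.desc_mk g m a

variable (M A) in
/-- The universal balanced family. -/
noncomputable def univ : MultilinearFamily M.toSymmSeq A.carrier (Relative M A) :=
  (Schur.univ M.toSymmSeq A.carrier).postcomp (relativeRel M A).mkQ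

variable (M A) in
theorem isBalanced_univ : IsBalanced (univ M A) where
  app_act {I _ J _} m q a := by
    refine (Submodule.Quotient.eq _).2 (Submodule.subset_span ?_)
    exact ⟨I, inferInstance, J, inferInstance, m, q, a, rfl⟩

theorem mk_act {I : Type} [Finite I] {J : I → Type} [∀ i, Finite (J i)] (m : M.obj I)
    (q : ∀ i, P.obj (J i)) (a : (Σ i, J i) → A.carrier) :
    mk (M.act m q) a = mk m fun i => A.act (q i) fun j => a ⟨i, j⟩ :=
  (isBalanced_univ M A).app_act m q a

theorem mk_relabel {I J : Type} [Finite I] [Finite J] (σ : I ≃ J) (m : M.obj I)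
    (a : J → A.carrier) : mk (M.relabel σ m) a = mk m fun i => a (σ i) :=
  (univ M A).app_relabel σ m a

theorem hom_ext {f g : Relative M A →ₗ[k] W}
    (h : ∀ (n : ℕ) (m : M.obj (Fin n)) (a : Fin n → A.carrier), f (mk m a) = g (mk m a)) : f = g :=
  Submodule.linearMap_qext _ (Schur.hom_ext h)

theorem span_mk : Submodule.span k (Set.range
    fun x : Σ n : ℕ, M.obj (Fin n) × (Fin n → A.carrier) =>
      (mk x.2.1 x.2.2 : Relative M A)) = ⊤ := by
  have h := congrArg (Submodule.map (relativeRel M A).mkQ)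
    (Schur.span_mk (T := M.toSymmSeq) (A := A.carrier))
  rw [Submodule.map_span, Submodule.map_top, Submodule.range_mkQ, ← Set.range_comp] at h
  exact h

end Relative

/-- If a right module is free, then its relative composite product with an algebra is given by a
Schur functor, naturally in the algebra. -/
theorem RightModule.IsFree.exists_equiv (hM : M.IsFree) :
    ∃ (X : SymmSeq k) (ι : SymmSeq.Hom X M.toSymmSeq)
      (e : ∀ A : P.Alg, Schur X A.carrier ≃ₗ[k] Relative M A),
      ∀ (A : P.Alg) (I : Type) [Finite I] (x : X.obj I) (a : I → A.carrier),
        e A (Schur.mk x a) = Relative.mk (ι.app I x) a := by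
  obtain ⟨X, ι, h⟩ := hM
  -- Linear maps from the relative product to `W` are morphisms of right modules from `M` to the
  -- multilinear maps from `A` to `W`. By freeness they are determined on `X`.
  have hext : ∀ (A : P.Alg) (f g : Relative M A →ₗ[k] Relative M A),
      (∀ (I : Type) [Finite I] (x : X.obj I) (a : I → A.carrier),
        f (Relative.mk (ι.app I x) a) = g (Relative.mk (ι.app I x) a)) → f = g := by
    intro A f g hfg
    have h1 : ((Relative.isBalanced_univ M A).postcomp f).toHom =
        ((Relative.isBalanced_univ M A).postcomp g).toHom :=
      (h (A.multilinearModule _) (((Relative.univ M A).postcomp g).restrict ι).toHom).unique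
        (fun I _ x => MultilinearMap.ext fun a => hfg I x a) (fun I _ x => rfl)
    refine Relative.hom_ext fun n m a => ?_
    exact congrArg (fun F : RightModule.Hom M (A.multilinearModule (Relative M A)) =>
      (MultilinearFamily.ofHom F.toHom).app (Fin n) m a) h1
  -- The other half of freeness: the universal family on `X` extends to a balanced family on `M`,
  -- which gives the inverse map.
  choose G hG using fun A : P.Alg =>
    (h (A.multilinearModule (Schur X A.carrier)) (Schur.univ X A.carrier).toHom).exists
  let d (A : P.Alg) := Relative.desc (A := A) (MultilinearFamily.ofHom (G A).toHom)
    (IsBalanced.ofHom (G A))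
  have hd : ∀ (A : P.Alg) (I : Type) [Finite I] (x : X.obj I) (a : I → A.carrier),
      d A (Relative.mk (ι.app I x) a) = Schur.mk x a := fun A I _ x a =>
    (Relative.desc_mk _ _ _ _).trans
      (congrArg (fun m : MultilinearMap k (fun _ : I => A.carrier) _ => m a) (hG A I x))
  let c (A : P.Alg) := Schur.desc ((Relative.univ M A).restrict ι)
  have hc : ∀ (A : P.Alg) (I : Type) [Finite I] (x : X.obj I) (a : I → A.carrier),
      c A (Schur.mk x a) = Relative.mk (ι.app I x) a := fun A I _ x a => Schur.desc_mk _ _ _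
  refine ⟨X, ι, fun A => LinearEquiv.ofLinearMap (c A) (d A) ?_ ?_, hc⟩
  · refine hext A _ _ fun I _ x a => ?_
    rw [LinearMap.comp_apply, hd, hc]
    rfl
  · refine Schur.hom_ext fun n x a => ?_
    rw [LinearMap.comp_apply, hc, hd]
    rfl

end relative
end FunctorialPBW

namespace FunctorialPBW

/-! ## Universal enveloping algebras for varieties -/

section products

variable {k : Type u} [Field k] (V : Variety k)

/-- The product of two multilinear elements in disjoint sets of variables. -/
noncomputable def Variety.mulPart (e : V.Op) {I J : Type} :
    V.Part I →ₗ[k] V.Part J →ₗ[k] V.Part (I ⊕ J) :=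
  LinearMap.mk₂ k (fun p q => ⟨V.op e (V.rename Sum.inl p.1) (V.rename Sum.inr q.1), by
      have h := V.op_mem e (Set.isCompl_range_inl_range_inr (α := I) (β := J)).disjoint
        (Set.image_univ ▸ V.rename_mem Sum.inl Sum.inl_injective p.2)
        (Set.image_univ ▸ V.rename_mem Sum.inr Sum.inr_injective q.2)
      rwa [Set.range_inl_union_range_inr] at h⟩)
    (fun p p' q => Subtype.ext (by simp)) (fun c p q => Subtype.ext (by simp))
    (fun p q q' => Subtype.ext (by simp)) (fun c p q => Subtype.ext (by simp))

theorem Variety.mulPart_coe (e : V.Op) {I J : Type} (p : V.Part I) (q : V.Part J) :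
    (V.mulPart e p q).1 = V.op e (V.rename Sum.inl p.1) (V.rename Sum.inr q.1) := rfl

theorem Variety.mulPart_relabel (e : V.Op) {I J I' J' : Type} (σ : I ≃ I') (τ : J ≃ J')
    (p : V.Part I) (q : V.Part J) : V.mulPart e (V.relabelPart σ p) (V.relabelPart τ q) =
      V.relabelPart (Equiv.sumCongr σ τ) (V.mulPart e p q) := Subtype.ext (by
  simp only [mulPart_coe, relabelPart_coe, rename, lift_lift, lift_gen, lift_op]
  rfl)

theorem Variety.mulPart_comp (e : V.Op) {I L : Type} {J : I ⊕ L → Type} (p : V.Part I)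
    (q : V.Part L) (r : ∀ x, V.Part (J x)) :
    V.mulPart e (V.compPart p fun i => r (.inl i)) (V.compPart q fun l => r (.inr l)) =
      V.relabelPart (Equiv.sumSigmaDistrib J) (V.compPart (V.mulPart e p q) r) := Subtype.ext (by
  simp only [mulPart_coe, relabelPart_coe, compPart_coe, rename, lift_lift, lift_gen, lift_op]
  rfl)

end products

/-! ### The operations on the relative composite product -/

section envelope

variable {k : Type u} [Field k] {V : Variety k} {P : Operad k} (φ : Operad.Hom P V.operad)
  (A : P.Alg)

/-- The components of a morphism to the operad of a variety. -/
def part {I : Type} [Finite I] : P.obj I →ₗ[k] V.Part I := φ.app I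

/-- The underlying vector space of the universal enveloping algebra. -/
abbrev Envelope : Type u := Relative φ.rightModule A

namespace Envelope

variable {A}

/-- The element `p(aᵢ, i ∈ I)`. -/
noncomputable def mk {I : Type} [Finite I] (p : V.Part I) (a : I → A.carrier) : Envelope φ A :=
  Relative.mk (M := φ.rightModule) p a

/-- The multilinear map defined by `p`. -/
noncomputable def mkMulti {I : Type} [Finite I] :
    V.Part I →ₗ[k] MultilinearMap k (fun _ : I => A.carrier) (Envelope φ A) :=
  (Relative.univ φ.rightModule A).app I

theorem mkMulti_apply {I : Type} [Finite I] (p : V.Part I) (a : I → A.carrier) :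
    mkMulti φ p a = mk φ p a := rfl

theorem mk_relabel {I J : Type} [Finite I] [Finite J] (σ : I ≃ J) (p : V.Part I)
    (a : J → A.carrier) : mk φ (V.relabelPart σ p) a = mk φ p fun i => a (σ i) :=
  Relative.mk_relabel (M := φ.rightModule) σ p a

theorem mk_comp {I : Type} [Finite I] {J : I → Type} [∀ i, Finite (J i)] (p : V.Part I)
    (q : ∀ i, P.obj (J i)) (a : (Σ i, J i) → A.carrier) :
    mk φ (V.compPart p fun i => part φ (q i)) a =
      mk φ p fun i => A.act (q i) fun j => a ⟨i, j⟩ :=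
  Relative.mk_act (M := φ.rightModule) p q a

variable {φ} in
theorem hom_ext {W : Type u} [AddCommGroup W] [Module k W] {f g : Envelope φ A →ₗ[k] W}
    (h : ∀ (n : ℕ) (p : V.Part (Fin n)) (a : Fin n → A.carrier), f (mk φ p a) = g (mk φ p a)) :
    f = g := Relative.hom_ext h

theorem mk_mulPart_comp (e : V.Op) {I L : Type} [Finite I] [Finite L] {J : I ⊕ L → Type}
    [∀ x, Finite (J x)] (p : V.Part I) (q : V.Part L) (r : ∀ x, P.obj (J x))
    (a : (Σ i, J (.inl i)) → A.carrier) (b : (Σ l, J (.inr l)) → A.carrier) :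
    mk φ (V.mulPart e (V.compPart p fun i => part φ (r (.inl i)))
      (V.compPart q fun l => part φ (r (.inr l)))) (Sum.elim a b) =
    mk φ (V.mulPart e p q)
      (Sum.elim (fun i => A.act (r (.inl i)) fun j => a ⟨i, j⟩)
        fun l => A.act (r (.inr l)) fun j => b ⟨l, j⟩) := by
  rw [V.mulPart_comp e p q fun x => part φ (r x), mk_relabel, mk_comp]
  congr 1
  funext x
  cases x <;> rfl

/-- The products `(p, q) ↦ (p ∘ q)(a, b)` as multilinear maps. -/
noncomputable def mulMulti (e : V.Op) {I L : Type} [Finite I] [Finite L] (p : V.Part I)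
    (q : V.Part L) :
    MultilinearMap k (fun _ : I => A.carrier)
      (MultilinearMap k (fun _ : L => A.carrier) (Envelope φ A)) :=
  (mkMulti φ (V.mulPart e p q)).currySum

theorem mulMulti_apply (e : V.Op) {I L : Type} [Finite I] [Finite L] (p : V.Part I)
    (q : V.Part L) (a : I → A.carrier) (b : L → A.carrier) :
    mulMulti φ e p q a b = mk φ (V.mulPart e p q) (Sum.elim a b) :=
  MultilinearMap.currySum_apply' _ _ _

theorem mk_mulPart_relabel (e : V.Op) {I L I' L' : Type} [Finite I] [Finite L] [Finite I']
    [Finite L'] (σ : I ≃ I') (τ : L ≃ L') (p : V.Part I) (q : V.Part L) (a : I' → A.carrier)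
    (b : L' → A.carrier) :
    mk φ (V.mulPart e (V.relabelPart σ p) (V.relabelPart τ q)) (Sum.elim a b) =
      mk φ (V.mulPart e p q) (Sum.elim (fun i => a (σ i)) fun l => b (τ l)) := by
  rw [V.mulPart_relabel, mk_relabel]
  congr 1
  funext x
  cases x <;> rfl

/-- The inputs of the other factor are filled with the operadic unit, which reduces one-sided
substitution to substitution on both sides. -/
theorem mk_mulPart_comp_left (e : V.Op) {I L : Type} [Finite I] [Finite L] {J : I → Type}
    [∀ i, Finite (J i)] (p : V.Part I) (q : V.Part L) (r : ∀ i, P.obj (J i))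
    (a : (Σ i, J i) → A.carrier) (b : L → A.carrier) :
    mk φ (V.mulPart e (V.compPart p fun i => part φ (r i)) q) (Sum.elim a b) =
      mk φ (V.mulPart e p q) (Sum.elim (fun i => A.act (r i) fun j => a ⟨i, j⟩) b) := by
  have h1 : V.relabelPart (Equiv.sigmaPUnit L)
      (V.compPart q fun _ => part φ P.one) = q := φ.rightModule.act_one q
  have h2 := mk_mulPart_relabel φ e (Equiv.refl _) (Equiv.sigmaPUnit L)
    (V.compPart p fun i => part φ (r i)) (V.compPart q fun _ => part φ P.one) a b
  rw [h1, show V.relabelPart (Equiv.refl _) (V.compPart p fun i => part φ (r i)) = _ from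
    V.operad.relabel_refl _] at h2
  rw [h2]
  have : ∀ x, Finite (Sum.elim J (fun _ : L => Unit) x) := by
    rintro (i | l)
    · exact inferInstanceAs (Finite (J i))
    · exact inferInstanceAs (Finite Unit)
  let r' : ∀ x, P.obj (Sum.elim J (fun _ : L => Unit) x) := fun x =>
    Sum.rec (motive := fun x => P.obj (Sum.elim J (fun _ : L => Unit) x)) r (fun _ => P.one) x
  have h3 := mk_mulPart_comp φ e (J := Sum.elim J fun _ => Unit) p q r'
    a fun l => b l.1
  refine Eq.trans h3 ?_
  congr 1
  funext x
  cases x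
  · rfl
  · exact A.act_one _

theorem mk_mulPart_comp_right (e : V.Op) {I L : Type} [Finite I] [Finite L] {J : L → Type}
    [∀ i, Finite (J i)] (p : V.Part I) (q : V.Part L) (r : ∀ i, P.obj (J i))
    (a : I → A.carrier) (b : (Σ i, J i) → A.carrier) :
    mk φ (V.mulPart e p (V.compPart q fun i => part φ (r i))) (Sum.elim a b) =
      mk φ (V.mulPart e p q) (Sum.elim a fun i => A.act (r i) fun j => b ⟨i, j⟩) := by
  have h1 : V.relabelPart (Equiv.sigmaPUnit I)
      (V.compPart p fun _ => part φ P.one) = p := φ.rightModule.act_one p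
  have h2 := mk_mulPart_relabel φ e (Equiv.sigmaPUnit I) (Equiv.refl _)
    (V.compPart p fun _ => part φ P.one) (V.compPart q fun i => part φ (r i)) a b
  rw [h1, show V.relabelPart (Equiv.refl _) (V.compPart q fun i => part φ (r i)) = _ from
    V.operad.relabel_refl _] at h2
  rw [h2]
  have : ∀ x, Finite (Sum.elim (fun _ : I => Unit) J x) := by
    rintro (i | l)
    · exact inferInstanceAs (Finite Unit)
    · exact inferInstanceAs (Finite (J l))
  let r' : ∀ x, P.obj (Sum.elim (fun _ : I => Unit) J x) := fun x =>
    Sum.rec (motive := fun x => P.obj (Sum.elim (fun _ : I => Unit) J x)) (fun _ => P.one) r x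
  have h3 := mk_mulPart_comp φ e (J := Sum.elim (fun _ => Unit) J) p q r'
    (fun i => a i.1) b
  refine Eq.trans h3 ?_
  congr 1
  funext x
  cases x
  · exact A.act_one _
  · rfl

theorem mk_add {I : Type} [Finite I] (p q : V.Part I) (a : I → A.carrier) :
    mk φ (p + q) a = mk φ p a + mk φ q a :=
  congrArg (fun m : MultilinearMap k _ _ => m a) (map_add (mkMulti φ) p q)

theorem mk_smul {I : Type} [Finite I] (c : k) (p : V.Part I) (a : I → A.carrier) :
    mk φ (c • p) a = c • mk φ p a :=
  congrArg (fun m : MultilinearMap k _ _ => m a) (map_smul (mkMulti φ) c p)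

/-- Right multiplication by `q(b)`, as a multilinear map. -/
noncomputable def mulMultiLeft (e : V.Op) {L : Type} [Finite L] (q : V.Part L) (b : L → A.carrier)
    {I : Type} [Finite I] :
    V.Part I →ₗ[k] MultilinearMap k (fun _ : I => A.carrier) (Envelope φ A) where
  toFun p :=
    { toFun := fun a => mulMulti φ e p q a b
      map_update_add' := fun a i x y => by rw [MultilinearMap.map_update_add]; rfl
      map_update_smul' := fun a i c x => by rw [MultilinearMap.map_update_smul]; rfl }
  map_add' p p' := MultilinearMap.ext fun a => by
    change mulMulti φ e (p + p') q a b = mulMulti φ e p q a b + mulMulti φ e p' q a b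
    simp only [mulMulti_apply, map_add, LinearMap.add_apply, mk_add]
  map_smul' c p := MultilinearMap.ext fun a => by
    change mulMulti φ e (c • p) q a b = c • mulMulti φ e p q a b
    simp only [mulMulti_apply, map_smul, LinearMap.smul_apply, mk_smul]

/-- Right multiplication by `q(b)` as a family of multilinear maps. -/
noncomputable def mulFamily (e : V.Op) {L : Type} [Finite L] (q : V.Part L) (b : L → A.carrier) :
    MultilinearFamily V.operad.toSymmSeq A.carrier (Envelope φ A) where
  app I _ := mulMultiLeft φ e q b
  app_relabel σ p a := by
    have h := mk_mulPart_relabel φ e σ (Equiv.refl _) p q a b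
    rwa [show V.relabelPart (Equiv.refl _) q = _ from V.operad.relabel_refl _] at h

/-- Right multiplication by `q(b)`. -/
noncomputable def mulRight (e : V.Op) {L : Type} [Finite L] (q : V.Part L) (b : L → A.carrier) :
    Envelope φ A →ₗ[k] Envelope φ A :=
  Relative.desc (M := φ.rightModule) (mulFamily φ e q b)
    ⟨fun p r a => mk_mulPart_comp_left φ e p q r a b⟩

theorem mulRight_mk (e : V.Op) {I L : Type} [Finite I] [Finite L] (p : V.Part I) (q : V.Part L)
    (a : I → A.carrier) (b : L → A.carrier) :
    mulRight φ e q b (mk φ p a) = mk φ (V.mulPart e p q) (Sum.elim a b) :=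
  Relative.desc_mk (M := φ.rightModule) _ _ p a

/-- Right multiplications as multilinear maps. -/
noncomputable def mulRightMulti (e : V.Op) {L : Type} [Finite L] : V.Part L →ₗ[k]
    MultilinearMap k (fun _ : L => A.carrier) (Envelope φ A →ₗ[k] Envelope φ A) where
  toFun q :=
    { toFun := mulRight φ e q
      map_update_add' := fun b i x y => hom_ext fun n p a => by
        simp only [LinearMap.add_apply, mulRight_mk, ← mulMulti_apply,
          MultilinearMap.map_update_add]
      map_update_smul' := fun b i c x => hom_ext fun n p a => by
        simp only [LinearMap.smul_apply, mulRight_mk, ← mulMulti_apply,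
          MultilinearMap.map_update_smul] }
  map_add' q q' := MultilinearMap.ext fun b => hom_ext fun n p a => by
    change mulRight φ e (q + q') b _ = mulRight φ e q b _ + mulRight φ e q' b _
    rw [mulRight_mk, mulRight_mk, mulRight_mk, map_add, mk_add]
  map_smul' c q := MultilinearMap.ext fun b => hom_ext fun n p a => by
    change mulRight φ e (c • q) b _ = c • mulRight φ e q b _
    rw [mulRight_mk, mulRight_mk, map_smul, mk_smul]

/-- Right multiplications as a family of multilinear maps. -/
noncomputable def mulRightFamily (e : V.Op) : MultilinearFamily V.operad.toSymmSeq A.carrier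
    (Envelope φ A →ₗ[k] Envelope φ A) where
  app L _ := mulRightMulti φ e
  app_relabel σ q b := hom_ext fun n p a => by
    change mulRight φ e (V.relabelPart σ q) b _ = mulRight φ e q _ _
    have h := mk_mulPart_relabel φ e (Equiv.refl _) σ p q a b
    rw [show V.relabelPart (Equiv.refl _) p = _ from V.operad.relabel_refl _] at h
    rw [mulRight_mk, h]
    exact (mulRight_mk φ e p q a _).symm

/-- The operations of the universal enveloping algebra. -/
noncomputable def op (e : V.Op) : Envelope φ A →ₗ[k] Envelope φ A →ₗ[k] Envelope φ A :=
  -- `mulRight` has already descended in the left factor. Here it descends in the right factor, as a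
  -- family with values in endomorphisms, and `flip` restores the order of arguments.
  (Relative.desc (M := φ.rightModule) (mulRightFamily φ e) ⟨fun q r b => hom_ext fun n p a => by
    change mulRight φ e (V.compPart q fun i => part φ (r i)) b _ = mulRight φ e q _ _
    rw [mulRight_mk]
    exact (mk_mulPart_comp_right φ e p q r a b).trans (mulRight_mk φ e p q a _).symm⟩).flip

theorem op_mk (e : V.Op) {I L : Type} [Finite I] [Finite L] (p : V.Part I) (q : V.Part L)
    (a : I → A.carrier) (b : L → A.carrier) :
    op φ e (mk φ p a) (mk φ q b) = mk φ (V.mulPart e p q) (Sum.elim a b) := by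
  refine Eq.trans ?_ (mulRight_mk φ e p q a b)
  exact congrArg (fun f : Envelope φ A →ₗ[k] Envelope φ A => f (mk φ p a))
    (Relative.desc_mk (M := φ.rightModule) _ _ q b)

end Envelope

end envelope
end FunctorialPBW

namespace FunctorialPBW

/-- A linear map that respects a multilinear operation on a spanning family respects it. -/
theorem map_multilinear_of_span {k B C : Type u} [Field k] [AddCommGroup B] [Module k B]
    [AddCommGroup C] [Module k C] {I : Type} [Finite I] {ι : Type u} {g : ι → B}
    (hg : Submodule.span k (Set.range g) = ⊤) (F : MultilinearMap k (fun _ : I => B) B)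
    (G : MultilinearMap k (fun _ : I => C) C) (d : B →ₗ[k] C)
    (h : ∀ x : I → ι, d (F fun i => g (x i)) = G fun i => d (g (x i))) (b : I → B) :
    d (F b) = G fun i => d (b i) :=
  congrArg (fun m => m b) (MultilinearMap.ext_of_span_eq_top (φ := d.compMultilinearMap F)
    (φ' := G.compLinearMap fun _ => d) (fun _ => hg) h)

/-! ### Models of a variety as algebras over its operad -/

section model

variable {k : Type u} [Field k] (V : Variety k) {B : Type u} [AddCommGroup B] [Module k B]
  {o : V.Op → B →ₗ[k] B →ₗ[k] B} (h : V.IsModel o)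

theorem Variety.lift_rename {X Y : Type} (f : X → Y) (b : Y → B) (z : V.Free X) :
    V.lift o h b (V.rename f z) = V.lift o h (fun x => b (f x)) z := by
  simp only [rename, lift_lift, lift_gen]

/-- The multilinear operations on a model of the variety. -/
noncomputable def Variety.actPart {I : Type} [Finite I] :
    V.Part I →ₗ[k] MultilinearMap k (fun _ : I => B) B where
  toFun p :=
    { toFun := fun b => V.lift o h b p.1
      map_update_add' := fun b i x y => by
        obtain ⟨f, hf⟩ := V.lift_update h b i p.2
        rw [hf, hf, hf, map_add]
      map_update_smul' := fun b i c x => by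
        obtain ⟨f, hf⟩ := V.lift_update h b i p.2
        rw [hf, hf, map_smul] }
  map_add' p p' := MultilinearMap.ext fun b => map_add (V.lift o h b) p.1 p'.1
  map_smul' c p := MultilinearMap.ext fun b => map_smul (V.lift o h b) c p.1

theorem Variety.actPart_apply {I : Type} [Finite I] (p : V.Part I) (b : I → B) :
    V.actPart h p b = V.lift o h b p.1 := rfl

/-- A model of a variety is an algebra over its operad. -/
noncomputable def Variety.algOfModel : V.operad.Alg where
  carrier := B
  act := V.actPart h
  act_one b := V.lift_gen h b ()
  act_comp p q b := by
    change V.lift o h b (V.lift V.op _ _ p.1) = V.lift o h (fun i => V.lift o h _ (q i).1) p.1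
    simp only [lift_lift, lift_rename]
  act_relabel σ p b := V.lift_rename h σ b p.1

end model

namespace Envelope

variable {k : Type u} [Field k] {V : Variety k} {P : Operad k} (φ : Operad.Hom P V.operad)
  {A : P.Alg}

/-- The generator of the multilinear part of the free algebra on one variable. -/
noncomputable def onePart (V : Variety k) : V.Part Unit := V.operad.one

theorem onePart_coe (V : Variety k) : (onePart V).1 = V.gen () := rfl

/-- The canonical map from an algebra to its universal enveloping algebra. -/
noncomputable def unit : A.carrier →ₗ[k] Envelope φ A where
  toFun a := mk φ (onePart V) fun _ => a
  map_add' a b := by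
    have h := (mkMulti φ (A := A) (onePart V)).map_update_add (fun _ => 0) () a b
    simp only [mkMulti_apply, Function.update_eq_const_of_subsingleton] at h
    exact h
  map_smul' c a := by
    have h := (mkMulti φ (A := A) (onePart V)).map_update_smul (fun _ => 0) () c a
    simp only [mkMulti_apply, Function.update_eq_const_of_subsingleton] at h
    exact h

/-- Monomials are obtained from multilinear monomials by identification of variables. -/
theorem exists_mk_eq_eval {I : Type} (t : Mon V.Op I) :
    ∃ (J : Type) (_ : Finite J) (p : V.Part J) (f : J → I),
      V.rename f p.1 = (V.ideal I).mkQ (Finsupp.single t 1) ∧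
      (∀ a : I → A.carrier, mk φ p (fun j => a (f j)) = t.eval (op φ) fun i => unit φ (a i)) ∧
      Set.range f = {x | x ∈ t.vars} ∧ (t.vars.Nodup → Function.Injective f) := by
  induction t with
  | var x =>
    refine ⟨Unit, inferInstance, onePart V, fun _ => x, ?_, fun a => rfl, ?_,
      fun _ => Function.injective_of_subsingleton _⟩
    · rw [onePart_coe, Variety.rename, V.lift_gen]
      rfl
    · ext y
      simp [Mon.vars, eq_comm]
  | node e l r hl hr =>
    obtain ⟨J, hJ, p, f, h1, h2, h3, h4⟩ := hl
    obtain ⟨K, hK, q, g, h1', h2', h3', h4'⟩ := hr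
    refine ⟨J ⊕ K, inferInstance, V.mulPart e p q, Sum.elim f g, ?_, ?_, ?_, ?_⟩
    · rw [V.mulPart_coe, Variety.rename, V.lift_op, V.lift_rename, V.lift_rename]
      change V.op e (V.rename f p.1) (V.rename g q.1) = _
      rw [h1, h1', V.op_mk, Poly.op_single]
    · intro a
      rw [Mon.eval, ← h2, ← h2', op_mk]
      congr 1
      funext x
      cases x <;> rfl
    · rw [Set.Sum.elim_range, h3, h3']
      ext x
      simp [Mon.vars]
    · intro h
      rw [Mon.vars, List.nodup_append'] at h
      refine (h4 h.1).sumElim (h4' h.2.1) fun j j' hjj => ?_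
      have hj : f j ∈ {x | x ∈ l.vars} := h3 ▸ ⟨j, rfl⟩
      have hj' : g j' ∈ {x | x ∈ r.vars} := h3' ▸ ⟨j', rfl⟩
      exact h.2.2 hj (hjj ▸ hj')

variable (h : V.IsModel (op φ (A := A)))

/-- The elements of the universal enveloping algebra are obtained from the generators by the
operations. -/
theorem mk_eq_lift {I : Type} [Finite I] (p : V.Part I) (a : I → A.carrier) :
    mk φ p a = V.lift (op φ) h (fun i => unit φ (a i)) p.1 := by
  obtain ⟨p, hp⟩ := p
  have key : ∀ F G : V.Part I →ₗ[k] Envelope φ A, (∀ t : Mon V.Op I, ∀ (ht : t.vars.Nodup)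
      (ht' : {x | x ∈ t.vars} = Set.univ),
      F ⟨_, Submodule.subset_span ⟨t, ht, ht', rfl⟩⟩ =
        G ⟨_, Submodule.subset_span ⟨t, ht, ht', rfl⟩⟩) → F = G := by
    intro F G hFG
    refine (Submodule.linearMap_eq_iff_of_eq_span F G rfl).2 ?_
    rintro ⟨_, t, ht, ht', rfl⟩
    exact hFG t ht ht'
  let F : V.Part I →ₗ[k] Envelope φ A :=
    { toFun := fun p => mk φ p a
      map_add' := fun p q => mk_add φ p q a
      map_smul' := fun c p => mk_smul φ c p a }
  refine LinearMap.congr_fun (f := F)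
    (g := V.lift (op φ) h (fun i => unit φ (a i)) ∘ₗ (V.Part I).subtype)
    (key _ _ fun t ht ht' => ?_) ⟨p, hp⟩
  obtain ⟨J, hJ, q, f, h1, h2, h3, h4⟩ := exists_mk_eq_eval φ (A := A) t
  -- In a multilinear monomial no variables are identified and all of them occur, so the renaming is
  -- a bijection.
  let σ := Equiv.ofBijective f ⟨h4 ht, Set.range_eq_univ.1 (h3.trans ht')⟩
  have hσ : V.relabelPart σ q = ⟨_, Submodule.subset_span ⟨t, ht, ht', rfl⟩⟩ := Subtype.ext h1
  rw [← hσ]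
  change mk φ (V.relabelPart σ q) a = V.lift (op φ) h _ (V.relabelPart σ q).1
  rw [mk_relabel, hσ]
  refine (h2 a).trans ?_
  exact (Poly.eval_single _ _ t).symm

/-- The universal enveloping algebra as an algebra. -/
noncomputable def alg : V.operad.Alg := V.algOfModel h

/-- By `mk_eq_lift` all elements involved are values at images of elements of `A`, and evaluation
after evaluation is substitution. -/
theorem alg_act_mk {I : Type} [Finite I] {J : I → Type} [∀ i, Finite (J i)] (p : V.Part I)
    (q : ∀ i, V.Part (J i)) (a : ∀ i, J i → A.carrier) :
    V.actPart h p (fun i => mk φ (q i) (a i)) = mk φ (V.compPart p q) fun x => a x.1 x.2 := by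
  rw [V.actPart_apply, mk_eq_lift φ h, V.compPart_coe, V.lift_lift]
  congr 2
  funext i
  rw [V.lift_rename, mk_eq_lift φ h]

/-- The canonical map is a morphism of algebras. -/
noncomputable def unitHom : A ⟶ φ.pullback.obj (alg φ h) where
  toLinearMap := unit φ
  map_act {I _} q a := by
    change unit φ (A.act q a) = V.actPart h (part φ q) fun i => unit φ (a i)
    rw [V.actPart_apply, ← mk_eq_lift φ h]
    -- An operation of `P` moves across the relative product as a substitution into the unit of the
    -- operad.
    have h1 := mk_comp φ (onePart V) (fun _ => q) fun x => a x.2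
    have h2 : V.relabelPart (Equiv.uniqueSigma fun _ : Unit => I)
      (V.compPart (onePart V) fun _ => part φ q) = part φ q := V.operad.one_comp (part φ q)
    rw [← h2, mk_relabel]
    exact h1.symm

/-- The family of multilinear maps given by a morphism to an algebra. -/
noncomputable def homFamily {B : V.operad.Alg} (f : A ⟶ φ.pullback.obj B) :
    MultilinearFamily V.operad.toSymmSeq A.carrier B.carrier :=
  MultilinearFamily.precomp ⟨fun I _ => B.act, B.act_relabel⟩ f.toLinearMap

/-- The linear map from the universal enveloping algebra given by a morphism to an algebra. -/
noncomputable def descLinear {B : V.operad.Alg} (f : A ⟶ φ.pullback.obj B) :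
    Envelope φ A →ₗ[k] B.carrier :=
  Relative.desc (M := φ.rightModule) (homFamily φ f) ⟨fun {I _ J _} p q a => by
    refine (B.act_comp p (fun i => φ.app (J i) (q i)) fun x => f.toLinearMap (a x)).trans ?_
    refine congrArg (B.act p) (funext fun i => ?_)
    exact (f.map_act (q i) fun j => a ⟨i, j⟩).symm⟩

theorem descLinear_mk {B : V.operad.Alg} (f : A ⟶ φ.pullback.obj B) {I : Type} [Finite I]
    (p : V.Part I) (a : I → A.carrier) :
    descLinear φ f (mk φ p a) = B.act (I := I) p fun i => f.toLinearMap (a i) :=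
  Relative.desc_mk (M := φ.rightModule) _ _ p a

/-- The morphism from the universal enveloping algebra given by a morphism to an algebra. -/
noncomputable def descHom {B : V.operad.Alg} (f : A ⟶ φ.pullback.obj B) : alg φ h ⟶ B where
  toLinearMap := descLinear φ f
  map_act {I _} p := map_multilinear_of_span (Relative.span_mk (M := φ.rightModule) (A := A))
    (V.actPart h p) (B.act p) (descLinear φ f) fun x => by
      refine (congrArg (descLinear φ f)
        (alg_act_mk φ h p (fun i => (x i).2.1) fun i => (x i).2.2)).trans ?_
      rw [descLinear_mk]
      refine (B.act_comp p (fun i => (x i).2.1) _).trans ?_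
      refine congrArg (B.act p) (funext fun i => ?_)
      exact (descLinear_mk φ f _ _).symm

/-- The universal property of the universal enveloping algebra. -/
noncomputable def homEquiv (B : V.operad.Alg) : (alg φ h ⟶ B) ≃ (A ⟶ φ.pullback.obj B) where
  toFun F := unitHom φ h ≫ φ.pullback.map F
  invFun f := descHom φ h f
  left_inv F := by
    refine Operad.Alg.Hom.ext (hom_ext fun n p a => ?_)
    refine (descLinear_mk φ _ p a).trans ?_
    -- A morphism is determined by its values on the image of `A`, which generates.
    rw [mk_eq_lift φ h]
    exact (F.map_act (I := Fin n) p fun i => unit φ (a i)).symm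
  right_inv f := by
    refine Operad.Alg.Hom.ext (LinearMap.ext fun a => ?_)
    exact (descLinear_mk φ f (onePart V) fun _ => a).trans (B.act_one _)

end Envelope
end FunctorialPBW

namespace FunctorialPBW

/-! ### The PBW property from freeness -/

section pbw

variable {k : Type u} [Field k]

/-- The PBW property follows from the freeness of the right module. -/
theorem hasPBWProperty_of_isFree {V : Variety k} {P : Operad k} (φ : Operad.Hom P V.operad)
    (h : ∀ A : P.Alg, V.IsModel (Envelope.op φ (A := A))) (hM : φ.rightModule.IsFree) :
    φ.HasPBWProperty := by
  obtain ⟨X, ι, e, he⟩ := hM.exists_equiv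
  have hn : ∀ (A : P.Alg) (B C : V.operad.Alg) (g : B ⟶ C) (f : Envelope.alg φ (h A) ⟶ B),
      Envelope.homEquiv φ (h A) C (f ≫ g) =
        Envelope.homEquiv φ (h A) B f ≫ φ.pullback.map g := fun A B C g f => rfl
  refine ⟨_, Adjunction.adjunctionOfEquivLeft (fun A B => Envelope.homEquiv φ (h A) B) hn,
    schurFunctor X, ⟨NatIso.ofComponents (fun A => (e A).symm.toModuleIso) ?_⟩⟩
  intro A B f
  refine ModuleCat.hom_ext ?_
  -- The linear map underlying the value of the left adjoint at `f`. Naturality means that it acts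
  -- on `x(a)` by applying `f` to the arguments, as the Schur functor does.
  let F : Envelope φ A →ₗ[k] Envelope φ B :=
    Envelope.descLinear φ (B := Envelope.alg φ (h B)) (f ≫ Envelope.unitHom φ (h B))
  have hF : ∀ (I : Type) [Finite I] (p : V.Part I) (a : I → A.carrier),
      F (Envelope.mk φ p a) = Envelope.mk φ p fun i => f.toLinearMap (a i) := by
    intro I _ p a
    rw [Envelope.mk_eq_lift φ (h B)]
    exact Envelope.descLinear_mk φ _ p a
  have key : F ∘ₗ (e A).toLinearMap = (e B).toLinearMap ∘ₗ Schur.map X f.toLinearMap := by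
    refine Schur.hom_ext fun n x a => ?_
    rw [LinearMap.comp_apply, LinearMap.comp_apply, Schur.map_mk]
    refine (congrArg F (he A _ x a)).trans ?_
    refine Eq.trans ?_ (he B _ x _).symm
    exact hF _ _ _
  refine LinearMap.ext fun z => ?_
  obtain ⟨z, rfl⟩ := (e A).surjective z
  change (e B).symm (F (e A z)) = Schur.map X f.toLinearMap ((e A).symm (e A z))
  rw [LinearEquiv.symm_apply_apply, LinearEquiv.symm_apply_eq]
  exact LinearMap.congr_fun key z

theorem trilinear_ext {U W : Type u} [AddCommGroup U] [Module k U] [AddCommGroup W] [Module k W]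
    {ι : Type u} {g : ι → U} (hg : Submodule.span k (Set.range g) = ⊤)
    {F G : U →ₗ[k] U →ₗ[k] U →ₗ[k] W} (h : ∀ x y z, F (g x) (g y) (g z) = G (g x) (g y) (g z)) :
    F = G :=
  LinearMap.ext_on_range hg fun x => LinearMap.ext_on_range hg fun y =>
    LinearMap.ext_on_range hg fun z => h x y z

end pbw

/-! ### Products of three elements of the enveloping algebra -/

section threefold

variable {k : Type u} [Field k] {V : Variety k}

/-- The product `(p ∘ q) ∘' r` of three multilinear elements. -/
noncomputable def mulThreeLeft {I J K : Type} (e e' : V.Op) (p : V.Part I)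
    (q : V.Part J) (r : V.Part K) : V.Part ((I ⊕ J) ⊕ K) :=
  V.mulPart e' (V.mulPart e p q) r

/-- The product `p ∘ (q ∘' r)` of three multilinear elements. -/
noncomputable def mulThreeRight {I J K : Type} (e e' : V.Op) (p : V.Part I)
    (q : V.Part J) (r : V.Part K) : V.Part ((I ⊕ J) ⊕ K) :=
  V.relabelPart (Equiv.sumAssoc I J K).symm (V.mulPart e p (V.mulPart e' q r))

variable {I J K : Type} (p : V.Part I) (q : V.Part J) (r : V.Part K)

theorem mulThreeLeft_coe (e e' : V.Op) : (mulThreeLeft e e' p q r).1 =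
    V.op e' (V.op e (V.rename (fun i => .inl (.inl i)) p.1)
      (V.rename (fun i => .inl (.inr i)) q.1)) (V.rename .inr r.1) := by
  simp only [mulThreeLeft, Variety.mulPart_coe, Variety.rename, Variety.lift_op,
    Variety.lift_lift, Variety.lift_gen]

theorem mulThreeRight_coe (e e' : V.Op) : (mulThreeRight e e' p q r).1 =
    V.op e (V.rename (fun i => .inl (.inl i)) p.1)
      (V.op e' (V.rename (fun i => .inl (.inr i)) q.1) (V.rename .inr r.1)) := by
  simp only [mulThreeRight, Variety.mulPart_coe, Variety.relabelPart_coe, Variety.rename,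
    Variety.lift_op, Variety.lift_lift, Variety.lift_gen]
  rfl

variable {P : Operad k} (φ : Operad.Hom P V.operad) {A : P.Alg} [Finite I] [Finite J] [Finite K]
  (a : I → A.carrier) (b : J → A.carrier) (c : K → A.carrier)

theorem op_op_mk_left (e e' : V.Op) :
    Envelope.op φ e' (Envelope.op φ e (Envelope.mk φ p a) (Envelope.mk φ q b))
      (Envelope.mk φ r c) =
    Envelope.mk φ (mulThreeLeft e e' p q r) (Sum.elim (Sum.elim a b) c) := by
  rw [Envelope.op_mk, Envelope.op_mk]
  rfl

theorem op_op_mk_right (e e' : V.Op) :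
    Envelope.op φ e (Envelope.mk φ p a)
      (Envelope.op φ e' (Envelope.mk φ q b) (Envelope.mk φ r c)) =
    Envelope.mk φ (mulThreeRight e e' p q r) (Sum.elim (Sum.elim a b) c) := by
  rw [Envelope.op_mk, Envelope.op_mk, mulThreeRight, Envelope.mk_relabel]
  congr 1
  funext x
  rcases x with x | x | x <;> rfl

/-- The linear map `p ↦ p(a)`. -/
noncomputable def Envelope.mkLinear : V.Part I →ₗ[k] Envelope φ A where
  toFun p := Envelope.mk φ p a
  map_add' p q := Envelope.mk_add φ p q a
  map_smul' c p := Envelope.mk_smul φ c p a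

end threefold

/-! ### The enveloping algebra is tridendriform -/

section tridendriform

variable {k : Type u} [Field k] {P : Operad k} (φ : Operad.Hom P (triDend k).operad)

/-- The operations of the universal enveloping tridendriform algebra. -/
noncomputable def envelopeOp (A : P.Alg) :
    TriDendOp → Envelope φ A →ₗ[k] Envelope φ A →ₗ[k] Envelope φ A := Envelope.op φ

/-- The trilinear map `(x ∘ y) ∘' z`. -/
noncomputable def trilinearLeft {U : Type u} [AddCommGroup U] [Module k U]
    (o : TriDendOp → U →ₗ[k] U →ₗ[k] U) (e e' : TriDendOp) : U →ₗ[k] U →ₗ[k] U →ₗ[k] U :=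
  (o e).compr₂ (o e')

/-- The trilinear map `x ∘ (y ∘' z)`. -/
noncomputable def trilinearRight {U : Type u} [AddCommGroup U] [Module k U]
    (o : TriDendOp → U →ₗ[k] U →ₗ[k] U) (e e' : TriDendOp) : U →ₗ[k] U →ₗ[k] U →ₗ[k] U :=
  (LinearMap.llcomp k U U U).compl₁₂ (o e) (o e')

/-- The identities are trilinear, so generators suffice. For each triple of generators they are the
images under a linear map of identities that hold in an auxiliary space, which may depend on the
triple. -/
theorem isModel_of_span {U : Type u} [AddCommGroup U] [Module k U]
    {o : TriDendOp → U →ₗ[k] U →ₗ[k] U} {ι : Type u} {g : ι → U}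
    (hg : Submodule.span k (Set.range g) = ⊤)
    (h : ∀ i j l, ∃ (F : Type u) (_ : AddCommGroup F) (_ : Module k F) (f : F →ₗ[k] U)
      (L R : TriDendOp → TriDendOp → F),
      (∀ e e', f (L e e') = o e' (o e (g i) (g j)) (g l)) ∧
      (∀ e e', f (R e e') = o e (g i) (o e' (g j) (g l))) ∧
      L .prec .prec = R .prec .prec + R .prec .succ + R .prec .dot ∧
      L .dot .prec = R .dot .prec ∧ L .dot .dot = R .dot .dot ∧ L .succ .prec = R .succ .prec ∧
      L .prec .dot = R .dot .succ ∧ L .succ .dot = R .succ .dot ∧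
      L .prec .succ + L .succ .succ + L .dot .succ = R .succ .succ) :
    (triDend k).IsModel o := by
  rw [isModel_triDend_iff]
  have h1 := trilinear_ext hg (F := trilinearLeft o .prec .prec) (G := trilinearRight o .prec .prec +
    trilinearRight o .prec .succ + trilinearRight o .prec .dot) fun i j l => by
      obtain ⟨F, _, _, f, L, R, hL, hR, h1, h2, h3, h4, h5, h6, h7⟩ := h i j l
      refine (hL _ _).symm.trans ?_
      rw [h1, map_add, map_add, hR, hR, hR]
      rfl
  have h2 := trilinear_ext hg (F := trilinearLeft o .dot .prec) (G := trilinearRight o .dot .prec)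
    fun i j l => by
      obtain ⟨F, _, _, f, L, R, hL, hR, h1, h2, h3, h4, h5, h6, h7⟩ := h i j l
      exact ((hL _ _).symm.trans (congrArg f h2)).trans (hR _ _)
  have h3 := trilinear_ext hg (F := trilinearLeft o .dot .dot) (G := trilinearRight o .dot .dot)
    fun i j l => by
      obtain ⟨F, _, _, f, L, R, hL, hR, h1, h2, h3, h4, h5, h6, h7⟩ := h i j l
      exact ((hL _ _).symm.trans (congrArg f h3)).trans (hR _ _)
  have h4 := trilinear_ext hg (F := trilinearLeft o .succ .prec) (G := trilinearRight o .succ .prec)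
    fun i j l => by
      obtain ⟨F, _, _, f, L, R, hL, hR, h1, h2, h3, h4, h5, h6, h7⟩ := h i j l
      exact ((hL _ _).symm.trans (congrArg f h4)).trans (hR _ _)
  have h5 := trilinear_ext hg (F := trilinearLeft o .prec .dot) (G := trilinearRight o .dot .succ)
    fun i j l => by
      obtain ⟨F, _, _, f, L, R, hL, hR, h1, h2, h3, h4, h5, h6, h7⟩ := h i j l
      exact ((hL _ _).symm.trans (congrArg f h5)).trans (hR _ _)
  have h6 := trilinear_ext hg (F := trilinearLeft o .succ .dot) (G := trilinearRight o .succ .dot)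
    fun i j l => by
      obtain ⟨F, _, _, f, L, R, hL, hR, h1, h2, h3, h4, h5, h6, h7⟩ := h i j l
      exact ((hL _ _).symm.trans (congrArg f h6)).trans (hR _ _)
  have h7 := trilinear_ext hg (F := trilinearLeft o .prec .succ + trilinearLeft o .succ .succ +
    trilinearLeft o .dot .succ) (G := trilinearRight o .succ .succ) fun i j l => by
      obtain ⟨F, _, _, f, L, R, hL, hR, h1, h2, h3, h4, h5, h6, h7⟩ := h i j l
      refine Eq.trans ?_ (hR _ _)
      rw [← h7, map_add, map_add, hL, hL, hL]
      rfl
  exact fun a b c => ⟨congrArg (fun F => F a b c) h1, congrArg (fun F => F a b c) h2,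
    congrArg (fun F => F a b c) h3, congrArg (fun F => F a b c) h4,
    congrArg (fun F => F a b c) h5, congrArg (fun F => F a b c) h6,
    congrArg (fun F => F a b c) h7⟩

variable (k) in
/-- The products `(p ∘ q) ∘' r` for tridendriform operations. -/
noncomputable def triThreeLeft {I J K : Type} (p : (triDend k).Part I) (q : (triDend k).Part J)
    (r : (triDend k).Part K) (e e' : TriDendOp) : (triDend k).Part ((I ⊕ J) ⊕ K) :=
  mulThreeLeft (V := triDend k) e e' p q r

variable (k) in
/-- The products `p ∘ (q ∘' r)` for tridendriform operations. -/
noncomputable def triThreeRight {I J K : Type} (p : (triDend k).Part I) (q : (triDend k).Part J)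
    (r : (triDend k).Part K) (e e' : TriDendOp) : (triDend k).Part ((I ⊕ J) ⊕ K) :=
  mulThreeRight (V := triDend k) e e' p q r

/-- For `p(a)`, `q(b)`, `r(c)` the auxiliary space is the multilinear part on the disjoint union of
the three sets of inputs. The identities hold there because they hold in the free tridendriform
algebra, and evaluation at `a, b, c` carries them over. -/
theorem isModel_envelopeOp (A : P.Alg) : (triDend k).IsModel (envelopeOp φ A) := by
  refine isModel_of_span (Relative.span_mk (M := φ.rightModule) (A := A)) ?_
  have key := fun (n m l : ℕ) (p : (triDend k).Part (Fin n)) (q : (triDend k).Part (Fin m))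
      (r : (triDend k).Part (Fin l)) =>
    (isModel_triDend_iff (triOp k ((Fin n ⊕ Fin m) ⊕ Fin l))).1 (isModel_triOp k _)
      ((triDend k).rename (fun i => .inl (.inl i)) p.1)
      ((triDend k).rename (fun i => .inl (.inr i)) q.1) ((triDend k).rename .inr r.1)
  rintro ⟨n, p, a⟩ ⟨m, q, b⟩ ⟨l, r, c⟩
  obtain ⟨h1, h2, h3, h4, h5, h6, h7⟩ := key n m l p q r
  have hL := fun e e' => mulThreeLeft_coe (V := triDend k) p q r e e'
  have hR := fun e e' => mulThreeRight_coe (V := triDend k) p q r e e'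
  have hL' := fun e e' => (op_op_mk_left (V := triDend k) p q r φ a b c e e').symm
  have hR' := fun e e' => (op_op_mk_right (V := triDend k) p q r φ a b c e e').symm
  refine ⟨(triDend k).Part ((Fin n ⊕ Fin m) ⊕ Fin l), inferInstance, inferInstance,
    Envelope.mkLinear φ (Sum.elim (Sum.elim a b) c), triThreeLeft k p q r,
    triThreeRight k p q r, hL', hR',
    Subtype.ext ?_, Subtype.ext ?_, Subtype.ext ?_, Subtype.ext ?_, Subtype.ext ?_, Subtype.ext ?_,
    Subtype.ext ?_⟩
  · exact (hL _ _).trans (h1.trans (congrArg₂ _ (congrArg₂ _ (hR _ _).symm (hR _ _).symm)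
      (hR _ _).symm))
  · exact (hL _ _).trans (h2.trans (hR _ _).symm)
  · exact (hL _ _).trans (h3.trans (hR _ _).symm)
  · exact (hL _ _).trans (h4.trans (hR _ _).symm)
  · exact (hL _ _).trans (h5.trans (hR _ _).symm)
  · exact (hL _ _).trans (h6.trans (hR _ _).symm)
  · exact (congrArg₂ _ (congrArg₂ _ (hL _ _) (hL _ _)) (hL _ _)).trans (h7.trans (hR _ _).symm)

end tridendriform
end FunctorialPBW

theorem mainTheorem2 (k : Type u) [Field k] [CharZero k] :
    (FunctorialPBW.phi k).HasPBWProperty ∧ (FunctorialPBW.phi k).rightModule.IsFree := by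
  exact ⟨FunctorialPBW.hasPBWProperty_of_isFree (V := FunctorialPBW.triDend k) (FunctorialPBW.phi k)
    (FunctorialPBW.isModel_envelopeOp (FunctorialPBW.phi k)) FunctorialPBW.isFree_rightModule_phi,
    FunctorialPBW.isFree_rightModule_phi⟩
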